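/- Let $n$ be a natural number, let $p\in C^1(\mathbb R^n)$ be real valued, and let $D\subset\mathbb R^n$ be a bounded open set with $1<\inf_{D}p\le\sup_{D}p<\infty$. Let $\varepsilon>0$. *Notions.* For $\varphi\in C^2(D)$ and $x\in D$ with $D\varphi(x)\ne0$ put $$\Delta_{p(x)}\varphi(x)=|D\varphi(x)|^{p(x)-2}\Big(\Delta\varphi(x)+Dp(x)\cdot D\varphi(x)\,\log|D\varphi(x)|+(p(x)-2)\,D^2\varphi(x)\tfrac{D\varphi(x)}{|D\varphi(x)|}\cdot\tfrac{D\varphi(x)}{|D\varphi(x)|}\Big).$$ A function $v:D\to(-\infty,\infty]$ is a *viscosity supersolution* of $-\Delta_{p(x)}v=0$ in $D$ if it is lower semicontinuous, finite almost everywhere, and $-\Delta_{p(x)}\varphi(x_0)\ge0$ whenever $x_0\in D$ and $\varphi\in C^2(D)$ satisfy $v(x_0)=\varphi(x_0)$, $v(x)>\varphi(x)$ for all $x\in D\setminus\{x_0\}$, and $D\varphi(x_0)\neq0$. A function $u:D\to[-\infty,\infty)$ is a *viscosity subsolution* if it is upper semicontinuous, finite almost everywhere, and $-\Delta_{p(x)}\varphi(x_0)\le0$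 whenever $x_0\in D$ and $\varphi\in C^2(D)$ satisfy $u(x_0)=\varphi(x_0)$, $u(x)<\varphi(x)$ for all $x\in D\setminus\{x_0\}$, and $D\varphi(x_0)\neq0$. For $c\in\mathbb R$, a *weak solution* of $-\Delta_{p(x)}h=c$ in $D$ is a function $h\in W^{1,p(\cdot)}_{\mathrm{loc}}(D)$ with $$\int_D|Dh(x)|^{p(x)-2}Dh(x)\cdot D\varphi(x)\,dx=\int_D c\,\varphi(x)\,dx\qquad\text{for all }\varphi\in C_0^\infty(D).$$ *Proposition.* (i) Let $v$ be a viscosity supersolution of $-\Delta_{p(x)}v=0$ in $D$, and let $h$ be a locally Lipschitz continuous weak solution of $-\Delta_{p(x)}h=-\varepsilon$ in $D$. If $v\ge h$ on $\partial D$, in the sense that $\liminf_{D\ni x\to z}\,(v(x)-h(x))\ge0$ for every $z\in\partial D$, then $v\ge h$ in $D$. (ii) Let $u$ be a viscosity subsolution of $-\Delta_{p(x)}u=0$ in $D$, and let $h$ be a locally Lipschitz continuous weak solution of $-\Delta_{p(x)}h=\varepsilon$ in $D$. If $u\le h$ on $\partial D$, in the sense that $\limsup_{D\ni x\to z}\,(u(x)-h(x))\le0$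 for every $z\in\partial D$, then $u\le h$ in $D$. -/

import Mathlib

open MeasureTheory Filter Topology TopologicalSpace Set
open scoped Distributions Laplacian

noncomputable section

namespace PxLaplace

/-- Membership of `f` in the variable exponent Lebesgue space `L^{p(·)}(Ω)`: `f` is measurable and
its modular `∫_Ω |f(x)|^{p(x)} dx` is finite. -/
def MemVarLp {n : ℕ} {F : Type*} [NormedAddCommGroup F] (p : EuclideanSpace ℝ (Fin n) → ℝ)
    (Ω : Opens (EuclideanSpace ℝ (Fin n))) (f : EuclideanSpace ℝ (Fin n) → F) : Prop :=
  AEStronglyMeasurable f (volume.restrict (Ω : Set (EuclideanSpace ℝ (Fin n)))) ∧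
    ∫⁻ x in (Ω : Set (EuclideanSpace ℝ (Fin n))), ENNReal.ofReal (‖f x‖ ^ p x) < ⊤

/-- `G` is the weak (distributional) gradient of `u` in `Ω`; the test functions are
`𝓓(Ω, ℝ)`, that is `C_0^∞(Ω)`. -/
def HasWeakGradient {n : ℕ} (Ω : Opens (EuclideanSpace ℝ (Fin n)))
    (u : EuclideanSpace ℝ (Fin n) → ℝ)
    (G : EuclideanSpace ℝ (Fin n) → EuclideanSpace ℝ (Fin n)) : Prop :=
  LocallyIntegrableOn u (Ω : Set (EuclideanSpace ℝ (Fin n))) ∧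
  LocallyIntegrableOn G (Ω : Set (EuclideanSpace ℝ (Fin n))) ∧
  ∀ φ : 𝓓(Ω, ℝ),
    ∫ x in (Ω : Set (EuclideanSpace ℝ (Fin n))), u x • gradient φ x =
      -∫ x in (Ω : Set (EuclideanSpace ℝ (Fin n))), φ x • G x

/-- `u ∈ W^{1,p(·)}_loc(Ω)` with weak gradient `G`: both `u` and `G` are in `L^{p(·)}(Ω')` for every
open `Ω'` compactly contained in `Ω`. -/
def MemSobolevLocWith {n : ℕ} (p : EuclideanSpace ℝ (Fin n) → ℝ)
    (Ω : Opens (EuclideanSpace ℝ (Fin n))) (u : EuclideanSpace ℝ (Fin n) → ℝ)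
    (G : EuclideanSpace ℝ (Fin n) → EuclideanSpace ℝ (Fin n)) : Prop :=
  HasWeakGradient Ω u G ∧
  ∀ Ω' : Opens (EuclideanSpace ℝ (Fin n)),
    IsCompact (closure (Ω' : Set (EuclideanSpace ℝ (Fin n)))) →
    closure (Ω' : Set (EuclideanSpace ℝ (Fin n))) ⊆ Ω →
    MemVarLp p Ω' u ∧ MemVarLp p Ω' G

/-- `v ∈ W^{1,p(·)}_loc(Ω)` is a weak solution of `-div(|Dv|^{p(x)-2} Dv) = c` in `Ω`.
(Where `Dv = 0`, the field `|Dv|^{p(x)-2} Dv` is zero.) -/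
def IsWeakSolution {n : ℕ} (p : EuclideanSpace ℝ (Fin n) → ℝ) (c : ℝ)
    (Ω : Opens (EuclideanSpace ℝ (Fin n))) (v : EuclideanSpace ℝ (Fin n) → ℝ) : Prop :=
  ∃ G : EuclideanSpace ℝ (Fin n) → EuclideanSpace ℝ (Fin n),
    MemSobolevLocWith p Ω v G ∧
    ∀ φ : 𝓓(Ω, ℝ),
      ∫ x in (Ω : Set (EuclideanSpace ℝ (Fin n))),
          inner ℝ (‖G x‖ ^ (p x - 2) • G x) (gradient φ x) =
        ∫ x in (Ω : Set (EuclideanSpace ℝ (Fin n))), c * φ x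

/-- The normalized `∞`-Laplacian `D²φ(x) ν · ν`, `ν = Dφ(x) / |Dφ(x)|`
(used only where `Dφ(x) ≠ 0`). -/
def normalizedInfLaplacian {n : ℕ} (φ : EuclideanSpace ℝ (Fin n) → ℝ)
    (x : EuclideanSpace ℝ (Fin n)) : ℝ :=
  fderiv ℝ (fderiv ℝ φ) x (‖gradient φ x‖⁻¹ • gradient φ x) (‖gradient φ x‖⁻¹ • gradient φ x)

/-- The pointwise value of `Δ_{p(x)} φ` for a `C²` function `φ`, with the divergence carried out
(used only where `Dφ(x) ≠ 0`). -/
def pxLaplacian {n : ℕ} (p : EuclideanSpace ℝ (Fin n) → ℝ) (φ : EuclideanSpace ℝ (Fin n) → ℝ)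
    (x : EuclideanSpace ℝ (Fin n)) : ℝ :=
  ‖gradient φ x‖ ^ (p x - 2) *
    (Δ φ x + inner ℝ (gradient p x) (gradient φ x) * Real.log ‖gradient φ x‖
      + (p x - 2) * normalizedInfLaplacian φ x)

/-- Viscosity supersolutions `v : Ω → (-∞, ∞]` of `-Δ_{p(x)} v = 0`. Only the values of `v` in `Ω`
matter. -/
structure IsViscositySupersolution {n : ℕ} (p : EuclideanSpace ℝ (Fin n) → ℝ)
    (Ω : Opens (EuclideanSpace ℝ (Fin n))) (v : EuclideanSpace ℝ (Fin n) → EReal) : Prop where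
  ne_bot : ∀ x ∈ Ω, v x ≠ ⊥
  lsc : LowerSemicontinuousOn v (Ω : Set (EuclideanSpace ℝ (Fin n)))
  finite_ae : ∀ᵐ x ∂(volume.restrict (Ω : Set (EuclideanSpace ℝ (Fin n)))), v x ≠ ⊤
  touching : ∀ φ : EuclideanSpace ℝ (Fin n) → ℝ,
    ContDiffOn ℝ 2 φ (Ω : Set (EuclideanSpace ℝ (Fin n))) →
    ∀ x₀ ∈ Ω, v x₀ = (φ x₀ : EReal) → (∀ x ∈ Ω, x ≠ x₀ → (φ x : EReal) < v x) →
      gradient φ x₀ ≠ 0 → 0 ≤ -pxLaplacian p φ x₀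

/-- Viscosity subsolutions `u : Ω → [-∞, ∞)` of `-Δ_{p(x)} u = 0`. Only the values of `u` in `Ω`
matter. -/
structure IsViscositySubsolution {n : ℕ} (p : EuclideanSpace ℝ (Fin n) → ℝ)
    (Ω : Opens (EuclideanSpace ℝ (Fin n))) (u : EuclideanSpace ℝ (Fin n) → EReal) : Prop where
  ne_top : ∀ x ∈ Ω, u x ≠ ⊤
  usc : UpperSemicontinuousOn u (Ω : Set (EuclideanSpace ℝ (Fin n)))
  finite_ae : ∀ᵐ x ∂(volume.restrict (Ω : Set (EuclideanSpace ℝ (Fin n)))), u x ≠ ⊥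
  touching : ∀ φ : EuclideanSpace ℝ (Fin n) → ℝ,
    ContDiffOn ℝ 2 φ (Ω : Set (EuclideanSpace ℝ (Fin n))) →
    ∀ x₀ ∈ Ω, u x₀ = (φ x₀ : EReal) → (∀ x ∈ Ω, x ≠ x₀ → u x < (φ x : EReal)) →
      gradient φ x₀ ≠ 0 → -pxLaplacian p φ x₀ ≤ 0

end PxLaplace

end

/-! Part (ii) is part (i) applied to `-u` and `-h`, since the operator is odd. For (i), suppose `v <
h` somewhere. The boundary condition confines the points where `v ≤ h - m/2` to a compact subset of
`D`, so everything takes place on a compact `K ⊆ D`, where `h` is Lipschitz and `v` can be truncated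
to a real function `u`. Three points are used instead of the usual two: one maximizes `h y - u z - k
(x - y) - k (x - z)` over `x` and over `y, z ∈ K`, where `k` is a large multiple of a kernel equal
to `‖w‖ ^ (2 * (q + 1))` near the origin. The multiple is fixed, not sent to infinity; it only has
to make the points close.

Second-order information at a maximum comes from `exists_contact_jets`. Maximizing in `y` and `z`
separately turns the functional into a sum of two semiconvex sup-convolutions of `x`.
`exists_regularization` replaces them by `C^{1,1}` functions `F` and `G` without destroying any
contact up to affine functions. As the linear perturbation varies, the slopes of `F - G` at contact
points fill a ball, so the contact set is not null, and Rademacher's theorem for `fderiv F` and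
`fderiv G` yields a contact point where both are twice differentiable. Their ordered Hessians `X ≤
Y` transfer to `h` at `y` and to `v` at `z`; at `z` one may move `x` by `S e` while `z` moves by
`e`, for any linear `S`, at the price of a Hessian of `k` on `(S - id) e`. Removing the perturbation
by compactness is `exists_maximizer_jets`.

The function `h` is only a weak solution. `le_divergence_of_touching_above` makes it a strict
viscosity subsolution: if `Q` touches it from above and the flux of `Q` is `C^1`, the divergence of
that flux is at least `ε` at the contact point. This also works at critical points, where
`not_eventually_le_norm_pow` uses it to exclude a vanishing gradient `η` of the kernel: a
sufficiently flat power has zero divergence there.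

It remains to compare the operators with exponents `p y` and `p z`
(`pxOperator_le_of_forall_pxOperator_le`). Choosing `S` as the stretch by `√((p y - 1) / (p z - 1))`
along `η` makes the Hessian terms cancel. The error from `k` is of order `‖x - z‖ * ‖η‖ ^ (p y -
1)`, and the logarithmic terms differ by at most `‖Dp y - Dp z‖ * ‖η‖ ^ (p y - 1) * |log ‖η‖|`. As
`‖η‖` is bounded by the Lipschitz constant of `h`, both are small when the points are close, which
contradicts the lower bound `ε`. -/

noncomputable section
namespace PxLaplace

/-! ### Convex functions, `C^{1,1}` regularity and envelopes by paraboloids. -/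

section ConvexAnalysis

variable {E : Type*} [NormedAddCommGroup E] [InnerProductSpace ℝ E]

theorem convexOn_of_affine_support {U : E → ℝ}
    (h : ∀ x, ∃ b : E →L[ℝ] ℝ, ∀ y, U x + b (y - x) ≤ U y) : ConvexOn ℝ univ U := by
  refine ⟨convex_univ, fun x _ y _ s t hs ht hst => ?_⟩
  obtain ⟨b, hb⟩ := h (s • x + t • y)
  have h1 := hb x
  have h2 := hb y
  have e : s * b (x - (s • x + t • y)) + t * b (y - (s • x + t • y)) = 0 := by
    rw [← smul_eq_mul, ← smul_eq_mul, ← map_smul, ← map_smul, ← map_add]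
    have : s • (x - (s • x + t • y)) + t • (y - (s • x + t • y)) = 0 := by
      have hs' : s = 1 - t := by linarith
      subst hs'
      module
    rw [this, map_zero]
  simp only [smul_eq_mul]
  have h3 := mul_le_mul_of_nonneg_left h1 hs
  have h4 := mul_le_mul_of_nonneg_left h2 ht
  rw [mul_add] at h3 h4
  have h5 : (s + t) * U (s • x + t • y) = U (s • x + t • y) := by rw [hst, one_mul]
  rw [add_mul] at h5
  linarith

/-- Scaling `e` by `t → 0` kills the quadratic term, and a linear inequality valid for both `e` and
`-e` is an equality. -/
theorem eq_of_le_add_sq {b d : E →L[ℝ] ℝ} {c : ℝ} (h : ∀ e, b e ≤ d e + c * ‖e‖ ^ 2) : b = d := by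
  have key : ∀ e, b e ≤ d e := by
    intro e
    have h1 : ∀ t > (0 : ℝ), b e ≤ d e + t * (c * ‖e‖ ^ 2) := by
      intro t ht
      have := h (t • e)
      rw [map_smul, map_smul, norm_smul, mul_pow, smul_eq_mul, smul_eq_mul, Real.norm_eq_abs,
        sq_abs] at this
      have h2 : t * b e ≤ t * (d e + t * (c * ‖e‖ ^ 2)) := by nlinarith
      exact le_of_mul_le_mul_left h2 ht
    have h2 : Tendsto (fun t : ℝ => d e + t * (c * ‖e‖ ^ 2)) (𝓝[>] 0)
        (𝓝 (d e + 0 * (c * ‖e‖ ^ 2))) :=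
      ((continuous_const.add (continuous_id.mul continuous_const)).tendsto 0).mono_left
        nhdsWithin_le_nhds
    have := ge_of_tendsto h2 (eventually_nhdsWithin_of_forall h1)
    simpa using this
  ext e
  have h1 := key e
  have h2 := key (-e)
  simp only [map_neg] at h2
  linarith

variable [FiniteDimensional ℝ E]

theorem exists_affine_support {U : E → ℝ} (hU : ConvexOn ℝ univ U) (x : E) :
    ∃ b : E →L[ℝ] ℝ, ∀ y, U x + b (y - x) ≤ U y := by
  have hc : Continuous U := by
    simpa [continuousOn_univ] using hU.continuousOn isOpen_univ
  have hs : Convex ℝ {q : E × ℝ | q.1 ∈ univ ∧ U q.1 < q.2} := hU.convex_strict_epigraph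
  have ho : IsOpen {q : E × ℝ | q.1 ∈ univ ∧ U q.1 < q.2} := by
    simpa using isOpen_lt (hc.comp continuous_fst) continuous_snd
  obtain ⟨L, hL⟩ := geometric_hahn_banach_open_point (x := (x, U x)) hs ho (by simp)
  have hdec : ∀ y t, L (y, t) = L (y, 0) + t * L (0, 1) := by
    intro y t
    have : ((y, t) : E × ℝ) = (y, 0) + t • ((0, 1) : E × ℝ) := by simp
    rw [this, map_add, map_smul, smul_eq_mul]
  -- The separating hyperplane is not vertical, because a point straight above `(x, U x)` lies in
  -- the open epigraph.
  have hneg : L (0, 1) < 0 := by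
    have := hL (x, U x + 1) (by simp)
    rw [hdec x (U x + 1), hdec x (U x)] at this
    linarith
  have hle : ∀ y, L (y, 0) + U y * L (0, 1) ≤ L (x, 0) + U x * L (0, 1) := by
    intro y
    have h1 : ∀ t > U y, L (y, 0) + t * L (0, 1) ≤ L (x, 0) + U x * L (0, 1) := by
      intro t ht
      rw [← hdec, ← hdec]
      exact (hL (y, t) (by simpa using ht)).le
    have h2 : Tendsto (fun t : ℝ => L (y, 0) + t * L (0, 1)) (𝓝[>] (U y))
        (𝓝 (L (y, 0) + U y * L (0, 1))) :=
      ((continuous_const.add (continuous_id.mul continuous_const)).tendsto (U y)).mono_left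
        nhdsWithin_le_nhds
    exact le_of_tendsto h2 (eventually_nhdsWithin_of_forall h1)
  refine ⟨(-(L (0, 1)))⁻¹ • L.comp (.inl ℝ E ℝ), fun y => ?_⟩
  have h3 : L (y - x, 0) = L (y, 0) - L (x, 0) := by
    rw [← map_sub]; simp
  have h4 : 0 < -(L (0, 1)) := by linarith
  have h5 : (-(L (0, 1)))⁻¹ * (L (y, 0) - L (x, 0)) ≤ U y - U x := by
    rw [inv_mul_le_iff₀ h4]
    linarith [hle y]
  simp only [_root_.smul_apply, ContinuousLinearMap.comp_apply,
    ContinuousLinearMap.inl_apply, smul_eq_mul, h3]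
  linarith

/-- At each point `U` is squeezed between an affine function and a paraboloid of opening `c`
touching there; their slopes must agree, and the common slope is the derivative. -/
theorem differentiable_lipschitz_fderiv_of_convex {U : E → ℝ} {c : ℝ} (hc : 0 ≤ c)
    (hU : ConvexOn ℝ univ U) (hV : ConvexOn ℝ univ fun x => c * ‖x‖ ^ 2 - U x) :
    Differentiable ℝ U ∧ ∃ K, LipschitzWith K (fderiv ℝ U) := by
  have hsupp : ∀ x, ∃ b : E →L[ℝ] ℝ, ∀ y, U x + b (y - x) ≤ U y ∧
      U y ≤ U x + b (y - x) + c * ‖y - x‖ ^ 2 := by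
    intro x
    obtain ⟨b, hb⟩ := exists_affine_support hU x
    obtain ⟨d, hd⟩ := exists_affine_support hV x
    set d' : E →L[ℝ] ℝ := (2 * c) • innerSL ℝ x - d with hd'
    have hup : ∀ y, U y ≤ U x + d' (y - x) + c * ‖y - x‖ ^ 2 := by
      intro y
      have h1 := hd y
      have h2 : ‖y‖ ^ 2 = ‖x‖ ^ 2 + 2 * inner ℝ x (y - x) + ‖y - x‖ ^ 2 := by
        rw [← norm_add_sq_real]; simp
      simp only [hd', _root_.sub_apply, _root_.smul_apply,
        innerSL_apply_apply, smul_eq_mul]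
      simp only [h2] at h1
      nlinarith
    have hbd : b = d' := by
      apply eq_of_le_add_sq (c := c)
      intro e
      have h1 := hb (x + e)
      have h2 := hup (x + e)
      simp only [add_sub_cancel_left] at h1 h2
      linarith
    exact ⟨b, fun y => ⟨hb y, by rw [hbd]; exact hup y⟩⟩
  choose b hb using hsupp
  have hder : ∀ x, HasFDerivAt U (b x) x := by
    intro x
    rw [hasFDerivAt_iff_isLittleO_nhds_zero]
    refine Asymptotics.IsBigO.trans_isLittleO (g := fun h : E => ‖h‖ ^ 2) ?_ ?_
    · refine Asymptotics.IsBigO.of_bound c (Eventually.of_forall fun h => ?_)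
      obtain ⟨h1, h2⟩ := hb x (x + h)
      simp only [add_sub_cancel_left] at h1 h2
      rw [Real.norm_eq_abs, Real.norm_eq_abs, abs_of_nonneg (by linarith),
        abs_of_nonneg (by positivity)]
      linarith
    · exact Asymptotics.isLittleO_norm_pow_id one_lt_two
  refine ⟨fun x => (hder x).differentiableAt, Real.toNNReal (2 * c), ?_⟩
  have hfd : fderiv ℝ U = b := funext fun x => (hder x).fderiv
  rw [hfd]
  refine LipschitzWith.of_dist_le_mul fun x y => ?_
  rw [dist_eq_norm, dist_eq_norm, Real.coe_toNNReal _ (by linarith)]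
  -- Chain the lower bound at `x` and the upper bound at `y`, both evaluated at `y + e`, with the
  -- upper bound at `x` evaluated at `y`. Taking `‖e‖ = ‖x - y‖` balances the two quadratic terms.
  have key : ∀ e, ‖e‖ = ‖x - y‖ → (b x - b y) e ≤ 2 * c * ‖x - y‖ ^ 2 := by
    intro e he
    have h1 := (hb x (y + e)).1
    have h2 := (hb y (y + e)).2
    have h3 := (hb x y).2
    have h4 : b x (y + e - x) = b x (y - x) + b x e := by rw [← map_add]; congr 1; abel
    rw [norm_sub_rev y x] at h3
    simp only [add_sub_cancel_left, he] at h2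
    rw [_root_.sub_apply]
    linarith
  refine ContinuousLinearMap.opNorm_le_bound _ (by positivity) fun v => ?_
  have key2 : ∀ v : E, (b x - b y) v ≤ 2 * c * ‖x - y‖ * ‖v‖ := by
    intro v
    rcases eq_or_ne v 0 with rfl | hv
    · simp
    rcases eq_or_lt_of_le (norm_nonneg (x - y)) with h0 | h0
    · have : x = y := sub_eq_zero.1 (norm_eq_zero.1 h0.symm)
      simp [this]
    have hv' : 0 < ‖v‖ := norm_pos_iff.2 hv
    have h1 := key ((‖x - y‖ / ‖v‖) • v) (by
      rw [norm_smul, Real.norm_of_nonneg (by positivity)]; field_simp)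
    rw [map_smul, smul_eq_mul, div_mul_eq_mul_div, div_le_iff₀ hv'] at h1
    nlinarith
  rw [Real.norm_eq_abs, abs_le]
  refine ⟨?_, key2 v⟩
  have := key2 (-v)
  rw [map_neg, norm_neg] at this
  linarith

/-- The envelope is the infimum of all paraboloids of opening `2 * a` lying above `φ`: `B z` is the
least admissible height for vertex `z`. An infimum of such paraboloids is semiconcave, and it stays
convex because `B` is a supremum of translates of the convex `φ` and the infimum is an
inf-convolution. The last clause is minimality, through which inequalities between two functions
survive regularization. -/
theorem exists_convex_envelope {φ : E → ℝ} (hφ : ConvexOn ℝ univ φ) {a c : ℝ} (ha : 0 < a)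
    (hgrow : ∀ y, φ y ≤ c + a * ‖y‖ ^ 2) :
    ∃ U : E → ℝ, ConvexOn ℝ univ U ∧ Differentiable ℝ U ∧ (∃ K, LipschitzWith K (fderiv ℝ U)) ∧
      (∀ x, φ x ≤ U x) ∧ ∀ (α : ℝ) (b : E →L[ℝ] ℝ), (∀ y, φ y ≤ α + b y + 2 * a * ‖y‖ ^ 2) →
        ∀ x, U x ≤ α + b x + 2 * a * ‖x‖ ^ 2 := by
  set B : E → ℝ := fun z => ⨆ e, φ (z + e) - 2 * a * ‖e‖ ^ 2 with hB
  have hbdd : ∀ z, BddAbove (range fun e => φ (z + e) - 2 * a * ‖e‖ ^ 2) := by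
    intro z
    refine ⟨c + 2 * a * ‖z‖ ^ 2, ?_⟩
    rintro _ ⟨e, rfl⟩
    have h1 := hgrow (z + e)
    have h2 : ‖z + e‖ ^ 2 ≤ 2 * ‖z‖ ^ 2 + 2 * ‖e‖ ^ 2 := by
      have := norm_add_le z e
      nlinarith [sq_nonneg (‖z‖ - ‖e‖), norm_nonneg (z + e), norm_nonneg z, norm_nonneg e]
    simp only
    nlinarith
  have hBle : ∀ z e, φ (z + e) - 2 * a * ‖e‖ ^ 2 ≤ B z := fun z e => le_ciSup (hbdd z) e
  set U : E → ℝ := fun x => ⨅ z, B z + 2 * a * ‖x - z‖ ^ 2 with hUdef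
  have hlow : ∀ x z, φ x ≤ B z + 2 * a * ‖x - z‖ ^ 2 := by
    intro x z
    have := hBle z (x - z)
    rw [add_sub_cancel] at this
    linarith
  have hbdd' : ∀ x, BddBelow (range fun z => B z + 2 * a * ‖x - z‖ ^ 2) := by
    intro x
    refine ⟨φ x, ?_⟩
    rintro _ ⟨z, rfl⟩
    exact hlow x z
  have hUle : ∀ x z, U x ≤ B z + 2 * a * ‖x - z‖ ^ 2 := fun x z => ciInf_le (hbdd' x) z
  have hφU : ∀ x, φ x ≤ U x := fun x => le_ciInf (hlow x)
  have hsq : ∀ (u v : E) (s t : ℝ), 0 ≤ s → 0 ≤ t → s + t = 1 →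
      ‖s • u + t • v‖ ^ 2 ≤ s * ‖u‖ ^ 2 + t * ‖v‖ ^ 2 := by
    intro u v s t hs ht hst
    have h1 : ‖s • u + t • v‖ ≤ s * ‖u‖ + t * ‖v‖ := by
      refine (norm_add_le _ _).trans ?_
      rw [norm_smul, norm_smul, Real.norm_of_nonneg hs, Real.norm_of_nonneg ht]
    have h2 : ‖s • u + t • v‖ ^ 2 ≤ (s * ‖u‖ + t * ‖v‖) ^ 2 :=
      pow_le_pow_left₀ (norm_nonneg _) h1 2
    have hs' : s = 1 - t := by linarith
    have h3 : s * ‖u‖ ^ 2 + t * ‖v‖ ^ 2 - (s * ‖u‖ + t * ‖v‖) ^ 2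
      = s * t * (‖u‖ - ‖v‖) ^ 2 := by subst hs'; ring
    have h4 : 0 ≤ s * t * (‖u‖ - ‖v‖) ^ 2 := by positivity
    linarith
  have hBconv : ConvexOn ℝ univ B := by
    refine ⟨convex_univ, fun x _ y _ s t hs ht hst => ciSup_le fun e => ?_⟩
    have h1 : s • x + t • y + e = s • (x + e) + t • (y + e) := by
      have hs' : s = 1 - t := by linarith
      subst hs'
      module
    have h2 := hφ.2 (mem_univ (x + e)) (mem_univ (y + e)) hs ht hst
    rw [← h1] at h2
    simp only [smul_eq_mul] at h2 ⊢
    have h3 := mul_le_mul_of_nonneg_left (hBle x e) hs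
    have h4 := mul_le_mul_of_nonneg_left (hBle y e) ht
    have hs' : s = 1 - t := by linarith
    subst hs'
    linarith
  have hUconv : ConvexOn ℝ univ U := by
    refine ⟨convex_univ, fun x _ y _ s t hs ht hst => ?_⟩
    simp only [smul_eq_mul]
    have key : ∀ z w, U (s • x + t • y) ≤
        s * (B z + 2 * a * ‖x - z‖ ^ 2) + t * (B w + 2 * a * ‖y - w‖ ^ 2) := by
      intro z w
      have h1 := hUle (s • x + t • y) (s • z + t • w)
      have h2 := hBconv.2 (mem_univ z) (mem_univ w) hs ht hst
      have h3 := hsq (x - z) (y - w) s t hs ht hst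
      have h4 : s • x + t • y - (s • z + t • w) = s • (x - z) + t • (y - w) := by module
      rw [h4] at h1
      simp only [smul_eq_mul] at h2
      nlinarith
    have key2 : ∀ w, U (s • x + t • y) ≤
        s * U x + t * (B w + 2 * a * ‖y - w‖ ^ 2) := by
      intro w
      rw [hUdef]
      simp only
      rw [Real.mul_iInf_of_nonneg hs, ← sub_le_iff_le_add]
      exact le_ciInf fun z => by linarith [key z w]
    have : U (s • x + t • y) - s * U x ≤ t * U y := by
      conv_rhs => rw [hUdef]
      simp only
      rw [Real.mul_iInf_of_nonneg ht]
      exact le_ciInf fun w => by linarith [key2 w]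
    linarith
  have hUconc : ConvexOn ℝ univ fun x => 2 * a * ‖x‖ ^ 2 - U x := by
    refine ⟨convex_univ, fun x _ y _ s t hs ht hst => ?_⟩
    simp only [smul_eq_mul]
    have key : s * U x + t * U y + 2 * a * (‖s • x + t • y‖ ^ 2 - s * ‖x‖ ^ 2 - t * ‖y‖ ^ 2)
        ≤ U (s • x + t • y) := by
      refine le_ciInf fun z => ?_
      have h1 := mul_le_mul_of_nonneg_left (hUle x z) hs
      have h2 := mul_le_mul_of_nonneg_left (hUle y z) ht
      have e1 : ‖x - z‖ ^ 2 = ‖x‖ ^ 2 - 2 * inner ℝ x z + ‖z‖ ^ 2 := norm_sub_sq_real x z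
      have e2 : ‖y - z‖ ^ 2 = ‖y‖ ^ 2 - 2 * inner ℝ y z + ‖z‖ ^ 2 := norm_sub_sq_real y z
      have e3 : ‖s • x + t • y - z‖ ^ 2 = ‖s • x + t • y‖ ^ 2
          - 2 * (s * inner ℝ x z + t * inner ℝ y z) + ‖z‖ ^ 2 := by
        rw [norm_sub_sq_real, inner_add_left, inner_smul_left, inner_smul_left]; rfl
      rw [e1] at h1
      rw [e2] at h2
      rw [e3]
      have hs' : s = 1 - t := by linarith
      subst hs'
      linarith
    linarith
  obtain ⟨hd, hL⟩ := differentiable_lipschitz_fderiv_of_convex (by positivity) hUconv hUconc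
  refine ⟨U, hUconv, hd, hL, hφU, fun α b hαb x => ?_⟩
  obtain ⟨β, hβ⟩ : ∃ β : E, ∀ y, b y = inner ℝ β y :=
    ⟨(InnerProductSpace.toDual ℝ E).symm b, fun y => by simp⟩
  -- The vertex of the paraboloid, obtained by completing the square.
  set z : E := -((4 * a)⁻¹ • β) with hz
  have hsqr : ∀ y, 2 * a * ‖y - z‖ ^ 2 = b y + 2 * a * ‖y‖ ^ 2 + 2 * a * ‖z‖ ^ 2 := by
    intro y
    rw [norm_sub_sq_real, hβ, hz, inner_neg_right, inner_smul_right, real_inner_comm]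
    field_simp
    ring
  have h1 := hUle x z
  have h2 : B z ≤ α - 2 * a * ‖z‖ ^ 2 := by
    refine ciSup_le fun e => ?_
    have h3 := hαb (z + e)
    have h4 := hsqr (z + e)
    rw [add_sub_cancel_left] at h4
    linarith
  have := hsqr x
  linarith

/-- Simultaneous `C^{1,1}` regularization of a semiconvex function `f` and a semiconcave function
`g`, from above and from below, preserving inequalities up to affine functions. -/
theorem exists_regularization {f g : E → ℝ} {a c : ℝ} (ha : 0 < a)
    (hf : ConvexOn ℝ univ fun x => f x + a * ‖x‖ ^ 2) (hfb : ∀ x, f x ≤ c)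
    (hg : ConvexOn ℝ univ fun x => a * ‖x‖ ^ 2 - g x) (hgb : ∀ x, -c ≤ g x) :
    ∃ F G : E → ℝ, Differentiable ℝ F ∧ Differentiable ℝ G ∧
      (∃ K, LipschitzWith K (fderiv ℝ F)) ∧ (∃ K, LipschitzWith K (fderiv ℝ G)) ∧
      (∀ x, f x ≤ F x) ∧ (∀ x, G x ≤ g x) ∧
      ∀ (l : E →L[ℝ] ℝ) (m : ℝ), (∀ x, f x ≤ g x + l x + m) → ∀ x, F x ≤ G x + l x + m := by
  obtain ⟨U, hUc, hUd, ⟨K, hK⟩, hUle, hUmin⟩ := exists_convex_envelope hf ha (c := c)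
    (fun y => by linarith [hfb y])
  obtain ⟨W, hWc, hWd, ⟨K', hK'⟩, hWle, hWmin⟩ := exists_convex_envelope hg ha (c := c)
    (fun y => by linarith [hgb y])
  have hsqd : ∀ x : E, HasFDerivAt (fun x : E => a * ‖x‖ ^ 2) (a • (2 • innerSL ℝ x)) x :=
    fun x => (hasStrictFDerivAt_norm_sq x).hasFDerivAt.const_mul a
  have hsqd' : Differentiable ℝ fun x : E => a * ‖x‖ ^ 2 := fun x => (hsqd x).differentiableAt
  have hsqL : ∃ K, LipschitzWith K (fderiv ℝ fun x : E => a * ‖x‖ ^ 2) := by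
    have : (fderiv ℝ fun x : E => a * ‖x‖ ^ 2) = fun x => ((a * 2) • innerSL ℝ : E →L[ℝ] _) x := by
      ext x y
      rw [(hsqd x).fderiv]
      simp [mul_assoc]
    rw [this]
    exact ⟨_, ((a * 2) • innerSL ℝ : E →L[ℝ] _).lipschitz⟩
  obtain ⟨K₂, hK₂⟩ := hsqL
  refine ⟨fun x => U x - a * ‖x‖ ^ 2, fun x => a * ‖x‖ ^ 2 - W x, hUd.sub hsqd', hsqd'.sub hWd,
    ⟨K + K₂, ?_⟩, ⟨K₂ + K', ?_⟩, fun x => by linarith [hUle x], fun x => by linarith [hWle x], ?_⟩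
  · have : (fderiv ℝ fun x => U x - a * ‖x‖ ^ 2) =
        fun x => fderiv ℝ U x - fderiv ℝ (fun x : E => a * ‖x‖ ^ 2) x :=
      funext fun x => fderiv_fun_sub (hUd x) (hsqd' x)
    rw [this]
    exact hK.sub hK₂
  · have : (fderiv ℝ fun x => a * ‖x‖ ^ 2 - W x) =
        fun x => fderiv ℝ (fun x : E => a * ‖x‖ ^ 2) x - fderiv ℝ W x :=
      funext fun x => fderiv_fun_sub (hsqd' x) (hWd x)
    rw [this]
    exact hK₂.sub hK'
  · intro l m hlm
    -- Semiconcavity places above `g` a paraboloid of opening `a` touching it at `x`. Added to `a *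
    -- ‖·‖ ^ 2` it has opening `2 * a`, so minimality of `U` applies. The same argument with the
    -- roles exchanged then treats `W`.
    have h1 : ∀ x, U x ≤ g x + l x + m + a * ‖x‖ ^ 2 := by
      intro x
      obtain ⟨b, hb⟩ := exists_affine_support hg x
      have := hUmin (m - (a * ‖x‖ ^ 2 - g x) + b x) (l - b) (fun y => by
        have h2 := hb y
        have h3 := hlm y
        rw [map_sub] at h2
        simp only [_root_.sub_apply]
        linarith) x
      simp only [_root_.sub_apply] at this
      linarith
    intro x
    obtain ⟨b, hb⟩ := exists_affine_support hUc x
    have := hWmin (m - U x + b x) (l - b) (fun y => by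
        have h2 := hb y
        have h3 := h1 y
        rw [map_sub] at h2
        simp only [_root_.sub_apply]
        linarith) x
    simp only [_root_.sub_apply] at this
    linarith

end ConvexAnalysis

/-! ### Smooth approximation of Lipschitz test functions. -/

section Mollification

variable {E : Type*} [NormedAddCommGroup E] [InnerProductSpace ℝ E] [FiniteDimensional ℝ E]
  [MeasurableSpace E] [BorelSpace E]

open scoped Convolution

/-- The derivative is put on the Lipschitz factor, which by Rademacher is differentiable almost
everywhere. The derivative of a mollification is thus an average of `fderiv w` and inherits its
bound. -/
theorem hasFDerivAt_convolution_lipschitz {μ : Measure E} [μ.IsAddHaarMeasure] {f w : E → ℝ}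
    {C : NNReal} (hf : Continuous f) (hfc : HasCompactSupport f) (hw : LipschitzWith C w) (x : E) :
    HasFDerivAt (f ⋆[ContinuousLinearMap.lsmul ℝ ℝ, μ] w)
      (∫ t, f t • fderiv ℝ w (x - t) ∂μ) x := by
  have hmeas : ∀ x, Continuous fun t => f t * w (x - t) := fun x =>
    hf.mul (hw.continuous.comp (continuous_const.sub continuous_id))
  refine (hasFDerivAt_integral_of_dominated_loc_of_lip (F := fun x t => f t * w (x - t))
    (bound := fun t => ‖f t‖ * C) (s := univ) univ_mem ?_ ?_ ?_ ?_ ?_ ?_).2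
  · exact Eventually.of_forall fun x => (hmeas x).aestronglyMeasurable
  · exact (hmeas x).integrable_of_hasCompactSupport hfc.mul_right
  · refine hf.aestronglyMeasurable.smul ?_
    exact ((measurable_fderiv ℝ w).comp (measurable_const.sub measurable_id)).aestronglyMeasurable
  · refine Eventually.of_forall fun t => LipschitzWith.lipschitzOnWith ?_
    refine LipschitzWith.of_dist_le_mul fun a b => ?_
    have := hw.dist_le_mul (a - t) (b - t)
    rw [dist_sub_right] at this
    rw [Real.dist_eq, ← mul_sub, abs_mul, Real.coe_nnabs, abs_mul, abs_norm,
      abs_of_nonneg C.coe_nonneg, mul_assoc, Real.norm_eq_abs]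
    rw [Real.dist_eq] at this
    exact mul_le_mul_of_nonneg_left this (abs_nonneg _)
  · exact (hf.integrable_of_hasCompactSupport hfc).norm.mul_const _
  · have h1 : ∀ᵐ t ∂μ, DifferentiableAt ℝ w (x - t) := by
      have := (quasiMeasurePreserving_sub_left_of_right_invariant μ x).ae
        (hw.ae_differentiableAt (μ := μ))
      exact this
    filter_upwards [h1] with t ht
    have h2 : HasFDerivAt (fun x => w (x - t)) (fderiv ℝ w (x - t)) x := by
      rw [← ContinuousLinearMap.comp_id (fderiv ℝ w (x - t))]
      exact ht.hasFDerivAt.comp (f := fun x => x - t) x ((hasFDerivAt_id x).sub_const t)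
    exact h2.const_mul (f t)

/-- Mollification at scales below `R - r` keeps the supports in the larger ball. The gradients are
bounded by `C` and converge almost everywhere by Lebesgue differentiation, as dominated convergence
requires. -/
theorem exists_smooth_approx {μ : Measure E} [μ.IsAddHaarMeasure] {w : E → ℝ} {C : NNReal}
    (hw : LipschitzWith C w) {y : E} {r R : ℝ} (hrR : r < R)
    (hsupp : ∀ x, x ∉ Metric.closedBall y r → w x = 0) :
    ∃ (φ : ℕ → E → ℝ) (M : ℝ), (∀ k, ContDiff ℝ ((⊤ : ℕ∞) : WithTop ℕ∞) (φ k)) ∧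
      (∀ k, tsupport (φ k) ⊆ Metric.closedBall y R) ∧ (∀ k x, |φ k x| ≤ M) ∧
      (∀ k x, ‖fderiv ℝ (φ k) x‖ ≤ C) ∧ (∀ x, Tendsto (fun k => φ k x) atTop (𝓝 (w x))) ∧
      ∀ᵐ x ∂μ, Tendsto (fun k => fderiv ℝ (φ k) x) atTop (𝓝 (fderiv ℝ w x)) := by
  have hδ : ∀ k : ℕ, 0 < (R - r) / (k + 2) := fun k => by
    have : 0 < R - r := by linarith
    positivity
  have hδle : ∀ k : ℕ, (R - r) / (k + 2) ≤ R - r := fun k =>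
    div_le_self (by linarith) (by linarith [(Nat.cast_nonneg k : (0 : ℝ) ≤ k)])
  let b : ℕ → ContDiffBump (0 : E) := fun k =>
    ⟨(R - r) / (k + 2) / 2, (R - r) / (k + 2), half_pos (hδ k), half_lt_self (hδ k)⟩
  have hb : Tendsto (fun k => (b k).rOut) atTop (𝓝 0) := by
    have h1 : Tendsto (fun k : ℕ => (k : ℝ) + 2) atTop atTop :=
      tendsto_atTop_add_const_right _ _ tendsto_natCast_atTop_atTop
    exact h1.const_div_atTop (R - r)
  obtain ⟨M, hM⟩ : ∃ M, ∀ x, |w x| ≤ M := by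
    have hc : HasCompactSupport w := HasCompactSupport.intro (isCompact_closedBall y r) hsupp
    obtain ⟨M, hM⟩ := hw.continuous.bounded_above_of_compact_support hc
    exact ⟨M, hM⟩
  have hcl : ∀ k x, dist (((b k).normed μ ⋆[ContinuousLinearMap.lsmul ℝ ℝ, μ] w) x) (w x) ≤
      C * (R - r) := by
    intro k x
    refine (b k).dist_normed_convolution_le hw.continuous.aestronglyMeasurable fun z hz => ?_
    refine (hw.dist_le_mul z x).trans (mul_le_mul_of_nonneg_left ?_ C.coe_nonneg)
    exact (Metric.mem_ball.1 hz).le.trans (hδle k)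
  have hfd : ∀ k x, fderiv ℝ ((b k).normed μ ⋆[ContinuousLinearMap.lsmul ℝ ℝ, μ] w) x =
      ∫ t, (b k).normed μ t • fderiv ℝ w (x - t) ∂μ := fun k x =>
    (hasFDerivAt_convolution_lipschitz (b k).continuous_normed (b k).hasCompactSupport_normed hw
      x).fderiv
  refine ⟨fun k => (b k).normed μ ⋆[ContinuousLinearMap.lsmul ℝ ℝ, μ] w, M + C * (R - r),
    fun k => ?_, fun k => ?_, fun k x => ?_, fun k x => ?_, fun x => ?_, ?_⟩
  · exact (b k).hasCompactSupport_normed.contDiff_convolution_left _ (b k).contDiff_normed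
      hw.continuous.locallyIntegrable
  · refine closure_minimal ?_ Metric.isClosed_closedBall
    refine (support_convolution_subset _).trans ?_
    rintro _ ⟨u, hu, v, hv, rfl⟩
    rw [(b k).support_normed_eq] at hu
    have hv' : v ∈ Metric.closedBall y r := by
      by_contra h
      exact hv (hsupp v h)
    rw [Metric.mem_ball, dist_zero_right] at hu
    rw [Metric.mem_closedBall, dist_eq_norm] at hv' ⊢
    have h1 : ‖u + v - y‖ ≤ ‖u‖ + ‖v - y‖ := by
      rw [add_sub_assoc]; exact norm_add_le _ _
    have h2 : ‖u‖ ≤ R - r := hu.le.trans (hδle k)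
    simp only
    linarith
  · have h1 := hcl k x
    rw [Real.dist_eq] at h1
    have h2 := abs_sub_abs_le_abs_sub
      (((b k).normed μ ⋆[ContinuousLinearMap.lsmul ℝ ℝ, μ] w) x) (w x)
    linarith [hM x]
  · rw [hfd]
    have h1 : ∀ᵐ t ∂μ, ‖(b k).normed μ t • fderiv ℝ w (x - t)‖ ≤ (b k).normed μ t * C := by
      refine Eventually.of_forall fun t => ?_
      rw [norm_smul, Real.norm_of_nonneg ((b k).nonneg_normed t)]
      exact mul_le_mul_of_nonneg_left (norm_fderiv_le_of_lipschitz ℝ hw) ((b k).nonneg_normed t)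
    refine (norm_integral_le_of_norm_le ((b k).integrable_normed.mul_const _) h1).trans ?_
    rw [integral_mul_const, (b k).integral_normed, one_mul]
  · exact ContDiffBump.convolution_tendsto_right_of_continuous hb hw.continuous x
  · have hloc : LocallyIntegrable (fderiv ℝ w) μ := by
      have : MemLp (fderiv ℝ w) ⊤ μ := memLp_top_of_bound
        (measurable_fderiv ℝ w).aestronglyMeasurable C
        (Eventually.of_forall fun x => norm_fderiv_le_of_lipschitz ℝ hw)
      exact this.locallyIntegrable le_top
    have := ContDiffBump.ae_convolution_tendsto_right_of_locallyIntegrable (K := 2) hb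
      (Eventually.of_forall fun k => by simp only [b]; linarith) hloc
    filter_upwards [this] with x hx
    simp_rw [hfd]
    exact hx

/-- A field which pairs with smooth test functions as a multiple of Lebesgue measure does so with
Lipschitz test functions. -/
theorem integral_inner_gradient_eq_of_lipschitz {μ : Measure E} [μ.IsAddHaarMeasure]
    {Ω : Opens E} {A : E → E} {c : ℝ}
    (hA : ∀ φ : 𝓓(Ω, ℝ), ∫ x in (Ω : Set E), inner ℝ (A x) (gradient φ x) ∂μ =
      ∫ x in (Ω : Set E), c * φ x ∂μ)
    {w : E → ℝ} {C : NNReal} (hw : LipschitzWith C w) {y : E} {r R : ℝ} (hrR : r < R)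
    (hR : Metric.closedBall y R ⊆ Ω) (hAi : IntegrableOn A (Metric.closedBall y R) μ)
    (hsupp : ∀ x, x ∉ Metric.closedBall y r → w x = 0) :
    ∫ x in Metric.closedBall y R, inner ℝ (A x) (gradient w x) ∂μ =
      ∫ x in Metric.closedBall y R, c * w x ∂μ := by
  obtain ⟨φ, M, hφs, hφt, hφM, hφC, hφw, hφd⟩ := exists_smooth_approx (μ := μ) hw hrR hsupp
  have hφ0 : ∀ k x, x ∉ Metric.closedBall y R → φ k x = 0 := fun k x hx =>
    image_eq_zero_of_notMem_tsupport fun h => hx (hφt k h)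
  have hφ0' : ∀ k x, x ∉ Metric.closedBall y R → gradient (φ k) x = 0 := by
    intro k x hx
    have h1 : fderiv ℝ (φ k) x = 0 := by
      by_contra h
      exact hx (hφt k (support_fderiv_subset ℝ h))
    simp [gradient, h1]
  have hmB : MeasurableSet (Metric.closedBall y R) := measurableSet_closedBall
  have key : ∀ k, ∫ x in Metric.closedBall y R, inner ℝ (A x) (gradient (φ k) x) ∂μ =
      ∫ x in Metric.closedBall y R, c * φ k x ∂μ := by
    intro k
    have h1 := hA ⟨φ k, hφs k, HasCompactSupport.of_support_subset_isCompact
      (isCompact_closedBall y R) (subset_closure.trans (hφt k)), (hφt k).trans hR⟩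
    simp only [TestFunction.coe_mk] at h1
    rw [setIntegral_eq_of_subset_of_forall_sdiff_eq_zero Ω.isOpen.measurableSet hR
      (fun x hx => by rw [hφ0' k x hx.2, inner_zero_right]),
      setIntegral_eq_of_subset_of_forall_sdiff_eq_zero Ω.isOpen.measurableSet hR
      (fun x hx => by rw [hφ0 k x hx.2, mul_zero])] at h1
    exact h1
  have hfin : μ (Metric.closedBall y R) ≠ ⊤ := (isCompact_closedBall y R).measure_lt_top.ne
  have hgm : ∀ u : E → ℝ, Measurable (gradient u) := fun u =>
    (InnerProductSpace.toDual ℝ E).symm.continuous.measurable.comp (measurable_fderiv ℝ u)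
  have t1 : Tendsto (fun k => ∫ x in Metric.closedBall y R, inner ℝ (A x) (gradient (φ k) x) ∂μ)
      atTop (𝓝 (∫ x in Metric.closedBall y R, inner ℝ (A x) (gradient w x) ∂μ)) := by
    refine tendsto_integral_of_dominated_convergence (fun x => ‖A x‖ * C) ?_ ?_ ?_ ?_
    · exact fun k => hAi.aestronglyMeasurable.inner (hgm _).aestronglyMeasurable
    · exact hAi.norm.mul_const _
    · refine fun k => Eventually.of_forall fun x => (norm_inner_le_norm _ _).trans ?_
      refine mul_le_mul_of_nonneg_left ?_ (norm_nonneg _)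
      rw [gradient, LinearIsometryEquiv.norm_map]
      exact hφC k x
    · filter_upwards [ae_restrict_of_ae hφd] with x hx
      refine Tendsto.inner tendsto_const_nhds ?_
      exact ((InnerProductSpace.toDual ℝ E).symm.continuous.tendsto _).comp hx
  have t2 : Tendsto (fun k => ∫ x in Metric.closedBall y R, c * φ k x ∂μ)
      atTop (𝓝 (∫ x in Metric.closedBall y R, c * w x ∂μ)) := by
    refine tendsto_integral_of_dominated_convergence (fun x => |c| * M) ?_ ?_ ?_ ?_
    · exact fun k => (continuous_const.mul (hφs k).continuous).aestronglyMeasurable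
    · exact integrableOn_const hfin
    · refine fun k => Eventually.of_forall fun x => ?_
      rw [Real.norm_eq_abs, abs_mul]
      exact mul_le_mul_of_nonneg_left (hφM k x) (abs_nonneg _)
    · exact Eventually.of_forall fun x => (hφw x).const_mul c
  simp_rw [key] at t1
  exact tendsto_nhds_unique t1 t2

end Mollification

/-! ### Weak gradients of Lipschitz functions and the divergence theorem. -/

section WeakSolutions

variable {n : ℕ}

local notation "𝔼" => EuclideanSpace ℝ (Fin n)

theorem contDiff_of_tsupport {E F : Type*} [NormedAddCommGroup E] [NormedSpace ℝ E]
    [NormedAddCommGroup F] [NormedSpace ℝ F] {f : E → F} {m : WithTop ℕ∞}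
    (hf : ∀ x ∈ tsupport f, ContDiffAt ℝ m f x) : ContDiff ℝ m f := by
  refine contDiff_iff_contDiffAt.2 fun x => ?_
  by_cases hx : x ∈ tsupport f
  · exact hf x hx
  · have : f =ᶠ[𝓝 x] fun _ => 0 := by
      filter_upwards [(isClosed_tsupport f).isOpen_compl.mem_nhds hx] with z hz
        using image_eq_zero_of_notMem_tsupport hz
    exact contDiffAt_const.congr_of_eventuallyEq this

theorem measurable_gradient (u : 𝔼 → ℝ) : Measurable (gradient u) :=
  (InnerProductSpace.toDual ℝ 𝔼).symm.continuous.measurable.comp (measurable_fderiv ℝ u)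

theorem norm_gradient_eq (u : 𝔼 → ℝ) (x : 𝔼) : ‖gradient u x‖ = ‖fderiv ℝ u x‖ := by
  rw [gradient, LinearIsometryEquiv.norm_map]

theorem integrable_mul_lineDeriv {g w : 𝔼 → ℝ} {C : NNReal} (hg : Continuous g)
    (hgc : HasCompactSupport g) (hw : LipschitzWith C w) (v : 𝔼) :
    Integrable fun x => g x * lineDeriv ℝ w x v := by
  refine (hg.integrable_of_hasCompactSupport hgc).mul_bdd (c := C * ‖v‖)
    (aestronglyMeasurable_lineDeriv hw.continuous _)
    (Eventually.of_forall fun x => norm_lineDeriv_le_of_lipschitz ℝ hw)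

theorem integral_smul_gradient_eq {φ w : 𝔼 → ℝ} {C : NNReal}
    (hφ : ContDiff ℝ 1 φ) (hφc : HasCompactSupport φ) (hw : LipschitzWith C w) :
    ∫ x, w x • gradient φ x = -∫ x, φ x • gradient w x := by
  obtain ⟨K, hK⟩ := hφ.lipschitzWith_of_hasCompactSupport hφc one_ne_zero
  have hgr : Continuous (gradient φ) :=
    (InnerProductSpace.toDual ℝ 𝔼).symm.continuous.comp (hφ.continuous_fderiv one_ne_zero)
  have hgrc : HasCompactSupport (gradient φ) := by
    refine HasCompactSupport.intro hφc fun x hx => ?_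
    have h1 : fderiv ℝ φ x = 0 := by
      by_contra h
      exact hx (support_fderiv_subset ℝ h)
    simp [gradient, h1]
  have hi1 : Integrable fun x => w x • gradient φ x :=
    (hw.continuous.smul hgr).integrable_of_hasCompactSupport hgrc.smul_left
  have hi2 : Integrable fun x => φ x • gradient w x := by
    refine ((hφ.continuous.integrable_of_hasCompactSupport hφc).smul_bdd C
      (measurable_gradient w).aestronglyMeasurable (Eventually.of_forall fun x => ?_))
    rw [norm_gradient_eq]
    exact norm_fderiv_le_of_lipschitz ℝ hw
  refine ext_inner_left ℝ fun v => ?_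
  rw [inner_neg_right, ← integral_inner hi1, ← integral_inner hi2]
  have h1 : ∀ x, inner ℝ v (w x • gradient φ x) = -(lineDeriv ℝ φ x (-v) * w x) := by
    intro x
    rw [inner_smul_right, inner_gradient_right,
      (hφ.differentiable one_ne_zero x).lineDeriv_eq_fderiv, map_neg]
    simp [mul_comm]
  have h2 : ∀ᵐ x, inner ℝ v (φ x • gradient w x) = lineDeriv ℝ w x v * φ x := by
    filter_upwards [hw.ae_differentiableAt] with x hx
    rw [inner_smul_right, inner_gradient_right, hx.lineDeriv_eq_fderiv]
    simp [mul_comm]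
  simp_rw [h1]
  rw [integral_congr_ae h2, integral_neg, hw.integral_lineDeriv_mul_eq hK hφc]

/-- Extend `h` from the ball to a global Lipschitz function and integrate by parts; the fundamental
lemma of the calculus of variations identifies `G` with the Rademacher gradient. -/
theorem ae_eq_gradient_of_hasWeakGradient {Ω : Opens 𝔼} {h : 𝔼 → ℝ} {G : 𝔼 → 𝔼}
    (hG : HasWeakGradient Ω h G) {y : 𝔼} {r : ℝ} {L : NNReal} (hr : Metric.ball y r ⊆ Ω)
    (hL : LipschitzOnWith L h (Metric.ball y r)) :
    ∀ᵐ x, x ∈ Metric.ball y r → DifferentiableAt ℝ h x ∧ G x = gradient h x := by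
  obtain ⟨u, hu, hEq⟩ := hL.extend_real
  obtain ⟨-, hGl, hGφ⟩ := hG
  have hul : LocallyIntegrable (gradient u) := by
    have : MemLp (gradient u) ⊤ (volume : Measure 𝔼) := memLp_top_of_bound
      (measurable_gradient u).aestronglyMeasurable L (Eventually.of_forall fun x => by
        rw [norm_gradient_eq]; exact norm_fderiv_le_of_lipschitz ℝ hu)
    exact this.locallyIntegrable le_top
  have key : ∀ᵐ x, x ∈ Metric.ball y r → G x - gradient u x = 0 := by
    refine Metric.isOpen_ball.ae_eq_zero_of_integral_contDiff_smul_eq_zero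
      ((hGl.mono_set hr).sub (hul.locallyIntegrableOn _)) fun φ hφ hφc hφt => ?_
    have h1 := hGφ ⟨φ, hφ, hφc, hφt.trans hr⟩
    simp only [TestFunction.coe_mk] at h1
    have h0 : ∀ x, x ∉ Metric.ball y r → φ x = 0 := fun x hx =>
      image_eq_zero_of_notMem_tsupport fun h => hx (hφt h)
    have h0' : ∀ x, x ∉ Metric.ball y r → gradient φ x = 0 := by
      intro x hx
      have h1 : fderiv ℝ φ x = 0 := by
        by_contra h
        exact hx (hφt (support_fderiv_subset ℝ h))
      simp [gradient, h1]
    rw [setIntegral_eq_integral_of_forall_compl_eq_zero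
        (fun x hx => by rw [h0' x fun h => hx (hr h), smul_zero]),
      setIntegral_eq_integral_of_forall_compl_eq_zero
        (fun x hx => by rw [h0 x fun h => hx (hr h), zero_smul])] at h1
    have h2 : (fun x => h x • gradient φ x) = fun x => u x • gradient φ x := by
      ext1 x
      by_cases hx : x ∈ Metric.ball y r
      · rw [hEq hx]
      · rw [h0' x hx, smul_zero, smul_zero]
    have hφ1 : ContDiff ℝ 1 φ := hφ.of_le (by exact_mod_cast le_top)
    rw [h2, integral_smul_gradient_eq hφ1 hφc hu, neg_inj] at h1
    have hi1 : Integrable fun x => φ x • G x := by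
      have h3 : IntegrableOn (fun x => φ x • G x) (tsupport φ) := by
        have : IntegrableOn G (tsupport φ) :=
          (hGl.mono_set hr).integrableOn_compact_subset hφt hφc
        exact this.continuousOn_smul hφ.continuous.continuousOn hφc
      rw [← integrableOn_iff_integrable_of_support_subset (s := tsupport φ)]
      · exact h3
      · intro x hx
        by_contra h
        exact hx (by simp [image_eq_zero_of_notMem_tsupport h])
    have hi2 : Integrable fun x => φ x • gradient u x := by
      refine ((hφ.continuous.integrable_of_hasCompactSupport hφc).smul_bdd L
        (measurable_gradient u).aestronglyMeasurable (Eventually.of_forall fun x => ?_))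
      rw [norm_gradient_eq]
      exact norm_fderiv_le_of_lipschitz ℝ hu
    simp_rw [smul_sub]
    rw [integral_sub hi1 hi2, h1, sub_self]
  filter_upwards [key, hu.ae_differentiableAt] with x hx hd hxb
  have heq : h =ᶠ[𝓝 x] u := hEq.eventuallyEq_of_mem (Metric.isOpen_ball.mem_nhds hxb)
  refine ⟨hd.congr_of_eventuallyEq heq, ?_⟩
  rw [sub_eq_zero.1 (hx hxb), gradient, gradient, heq.fderiv_eq]

/-- The divergence of a vector field. -/
def divergence (V : 𝔼 → 𝔼) (x : 𝔼) : ℝ :=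
  ∑ i, fderiv ℝ V x (EuclideanSpace.single i 1) i

theorem integral_inner_gradient_eq_divergence {V : 𝔼 → 𝔼} {w : 𝔼 → ℝ} {C : NNReal} {y : 𝔼}
    {r ρ R : ℝ} (hr : 0 < r) (hrρ : r < ρ) (hρR : ρ < R)
    (hV : ContDiffOn ℝ 1 V (Metric.ball y R)) (hw : LipschitzWith C w)
    (hsupp : ∀ x, x ∉ Metric.closedBall y r → w x = 0) :
    ∫ x in Metric.closedBall y ρ, inner ℝ (V x) (gradient w x) =
      ∫ x in Metric.closedBall y ρ, -divergence V x * w x := by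
  -- The cutoff makes the components of `V` globally Lipschitz with compact support; it equals `1`
  -- wherever `w` is nonzero.
  let χ : ContDiffBump y := ⟨ρ, (ρ + R) / 2, by linarith, by linarith⟩
  have hχ1 : ∀ x ∈ Metric.closedBall y ρ, χ x = 1 := fun x hx => χ.one_of_mem_closedBall hx
  have htw : tsupport w ⊆ Metric.closedBall y r := by
    refine closure_minimal (fun x hx => ?_) Metric.isClosed_closedBall
    by_contra h
    exact hx (hsupp x h)
  have hgw : ∀ x, x ∉ Metric.closedBall y r → fderiv ℝ w x = 0 := by
    intro x hx
    by_contra h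
    exact hx (htw (support_fderiv_subset ℝ h))
  have hsub : Metric.closedBall y r ⊆ Metric.closedBall y ρ :=
    Metric.closedBall_subset_closedBall hrρ.le
  let g : Fin n → 𝔼 → ℝ := fun i x => χ x * V x i
  have hgc : ∀ i, HasCompactSupport (g i) := fun i => χ.hasCompactSupport.mul_right
  have hVi : ∀ i, ContDiffOn ℝ 1 (fun x => V x i) (Metric.ball y R) := fun i =>
    (EuclideanSpace.proj i : 𝔼 →L[ℝ] ℝ).contDiff.comp_contDiffOn hV
  have hg : ∀ i, ContDiff ℝ 1 (g i) := by
    intro i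
    refine contDiff_of_tsupport fun x hx => ?_
    have h1 : x ∈ Metric.closedBall y ((ρ + R) / 2) := by
      have := tsupport_mul_subset_left (f := χ) (g := fun x => V x i) hx
      rwa [χ.tsupport_eq] at this
    have h2 : x ∈ Metric.ball y R := by
      rw [Metric.mem_closedBall] at h1
      rw [Metric.mem_ball]; linarith
    exact χ.contDiffAt.mul ((hVi i).contDiffAt (Metric.isOpen_ball.mem_nhds h2))
  have hgL : ∀ i, ∃ K, LipschitzWith K (g i) := fun i =>
    (hg i).lipschitzWith_of_hasCompactSupport (hgc i) one_ne_zero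
  have hball : Metric.closedBall y ρ ⊆ Metric.ball y R := Metric.closedBall_subset_ball hρR
  have hlhs : ∫ x in Metric.closedBall y ρ, inner ℝ (V x) (gradient w x) =
      ∑ i, ∫ x, lineDeriv ℝ w x (EuclideanSpace.single i 1) * g i x := by
    rw [← integral_finsetSum _ fun i _ => by
        simpa only [mul_comm] using integrable_mul_lineDeriv (hg i).continuous (hgc i) hw
          (EuclideanSpace.single i 1),
      ← setIntegral_eq_integral_of_forall_compl_eq_zero (s := Metric.closedBall y ρ)
        (f := fun x => ∑ i, lineDeriv ℝ w x (EuclideanSpace.single i 1) * g i x)]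
    · refine setIntegral_congr_ae measurableSet_closedBall ?_
      filter_upwards [hw.ae_differentiableAt] with x hx hxb
      simp only [hx.lineDeriv_eq_fderiv, g, hχ1 x hxb, one_mul]
      rw [inner_gradient_right]
      conv_lhs => rw [← (EuclideanSpace.basisFun (Fin n) ℝ).sum_repr (V x)]
      simp [mul_comm]
    · intro x hx
      refine Finset.sum_eq_zero fun i _ => ?_
      have h1 : w =ᶠ[𝓝 x] fun _ => 0 := by
        have : (tsupport w)ᶜ ∈ 𝓝 x :=
          (isClosed_tsupport w).isOpen_compl.mem_nhds fun h => hx (hsub (htw h))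
        filter_upwards [this] with z hz using image_eq_zero_of_notMem_tsupport hz
      have h2 : DifferentiableAt ℝ w x := (differentiableAt_const _).congr_of_eventuallyEq h1
      rw [h2.lineDeriv_eq_fderiv, hgw x fun h => hx (hsub h)]
      simp
  have hrhs : ∀ i, ∫ x, lineDeriv ℝ w x (EuclideanSpace.single i 1) * g i x =
      ∫ x in Metric.closedBall y ρ, -(fderiv ℝ V x (EuclideanSpace.single i 1) i) * w x := by
    intro i
    obtain ⟨K, hK⟩ := hgL i
    rw [hw.integral_lineDeriv_mul_eq hK (hgc i),
      ← setIntegral_eq_integral_of_forall_compl_eq_zero (s := Metric.closedBall y ρ)]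
    · refine setIntegral_congr_fun measurableSet_closedBall fun x hxb => ?_
      simp only
      by_cases hxr : x ∈ Metric.closedBall y r
      · have hx' : x ∈ Metric.ball y ρ := Metric.closedBall_subset_ball hrρ hxr
        have h1 : g i =ᶠ[𝓝 x] fun x => V x i := by
          filter_upwards [Metric.isOpen_ball.mem_nhds hx'] with z hz
          simp only [g, hχ1 z (Metric.ball_subset_closedBall hz), one_mul]
        have h3 : DifferentiableAt ℝ V x :=
          (hV.contDiffAt (Metric.isOpen_ball.mem_nhds (hball hxb))).differentiableAt one_ne_zero
        have h2 : HasFDerivAt (fun x => V x i)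
            ((EuclideanSpace.proj i : 𝔼 →L[ℝ] ℝ).comp (fderiv ℝ V x)) x :=
          (EuclideanSpace.proj i : 𝔼 →L[ℝ] ℝ).hasFDerivAt.comp x
            h3.hasFDerivAt
        rw [((hg i).differentiable one_ne_zero x).lineDeriv_eq_fderiv, h1.fderiv_eq, h2.fderiv]
        simp
      · rw [hsupp x hxr, mul_zero, mul_zero]
    · intro x hx
      rw [hsupp x fun h => hx (hsub h), mul_zero]
  have hdc : ContinuousOn (fderiv ℝ V) (Metric.closedBall y ρ) :=
    (hV.continuousOn_fderiv_of_isOpen Metric.isOpen_ball le_rfl).mono hball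
  rw [hlhs, Finset.sum_congr rfl fun i _ => hrhs i, ← integral_finsetSum]
  · refine setIntegral_congr_fun measurableSet_closedBall fun x _ => ?_
    simp only [divergence, ← Finset.sum_mul, Finset.sum_neg_distrib]
  · intro i _
    refine ContinuousOn.integrableOn_compact (isCompact_closedBall y ρ) ?_
    refine ContinuousOn.mul (ContinuousOn.neg ?_) hw.continuous.continuousOn
    exact (EuclideanSpace.proj i : 𝔼 →L[ℝ] ℝ).continuous.comp_continuousOn
      (hdc.clm_apply continuousOn_const)

end WeakSolutions

/-! ### Comparison of a weak solution with a function touching it from above. -/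

section WeakComparison

theorem rpow_sub_two_mul_self {t q : ℝ} (ht : 0 ≤ t) (hq : 1 < q) :
    t ^ (q - 2) * t = t ^ (q - 1) := by
  rcases ht.eq_or_lt with rfl | ht
  · rw [mul_zero, Real.zero_rpow (by linarith)]
  · nth_rewrite 2 [← Real.rpow_one t]
    rw [← Real.rpow_add ht]
    congr 1; ring

/-- By Cauchy–Schwarz the expression is at least `(‖a‖ ^ (q - 1) - ‖b‖ ^ (q - 1)) * (‖a‖ - ‖b‖)`,
and `t ↦ t ^ (q - 1)` is increasing. -/
theorem inner_rpow_smul_sub_nonneg {E : Type*} [NormedAddCommGroup E] [InnerProductSpace ℝ E]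
    {q : ℝ} (hq : 1 < q) (a b : E) :
    0 ≤ inner ℝ (‖a‖ ^ (q - 2) • a - ‖b‖ ^ (q - 2) • b) (a - b) := by
  have h1 : inner ℝ (‖a‖ ^ (q - 2) • a - ‖b‖ ^ (q - 2) • b) (a - b) =
      ‖a‖ ^ (q - 2) * ‖a‖ ^ 2 + ‖b‖ ^ (q - 2) * ‖b‖ ^ 2 -
        (‖a‖ ^ (q - 2) + ‖b‖ ^ (q - 2)) * inner ℝ a b := by
    simp only [inner_sub_left, inner_sub_right, inner_smul_left, real_inner_self_eq_norm_sq,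
      real_inner_comm a b, conj_trivial]
    ring
  have h2 : inner ℝ a b ≤ ‖a‖ * ‖b‖ := real_inner_le_norm a b
  have h3 : 0 ≤ ‖a‖ ^ (q - 2) + ‖b‖ ^ (q - 2) := by positivity
  have h4 : 0 ≤ (‖a‖ ^ (q - 2) * ‖a‖ - ‖b‖ ^ (q - 2) * ‖b‖) * (‖a‖ - ‖b‖) := by
    rw [rpow_sub_two_mul_self (norm_nonneg a) hq, rpow_sub_two_mul_self (norm_nonneg b) hq]
    rcases le_total ‖a‖ ‖b‖ with h | h
    · exact mul_nonneg_of_nonpos_of_nonpos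
        (sub_nonpos.2 (Real.rpow_le_rpow (norm_nonneg a) h (by linarith))) (sub_nonpos.2 h)
    · exact mul_nonneg
        (sub_nonneg.2 (Real.rpow_le_rpow (norm_nonneg b) h (by linarith))) (sub_nonneg.2 h)
  rw [h1]
  nlinarith [mul_le_mul_of_nonneg_left h2 h3]

variable {n : ℕ}

local notation "𝔼" => EuclideanSpace ℝ (Fin n)

theorem continuousOn_divergence {V : 𝔼 → 𝔼} {s : Set 𝔼} (hs : IsOpen s)
    (hV : ContDiffOn ℝ 1 V s) : ContinuousOn (divergence V) s := by
  refine continuousOn_finsetSum _ fun i _ => ?_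
  exact (EuclideanSpace.proj i : 𝔼 →L[ℝ] ℝ).continuous.comp_continuousOn
    ((hV.continuousOn_fderiv_of_isOpen hs le_rfl).clm_apply continuousOn_const)

/-- A truncation of `u + s` with compact support around a strict zero maximum of `u`. -/
theorem exists_cutoff_above {u : 𝔼 → ℝ} {K : NNReal} (hu : LipschitzWith K u) {y : 𝔼} {r : ℝ}
    (hr : 0 < r) (huy : u y = 0) (hneg : ∀ x ∈ Metric.closedBall y (2 * r), x ≠ y → u x < 0) :
    ∃ (s : ℝ) (w : 𝔼 → ℝ) (C : NNReal), 0 < s ∧ LipschitzWith C w ∧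
      (∀ x, x ∉ Metric.closedBall y r → w x = 0) ∧
      ∀ x ∈ Metric.closedBall y (2 * r), w x = max (u x + s) 0 := by
  obtain ⟨s, hs, hsu⟩ : ∃ s > 0, ∀ x ∈ Metric.closedBall y (2 * r) \ Metric.ball y r,
      u x + s ≤ 0 := by
    have hc : IsCompact (Metric.closedBall y (2 * r) \ Metric.ball y r) :=
      (isCompact_closedBall y (2 * r)).diff Metric.isOpen_ball
    rcases (Metric.closedBall y (2 * r) \ Metric.ball y r).eq_empty_or_nonempty with he | hne
    · exact ⟨1, one_pos, fun x hx => by rw [he] at hx; exact hx.elim⟩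
    · obtain ⟨z, hz, hzm⟩ := hc.exists_isMaxOn hne hu.continuous.continuousOn
      refine ⟨-u z, ?_, fun x hx => ?_⟩
      · have : z ≠ y := by
          rintro rfl
          exact hz.2 (Metric.mem_ball_self hr)
        linarith [hneg z hz.1 this]
      · have : u x ≤ u z := hzm hx
        linarith
  have hle : ∀ x ∈ Metric.closedBall y (2 * r), u x ≤ 0 := by
    intro x hx
    by_cases h : x = y
    · rw [h, huy]
    · exact (hneg x hx h).le
  have hdL : LipschitzWith (Real.toNNReal (s / r)) fun x : 𝔼 => s / r * (2 * r - dist x y) := by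
    refine LipschitzWith.of_dist_le_mul fun a b => ?_
    rw [Real.dist_eq, ← mul_sub, abs_mul, Real.coe_toNNReal _ (by positivity),
      abs_of_pos (by positivity : 0 < s / r)]
    refine mul_le_mul_of_nonneg_left ?_ (by positivity)
    rw [sub_sub_sub_cancel_left, dist_comm a b]
    exact abs_dist_sub_le b a y
  have huL : LipschitzWith K fun x => u x + s := by
    simpa using hu.add (LipschitzWith.const s)
  -- The ramp forces the function to vanish outside radius `2 * r`, where the sign of `u` is
  -- unknown. It is at least `s` inside radius `r`, so there it does not interfere with `u + s ≤ s`.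
  refine ⟨s, fun x => max (min (u x + s) (s / r * (2 * r - dist x y))) 0, _, hs,
    (huL.min hdL).max_const 0, fun x hx => ?_, fun x hx => ?_⟩
  · refine max_eq_right ?_
    by_cases hx2 : x ∈ Metric.closedBall y (2 * r)
    · exact (min_le_left _ _).trans (hsu x ⟨hx2, fun h => hx (Metric.ball_subset_closedBall h)⟩)
    · refine (min_le_right _ _).trans ?_
      rw [Metric.mem_closedBall, not_le] at hx2
      exact mul_nonpos_of_nonneg_of_nonpos (by positivity) (by linarith)
  · simp only
    by_cases hx1 : x ∈ Metric.ball y r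
    · rw [min_eq_left]
      have h1 : s / r * r ≤ s / r * (2 * r - dist x y) := by
        refine mul_le_mul_of_nonneg_left ?_ (by positivity)
        linarith [Metric.mem_ball.1 hx1]
      rw [div_mul_cancel₀ _ hr.ne'] at h1
      linarith [hle x hx]
    · have := hsu x ⟨hx, hx1⟩
      rw [max_eq_right this, max_eq_right ((min_le_left _ _).trans this)]

theorem integrableOn_rpow_smul_gradient {p : 𝔼 → ℝ} (hp : Continuous p) {pM : ℝ} {h : 𝔼 → ℝ}
    {s : Set 𝔼} (hs : MeasurableSet s) (hsf : volume s ≠ ⊤) (hps : ∀ x ∈ s, 1 < p x ∧ p x ≤ pM)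
    {L : ℝ} (hL : ∀ x ∈ s, ‖gradient h x‖ ≤ L) :
    IntegrableOn (fun x => ‖gradient h x‖ ^ (p x - 2) • gradient h x) s := by
  refine Measure.integrableOn_of_bounded (M := (max L 1) ^ (pM - 1)) hsf ?_ ?_
  · exact (((measurable_gradient h).norm.pow (hp.measurable.sub_const 2)).smul
      (measurable_gradient h)).aestronglyMeasurable
  · filter_upwards [ae_restrict_mem hs] with x hx
    rw [norm_smul, Real.norm_of_nonneg (by positivity),
      rpow_sub_two_mul_self (norm_nonneg _) (hps x hx).1]
    refine (Real.rpow_le_rpow (norm_nonneg _) ((hL x hx).trans (le_max_left L 1))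
      (by linarith [(hps x hx).1])).trans ?_
    exact Real.rpow_le_rpow_of_exponent_le (le_max_right L 1) (by linarith [(hps x hx).2])

/-- Weak comparison: a function touching a weak solution of `-Δ_{p(x)} h = -ε` strictly from above
is not a strict supersolution at the touching point. -/
theorem le_divergence_of_touching_above {p : 𝔼 → ℝ} (hp : Continuous p) {D : Opens 𝔼} {pM ε : ℝ}
    (hpD : ∀ x ∈ D, 1 < p x ∧ p x ≤ pM) {h : 𝔼 → ℝ}
    (hLip : LocallyLipschitzOn (D : Set 𝔼) h) (hsol : IsWeakSolution p (-ε) D h) {y : 𝔼}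
    {O : Set 𝔼} (hO : O ∈ 𝓝 y) (hOo : IsOpen O) (hOD : O ⊆ D) {Q : 𝔼 → ℝ} {V : 𝔼 → 𝔼}
    (hQ : ContDiffOn ℝ 1 Q O) (hV : ContDiffOn ℝ 1 V O)
    (hVQ : ∀ x ∈ O, V x = ‖gradient Q x‖ ^ (p x - 2) • gradient Q x) (hy : h y = Q y)
    (hlt : ∀ x ∈ O, x ≠ y → h x < Q x) : ε ≤ divergence V y := by
  by_contra! hdiv
  have hyO : y ∈ O := mem_of_mem_nhds hO
  have hyD : y ∈ (D : Set 𝔼) := hOD hyO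
  obtain ⟨L, t, ht, hLt⟩ := hLip hyD
  rw [D.isOpen.nhdsWithin_eq hyD] at ht
  obtain ⟨K, t', ht', hKt⟩ := (hQ.contDiffAt hO).exists_lipschitzOnWith
  have hdc := (continuousOn_divergence hOo hV).continuousAt hO
  have hall : O ∩ t ∩ t' ∩ {x | divergence V x < ε} ∈ 𝓝 y :=
    inter_mem (inter_mem (inter_mem hO ht) ht') (hdc.eventually_lt_const hdiv)
  obtain ⟨R, hR, hRall⟩ := Metric.mem_nhds_iff.1 hall
  have hLh : LipschitzOnWith L h (Metric.ball y R) := hLt.mono fun x hx => (hRall hx).1.1.2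
  have hLQ : LipschitzOnWith K Q (Metric.ball y R) := hKt.mono fun x hx => (hRall hx).1.2
  have hRO : Metric.ball y R ⊆ O := fun x hx => (hRall hx).1.1.1
  have hRd : ∀ x ∈ Metric.ball y R, divergence V x < ε := fun x hx => (hRall hx).2
  obtain ⟨u, hu, huEq⟩ := (hLh.sub hLQ).extend_real
  have hr : 0 < R / 4 := by linarith
  have hB : Metric.closedBall y (2 * (R / 4)) ⊆ Metric.ball y R :=
    Metric.closedBall_subset_ball (by linarith)
  have hyR : y ∈ Metric.ball y R := Metric.mem_ball_self hR
  -- The test function `w` is the positive part of `h - Q + s` near `y`.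
  obtain ⟨s, w, C, hs, hw, hw0, hwe⟩ := exists_cutoff_above hu hr
    (by rw [← huEq hyR]; simp [hy]) (fun x hx hxy => by
      rw [← huEq (hB hx)]
      simpa using hlt x (hRO (hB hx)) hxy)
  set B := Metric.closedBall y (2 * (R / 4)) with hBdef
  have hBm : MeasurableSet B := measurableSet_closedBall
  have hBf : volume B ≠ ⊤ := (isCompact_closedBall _ _).measure_lt_top.ne
  obtain ⟨G, ⟨hG, -⟩, hGsol⟩ := hsol
  have hGae := ae_eq_gradient_of_hasWeakGradient hG (hRO.trans hOD) hLh
  have hAint : IntegrableOn (fun x => ‖G x‖ ^ (p x - 2) • G x) B := by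
    have h1 : IntegrableOn (fun x => ‖gradient h x‖ ^ (p x - 2) • gradient h x) B := by
      refine integrableOn_rpow_smul_gradient hp hBm hBf
        (fun x hx => hpD x (hOD (hRO (hB hx)))) (L := L) fun x hx => ?_
      rw [norm_gradient_eq]
      exact norm_fderiv_le_of_lipschitzOn ℝ (Metric.isOpen_ball.mem_nhds (hB hx)) hLh
    refine h1.congr ?_
    rw [EventuallyEq, ae_restrict_iff' hBm]
    filter_upwards [hGae] with x hx hxB
    rw [(hx (hB hxB)).2]
  have e1 := integral_inner_gradient_eq_of_lipschitz hGsol hw (by linarith : R / 4 < 2 * (R / 4))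
    (hB.trans (hRO.trans hOD)) hAint hw0
  have e2 := integral_inner_gradient_eq_divergence (R := R) hr (by linarith : R / 4 < 2 * (R / 4))
    (by linarith) (hV.mono hRO) hw hw0
  have hgw : ∀ x, ‖gradient w x‖ ≤ C := fun x => by
    rw [norm_gradient_eq]; exact norm_fderiv_le_of_lipschitz ℝ hw
  have i1 : IntegrableOn (fun x => inner ℝ (‖G x‖ ^ (p x - 2) • G x) (gradient w x)) B := by
    refine Integrable.mono' (hAint.norm.mul_const C)
      (hAint.aestronglyMeasurable.inner (measurable_gradient w).aestronglyMeasurable)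
      (Eventually.of_forall fun x => (norm_inner_le_norm _ _).trans ?_)
    exact mul_le_mul_of_nonneg_left (hgw x) (norm_nonneg _)
  have hVint : IntegrableOn V B :=
    (hV.continuousOn.mono (hB.trans hRO)).integrableOn_compact (isCompact_closedBall _ _)
  have i2 : IntegrableOn (fun x => inner ℝ (V x) (gradient w x)) B := by
    refine Integrable.mono' (hVint.norm.mul_const C)
      (hVint.aestronglyMeasurable.inner (measurable_gradient w).aestronglyMeasurable)
      (Eventually.of_forall fun x => (norm_inner_le_norm _ _).trans ?_)
    exact mul_le_mul_of_nonneg_left (hgw x) (norm_nonneg _)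
  have hdB : ContinuousOn (divergence V) B := (continuousOn_divergence hOo hV).mono (hB.trans hRO)
  have i3 : IntegrableOn (fun x => -ε * w x) B :=
    (continuousOn_const.mul hw.continuous.continuousOn).integrableOn_compact
      (isCompact_closedBall _ _)
  have i4 : IntegrableOn (fun x => -divergence V x * w x) B :=
    (hdB.neg.mul hw.continuous.continuousOn).integrableOn_compact (isCompact_closedBall _ _)
  have hwn : ∀ x, 0 ≤ w x := by
    intro x
    by_cases hx : x ∈ B
    · rw [hwe x hx]; exact le_max_right _ _
    · rw [hw0 x fun h => hx (Metric.closedBall_subset_closedBall (by linarith) h)]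
  -- Where `w` vanishes it is minimal, so its gradient is zero; where `w > 0` its gradient is `Dh -
  -- DQ` almost everywhere, and the integrand is nonnegative by monotonicity. The two integral
  -- identities turn this integral into `-∫ (ε - div V) w`, which is negative if `div V < ε` near
  -- `y`.
  have hnonneg : 0 ≤ ∫ x in B, (inner ℝ (‖G x‖ ^ (p x - 2) • G x) (gradient w x) -
      inner ℝ (V x) (gradient w x)) := by
    refine integral_nonneg_of_ae ?_
    have hsub : ∀ᵐ x ∂(volume.restrict B), x ∈ B := ae_restrict_mem hBm
    filter_upwards [hsub, ae_restrict_of_ae hGae] with x hxB hxG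
    have hxR := hB hxB
    obtain ⟨hxd, hxG⟩ := hxG hxR
    have hxO := hRO hxR
    simp only [Pi.zero_apply]
    rw [← inner_sub_left, hxG, hVQ x hxO]
    rcases (hwn x).eq_or_lt with h0 | hpos
    · have : fderiv ℝ w x = 0 := by
        refine IsLocalMin.fderiv_eq_zero (Eventually.of_forall fun z => ?_)
        rw [← h0]; exact hwn z
      have : gradient w x = 0 := by simp [gradient, this]
      rw [this, inner_zero_right]
    · have hxr : x ∈ Metric.ball y (2 * (R / 4)) := by
        by_contra h
        have : x ∉ Metric.closedBall y (R / 4) := fun h' =>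
          h (Metric.closedBall_subset_ball (by linarith) h')
        exact hpos.ne' (hw0 x this)
      have heq : w =ᶠ[𝓝 x] fun z => h z - Q z + s := by
        filter_upwards [Metric.isOpen_ball.mem_nhds hxr,
          hw.continuous.continuousAt.eventually_const_lt hpos] with z hz hzp
        have hzB : z ∈ B := Metric.ball_subset_closedBall hz
        have e := hwe z hzB
        rw [← huEq (hB hzB)] at e
        rcases le_total (h z - Q z + s) 0 with h' | h'
        · have e' : w z = 0 := by rw [e]; exact max_eq_right h'
          exact absurd e' hzp.ne'
        · rw [e]; exact max_eq_left h'
      have hQd : DifferentiableAt ℝ Q x :=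
        (hQ.contDiffAt (hOo.mem_nhds hxO)).differentiableAt one_ne_zero
      have : gradient w x = gradient h x - gradient Q x := by
        rw [gradient, heq.fderiv_eq, fderiv_add_const, fderiv_fun_sub hxd hQd, map_sub]
        rfl
      rw [this]
      exact inner_rpow_smul_sub_nonneg (hpD x (hOD hxO)).1 _ _
  rw [integral_sub i1 i2, e1, e2, ← integral_sub i3 i4] at hnonneg
  have hpos : 0 < ∫ x in B, (ε - divergence V x) * w x := by
    have hi : IntegrableOn (fun x => (ε - divergence V x) * w x) B :=
      ((continuousOn_const.sub hdB).mul hw.continuous.continuousOn).integrableOn_compact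
        (isCompact_closedBall _ _)
    rw [setIntegral_pos_iff_support_of_nonneg_ae]
    · have hU : {x | 0 < w x} ∩ Metric.ball y (2 * (R / 4)) ⊆
          (Function.support fun x => (ε - divergence V x) * w x) ∩ B := by
        rintro x ⟨hx1, hx2⟩
        have hxB : x ∈ B := Metric.ball_subset_closedBall hx2
        refine ⟨?_, hxB⟩
        have := hRd x (hB hxB)
        exact (mul_pos (by linarith) hx1).ne'
      refine lt_of_lt_of_le ?_ (measure_mono hU)
      refine IsOpen.measure_pos _ ((isOpen_lt continuous_const hw.continuous).inter
        Metric.isOpen_ball) ⟨y, ?_, Metric.mem_ball_self (by linarith)⟩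
      have hyB : y ∈ B := Metric.mem_closedBall_self (by linarith)
      change 0 < w y
      rw [hwe y hyB, ← huEq hyR]
      simp only [hy, sub_self, zero_add]
      exact lt_max_of_lt_left hs
    · filter_upwards [ae_restrict_mem hBm] with x hxB
      have := hRd x (hB hxB)
      exact mul_nonneg (by linarith) (hwn x)
    · exact hi
  have : ∫ x in B, (-ε * w x - -divergence V x * w x) =
      -∫ x in B, (ε - divergence V x) * w x := by
    rw [← integral_neg]
    congr 1
    ext x
    ring
  linarith

end WeakComparison

/-! ### The operator on jets, and jets of the weak solution. -/

section Operator

variable {n : ℕ}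

local notation "𝔼" => EuclideanSpace ℝ (Fin n)

/-- The `p(x)`-Laplace operator as a function of the exponent, the gradient of the exponent, the
gradient and the Hessian. -/
def pxOperator (q : ℝ) (ξ η : 𝔼) (X : 𝔼 →L[ℝ] 𝔼 →L[ℝ] ℝ) : ℝ :=
  ‖η‖ ^ (q - 2) * (∑ i, X (EuclideanSpace.single i 1) (EuclideanSpace.single i 1) +
    inner ℝ ξ η * Real.log ‖η‖ + (q - 2) * X (‖η‖⁻¹ • η) (‖η‖⁻¹ • η))

theorem pxLaplacian_eq_pxOperator (p φ : 𝔼 → ℝ) (x : 𝔼) :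
    pxLaplacian p φ x =
      pxOperator (p x) (gradient p x) (gradient φ x) (fderiv ℝ (fderiv ℝ φ) x) := by
  rw [pxLaplacian, pxOperator, normalizedInfLaplacian,
    InnerProductSpace.laplacian_eq_iteratedFDeriv_orthonormalBasis φ
      (EuclideanSpace.basisFun (Fin n) ℝ)]
  simp [iteratedFDeriv_two_apply]

theorem sum_clm_single (L : 𝔼 →L[ℝ] ℝ) (b : 𝔼) :
    ∑ i, L (EuclideanSpace.single i 1) * b i = L b := by
  conv_rhs => rw [← (EuclideanSpace.basisFun (Fin n) ℝ).sum_repr b]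
  simp [mul_comm]

theorem hasFDerivAt_rpow_norm_smul {p : 𝔼 → ℝ} {A : 𝔼 → 𝔼} {p' : 𝔼 →L[ℝ] ℝ} {A' : 𝔼 →L[ℝ] 𝔼}
    {x : 𝔼} (hp : HasFDerivAt p p' x) (hA : HasFDerivAt A A' x) (h0 : A x ≠ 0) :
    HasFDerivAt (fun z => ‖A z‖ ^ (p z - 2) • A z)
      (‖A x‖ ^ (p x - 2) • A' +
        (((p x - 2) * ‖A x‖ ^ (p x - 2 - 2)) • (innerSL ℝ (A x)).comp A' +
          (‖A x‖ ^ (p x - 2) * Real.log ‖A x‖) • p').smulRight (A x)) x := by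
  have hN : 0 < ‖A x‖ := norm_pos_iff.2 h0
  have h1 : HasFDerivAt (fun z => ‖A z‖ ^ 2) (2 • (innerSL ℝ (A x)).comp A') x := hA.norm_sq
  have h2 : HasFDerivAt (fun z => ‖A z‖) (‖A x‖⁻¹ • (innerSL ℝ (A x)).comp A') x := by
    have h3 := h1.sqrt (by positivity)
    simp only [Real.sqrt_sq (norm_nonneg _)] at h3
    refine h3.congr_fderiv ?_
    ext e
    simp only [smul_apply, smul_eq_mul, nsmul_eq_mul, Nat.cast_ofNat]
    field_simp
  have h4 : HasFDerivAt (fun z => ‖A z‖ ^ (p z - 2)) _ x := h2.rpow (hp.sub_const 2) hN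
  refine (h4.fun_smul hA).congr_fderiv ?_
  rw [smul_smul, mul_assoc, show p x - 2 - 2 = (p x - 2 - 1) - 1 by ring,
    Real.rpow_sub_one hN.ne' (p x - 2 - 1), div_eq_mul_inv]

theorem divergence_rpow_norm_gradient {p Q : 𝔼 → ℝ} {x : 𝔼} (hp : DifferentiableAt ℝ p x)
    (hQ : DifferentiableAt ℝ (fderiv ℝ Q) x) (h0 : gradient Q x ≠ 0) :
    divergence (fun z => ‖gradient Q z‖ ^ (p z - 2) • gradient Q z) x = pxLaplacian p Q x := by
  set J : (𝔼 →L[ℝ] ℝ) →L[ℝ] 𝔼 :=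
    (InnerProductSpace.toDual ℝ 𝔼).symm.toContinuousLinearEquiv.toContinuousLinearMap with hJ
  have hJi : ∀ (L : 𝔼 →L[ℝ] ℝ) (e : 𝔼), inner ℝ (J L) e = L e := fun L e =>
    InnerProductSpace.toDual_symm_apply
  have hA : HasFDerivAt (gradient Q) (J.comp (fderiv ℝ (fderiv ℝ Q) x)) x :=
    J.hasFDerivAt.comp x hQ.hasFDerivAt
  have hN : 0 < ‖gradient Q x‖ := norm_pos_iff.2 h0
  rw [divergence, (hasFDerivAt_rpow_norm_smul hp.hasFDerivAt hA h0).fderiv,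
    pxLaplacian_eq_pxOperator, pxOperator]
  set X := fderiv ℝ (fderiv ℝ Q) x
  set a := gradient Q x
  have hcoord : ∀ (u : 𝔼) (i : Fin n), u i = inner ℝ u (EuclideanSpace.single i 1) := by
    intro u i
    simp [EuclideanSpace.inner_single_right]
  have e1 : ∀ i, (J (X (EuclideanSpace.single i 1))) i =
      X (EuclideanSpace.single i 1) (EuclideanSpace.single i 1) := by
    intro i
    rw [hcoord, hJi]
  simp only [add_apply, smul_apply, ContinuousLinearMap.smulRight_apply,
    ContinuousLinearMap.comp_apply, PiLp.add_apply, PiLp.smul_apply, smul_eq_mul, e1,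
    innerSL_apply_apply, Finset.sum_add_distrib, ← Finset.mul_sum, add_mul, mul_assoc]
  have e2 : ∑ i, inner ℝ a (J (X (EuclideanSpace.single i 1))) * a i = X a a := by
    have := sum_clm_single ((innerSL ℝ a).comp (J.comp X)) a
    simp only [ContinuousLinearMap.comp_apply, innerSL_apply_apply] at this
    rw [this, real_inner_comm, hJi]
  rw [e2, sum_clm_single, ← inner_gradient_left, Real.rpow_sub hN (p x - 2) 2]
  simp only [map_smul, smul_apply, smul_eq_mul, Real.rpow_two]
  field_simp
  ring

theorem contDiffAt_rpow_norm_gradient {p Q : 𝔼 → ℝ} {x : 𝔼} (hp : ContDiffAt ℝ 1 p x)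
    (hQ : ContDiffAt ℝ 2 Q x) (h0 : gradient Q x ≠ 0) :
    ContDiffAt ℝ 1 (fun z => ‖gradient Q z‖ ^ (p z - 2) • gradient Q z) x := by
  have hA : ContDiffAt ℝ 1 (gradient Q) x :=
    (InnerProductSpace.toDual ℝ 𝔼).symm.contDiff.contDiffAt.comp x
      (hQ.fderiv_right (by norm_num))
  exact ((hA.norm ℝ h0).rpow (hp.sub contDiffAt_const) (norm_ne_zero_iff.2 h0)).smul hA

/-- The quadratic polynomial with prescribed second order jet at `y`. -/
def quadraticJet (y : 𝔼) (c : ℝ) (η : 𝔼) (X : 𝔼 →L[ℝ] 𝔼 →L[ℝ] ℝ) (x : 𝔼) : ℝ :=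
  c + inner ℝ η (x - y) + 2⁻¹ * X (x - y) (x - y)

theorem contDiff_quadraticJet (y : 𝔼) (c : ℝ) (η : 𝔼) (X : 𝔼 →L[ℝ] 𝔼 →L[ℝ] ℝ)
    {m : WithTop ℕ∞} : ContDiff ℝ m (quadraticJet y c η X) := by
  unfold quadraticJet
  have h1 : ContDiff ℝ m fun x : 𝔼 => x - y := contDiff_id.sub contDiff_const
  exact (contDiff_const.add (contDiff_const.inner ℝ h1)).add
    (contDiff_const.mul ((X.contDiff.comp h1).clm_apply h1))

theorem fderiv_quadraticJet (y : 𝔼) (c : ℝ) (η : 𝔼) {X : 𝔼 →L[ℝ] 𝔼 →L[ℝ] ℝ}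
    (hX : ∀ u v, X u v = X v u) :
    fderiv ℝ (quadraticJet y c η X) = fun x => innerSL ℝ η + X (x - y) := by
  ext1 x
  have h1 : HasFDerivAt (fun x : 𝔼 => x - y) (.id ℝ 𝔼) x := (hasFDerivAt_id x).sub_const y
  have h2 : HasFDerivAt (fun x : 𝔼 => X (x - y)) X x := X.hasFDerivAt.comp x h1
  have h3 := h2.clm_apply h1
  have h4 : HasFDerivAt (fun x : 𝔼 => inner ℝ η (x - y)) (innerSL ℝ η) x :=
    (innerSL ℝ η).hasFDerivAt.comp x h1
  have h5 : HasFDerivAt (quadraticJet y c η X) _ x := (h4.const_add c).add (h3.const_mul 2⁻¹)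
  rw [h5.fderiv]
  ext e
  have h6 := hX e (x - y)
  simp only [add_apply, smul_apply, ContinuousLinearMap.comp_apply, ContinuousLinearMap.flip_apply,
    ContinuousLinearMap.id_apply, smul_eq_mul, h6]
  ring

theorem gradient_quadraticJet (y : 𝔼) (c : ℝ) (η : 𝔼) {X : 𝔼 →L[ℝ] 𝔼 →L[ℝ] ℝ}
    (hX : ∀ u v, X u v = X v u) : gradient (quadraticJet y c η X) y = η := by
  refine ext_inner_right ℝ fun e => ?_
  rw [inner_gradient_left, fderiv_quadraticJet y c η hX]
  simp

theorem fderiv_fderiv_quadraticJet (y : 𝔼) (c : ℝ) (η : 𝔼) {X : 𝔼 →L[ℝ] 𝔼 →L[ℝ] ℝ}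
    (hX : ∀ u v, X u v = X v u) : fderiv ℝ (fderiv ℝ (quadraticJet y c η X)) y = X := by
  rw [fderiv_quadraticJet y c η hX]
  have h1 : HasFDerivAt (fun x : 𝔼 => x - y) (.id ℝ 𝔼) y := (hasFDerivAt_id y).sub_const y
  exact ((X.hasFDerivAt.comp y h1).const_add (innerSL ℝ η)).fderiv

/-- The inner product as a bilinear form. -/
def innerForm : 𝔼 →L[ℝ] 𝔼 →L[ℝ] ℝ := innerSL ℝ

@[simp]
theorem innerForm_apply (u v : 𝔼) : innerForm u v = inner ℝ u v := rfl

theorem tendsto_pxOperator_add_inner (q : ℝ) (ξ η : 𝔼) (X : 𝔼 →L[ℝ] 𝔼 →L[ℝ] ℝ) (c : ℝ) :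
    Tendsto (fun τ : ℝ => pxOperator q ξ η (X + (c * τ) • innerForm)) (𝓝[>] 0)
      (𝓝 (pxOperator q ξ η X)) := by
  have h : Continuous fun τ : ℝ => pxOperator q ξ η (X + (c * τ) • innerForm) := by
    unfold pxOperator
    simp only [add_apply, smul_apply, smul_eq_mul]
    fun_prop
  have := (h.tendsto 0).mono_left (nhdsWithin_le_nhds (s := Ioi 0))
  have h0 : X + (c * 0) • innerForm = X := by
    ext u v
    simp
  rwa [h0] at this

theorem quadraticJet_add_inner (y : 𝔼) (c : ℝ) (η : 𝔼) (X : 𝔼 →L[ℝ] 𝔼 →L[ℝ] ℝ) (t : ℝ) (e : 𝔼) :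
    quadraticJet y c η (X + t • innerForm) (y + e) =
      c + inner ℝ η e + 2⁻¹ * X e e + 2⁻¹ * t * ‖e‖ ^ 2 := by
  simp only [quadraticJet, add_sub_cancel_left, add_apply, smul_apply, smul_eq_mul,
    innerForm_apply, real_inner_self_eq_norm_sq]
  ring

theorem eventually_nhds_of_eventually_add {y : 𝔼} {P : 𝔼 → Prop} (h : ∀ᶠ e in 𝓝 0, P (y + e)) :
    ∀ᶠ x in 𝓝 y, P x := by
  have h1 : Tendsto (fun x => x - y) (𝓝 y) (𝓝 0) := by
    have h2 : Continuous fun x : 𝔼 => x - y := by fun_prop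
    simpa using h2.tendsto y
  filter_upwards [h1.eventually h] with x hx
  simpa using hx

/-- Weak solutions of `-Δ_{p(x)} h = -ε` are viscosity subsolutions away from critical points. -/
theorem le_pxOperator_of_superjet {p : 𝔼 → ℝ} (hp : ContDiff ℝ 1 p) {D : Opens 𝔼} {pM ε : ℝ}
    (hpD : ∀ x ∈ D, 1 < p x ∧ p x ≤ pM) {h : 𝔼 → ℝ}
    (hLip : LocallyLipschitzOn (D : Set 𝔼) h) (hsol : IsWeakSolution p (-ε) D h) {y : 𝔼}
    (hy : y ∈ D) {η : 𝔼} (hη : η ≠ 0) {X : 𝔼 →L[ℝ] 𝔼 →L[ℝ] ℝ} (hX : ∀ u v, X u v = X v u)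
    (hjet : ∀ τ > 0, ∀ᶠ e in 𝓝 (0 : 𝔼),
      h (y + e) ≤ h y + inner ℝ η e + 2⁻¹ * X e e + τ * ‖e‖ ^ 2) :
    ε ≤ pxOperator (p y) (gradient p y) η X := by
  -- Adding `4 * τ` to the Hessian adds `2 * τ * ‖e‖ ^ 2` to the quadratic; half of it absorbs the
  -- error of the jet and the other half makes the touching strict.
  refine ge_of_tendsto (tendsto_pxOperator_add_inner (p y) (gradient p y) η X 4)
    (eventually_nhdsWithin_of_forall fun τ hτ => ?_)
  have hτ' : (0 : ℝ) < τ := hτ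
  set Xτ : 𝔼 →L[ℝ] 𝔼 →L[ℝ] ℝ := X + (4 * τ) • innerForm with hXτ
  have hsym : ∀ u v, Xτ u v = Xτ v u := by
    intro u v
    simp [hXτ, hX u v, real_inner_comm]
  set Q := quadraticJet y (h y) η Xτ with hQ
  have hQc : ContDiff ℝ 2 Q := contDiff_quadraticJet _ _ _ _
  have hQy : gradient Q y = η := gradient_quadraticJet y (h y) η hsym
  have hgc : Continuous (gradient Q) :=
    (InnerProductSpace.toDual ℝ 𝔼).symm.continuous.comp (hQc.continuous_fderiv two_ne_zero)
  have hev : ∀ᶠ x in 𝓝 y, x ≠ y → h x < Q x := by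
    refine eventually_nhds_of_eventually_add ?_
    filter_upwards [hjet τ hτ'] with e he hne
    have he0 : 0 < ‖e‖ := norm_pos_iff.2 (by simpa using hne)
    rw [hQ, hXτ, quadraticJet_add_inner]
    have : 0 < τ * ‖e‖ ^ 2 := by positivity
    linarith
  have hall : ∀ᶠ x in 𝓝 y, (x ≠ y → h x < Q x) ∧ gradient Q x ≠ 0 ∧ x ∈ D :=
    hev.and ((hgc.continuousAt.eventually_ne (by rwa [hQy])).and (D.isOpen.mem_nhds hy))
  obtain ⟨O, hO, hOo, hyO⟩ := eventually_nhds_iff.1 hall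
  have h1 := le_divergence_of_touching_above hp.continuous hpD hLip hsol (hOo.mem_nhds hyO) hOo
    (fun x hx => (hO x hx).2.2) (Q := Q)
    (V := fun z => ‖gradient Q z‖ ^ (p z - 2) • gradient Q z)
    (hQc.of_le (by norm_num)).contDiffOn
    (fun x hx => (contDiffAt_rpow_norm_gradient hp.contDiffAt hQc.contDiffAt
      (hO x hx).2.1).contDiffWithinAt) (fun x _ => rfl)
    (by simp [hQ, quadraticJet]) (fun x hx hxy => (hO x hx).1 hxy)
  rwa [divergence_rpow_norm_gradient (hp.differentiable one_ne_zero y)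
    ((hQc.fderiv_right (m := 1) (by norm_num)).differentiable one_ne_zero y) (by rwa [hQy]),
    pxLaplacian_eq_pxOperator, hQy, fderiv_fderiv_quadraticJet y _ η hsym] at h1

end Operator

/-! ### Exclusion of contact with flat powers at a critical point. -/

section CriticalTouching

variable {n : ℕ}

local notation "𝔼" => EuclideanSpace ℝ (Fin n)

theorem norm_fderiv_rpow_norm_smul_le {p : 𝔼 → ℝ} {A : 𝔼 → 𝔼} {p' : 𝔼 →L[ℝ] ℝ}
    {A' : 𝔼 →L[ℝ] 𝔼} {x : 𝔼} (hp : HasFDerivAt p p' x) (hA : HasFDerivAt A A' x) (h0 : A x ≠ 0) :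
    ‖fderiv ℝ (fun z => ‖A z‖ ^ (p z - 2) • A z) x‖ ≤
      ‖A x‖ ^ (p x - 2) * ‖A'‖ * (1 + |p x - 2|) +
        ‖A x‖ ^ (p x - 1) * |Real.log ‖A x‖| * ‖p'‖ := by
  have hN : 0 < ‖A x‖ := norm_pos_iff.2 h0
  rw [(hasFDerivAt_rpow_norm_smul hp hA h0).fderiv]
  have e1 : ‖A x‖ ^ (p x - 2 - 2) * ‖A x‖ * ‖A x‖ = ‖A x‖ ^ (p x - 2) := by
    rw [Real.rpow_sub hN (p x - 2) 2, Real.rpow_two]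
    field_simp
  have e2 : ‖A x‖ ^ (p x - 2) * ‖A x‖ = ‖A x‖ ^ (p x - 1) := by
    nth_rewrite 2 [← Real.rpow_one ‖A x‖]
    rw [← Real.rpow_add hN]
    congr 1; ring
  have h1 : ‖(innerSL ℝ (A x)).comp A'‖ ≤ ‖A x‖ * ‖A'‖ := by
    refine (ContinuousLinearMap.opNorm_comp_le _ _).trans ?_
    rw [innerSL_apply_norm]
  have h2 : ‖((p x - 2) * ‖A x‖ ^ (p x - 2 - 2)) • (innerSL ℝ (A x)).comp A' +
      (‖A x‖ ^ (p x - 2) * Real.log ‖A x‖) • p'‖ ≤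
      |p x - 2| * ‖A x‖ ^ (p x - 2 - 2) * (‖A x‖ * ‖A'‖) +
      ‖A x‖ ^ (p x - 2) * |Real.log ‖A x‖| * ‖p'‖ := by
    refine (norm_add_le _ _).trans (add_le_add ?_ ?_)
    · rw [norm_smul, norm_mul, Real.norm_eq_abs, Real.norm_of_nonneg (by positivity)]
      exact mul_le_mul_of_nonneg_left h1 (by positivity)
    · rw [norm_smul, norm_mul, Real.norm_of_nonneg (by positivity), Real.norm_eq_abs]
  refine (norm_add_le _ _).trans ?_
  rw [norm_smul, Real.norm_of_nonneg (by positivity), ContinuousLinearMap.norm_smulRight_apply]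
  refine (add_le_add_right (mul_le_mul_of_nonneg_right h2 (norm_nonneg _)) _).trans (le_of_eq ?_)
  rw [← e1, ← e2, ← e1]
  ring

theorem gradient_norm_sq_pow (c B : ℝ) (k : ℕ) (y : 𝔼) :
    gradient (fun x : 𝔼 => c + B * (‖x - y‖ ^ 2) ^ (k + 1)) =
      fun x => (2 * B * (k + 1) * (‖x - y‖ ^ 2) ^ k) • (x - y) := by
  ext1 x
  have h1 : HasFDerivAt (fun x : 𝔼 => x - y) (.id ℝ 𝔼) x := (hasFDerivAt_id x).sub_const y
  have h2 := (((h1.norm_sq).pow (k + 1)).const_mul B).const_add c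
  refine ext_inner_right ℝ fun e => ?_
  rw [inner_gradient_left, h2.fderiv, inner_smul_left]
  simp [inner_sub_left]
  ring

theorem exists_hasFDerivAt_norm_sq_pow_smul {b : ℝ} (hb : 0 < b) {k : ℕ} (hk : 1 ≤ k) (y x : 𝔼) :
    ∃ A' : 𝔼 →L[ℝ] 𝔼, HasFDerivAt (fun x : 𝔼 => (b * (‖x - y‖ ^ 2) ^ k) • (x - y)) A' x ∧
      ‖A'‖ ≤ (1 + 2 * k) * (b * (‖x - y‖ ^ 2) ^ k) := by
  have h1 : HasFDerivAt (fun x : 𝔼 => x - y) (.id ℝ 𝔼) x := (hasFDerivAt_id x).sub_const y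
  have h2 := (((h1.norm_sq).pow k).const_mul b).fun_smul h1
  refine ⟨_, h2, (norm_add_le _ _).trans ?_⟩
  rw [norm_smul, ContinuousLinearMap.norm_smulRight_apply, norm_smul, norm_smul,
    Real.norm_of_nonneg (by positivity), Real.norm_of_nonneg hb.le]
  have h3 : ‖ContinuousLinearMap.id ℝ 𝔼‖ ≤ 1 := ContinuousLinearMap.norm_id_le
  have h4 : ‖(2 : ℕ) • (innerSL ℝ (x - y)).comp (ContinuousLinearMap.id ℝ 𝔼)‖ ≤ 2 * ‖x - y‖ := by
    rw [ContinuousLinearMap.comp_id, ← Nat.cast_smul_eq_nsmul ℝ, norm_smul, innerSL_apply_norm]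
    simp
  have h5 : ‖(k • (‖x - y‖ ^ 2) ^ (k - 1))‖ = k * (‖x - y‖ ^ 2) ^ (k - 1) := by
    rw [nsmul_eq_mul, Real.norm_of_nonneg (by positivity)]
  obtain ⟨j, rfl⟩ := Nat.exists_eq_add_of_le' hk
  rw [h5, add_tsub_cancel_right]
  have h6 : b * (((j + 1 : ℕ) : ℝ) * (‖x - y‖ ^ 2) ^ j *
      ‖(2 : ℕ) • (innerSL ℝ (x - y)).comp (ContinuousLinearMap.id ℝ 𝔼)‖) * ‖x - y‖ ≤
      b * (((j + 1 : ℕ) : ℝ) * (‖x - y‖ ^ 2) ^ j * (2 * ‖x - y‖)) * ‖x - y‖ := by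
    gcongr
  have h7 : b * (‖x - y‖ ^ 2) ^ (j + 1) * ‖ContinuousLinearMap.id ℝ 𝔼‖ ≤
      b * (‖x - y‖ ^ 2) ^ (j + 1) * 1 := by gcongr
  refine (add_le_add h7 h6).trans (le_of_eq ?_)
  rw [pow_succ]
  ring

/-- A solution of `-Δ_{p(x)} h = -ε` is not touched from above by a sufficiently flat power. -/
theorem not_eventually_le_norm_pow {p : 𝔼 → ℝ} (hp : ContDiff ℝ 1 p) {D : Opens 𝔼} {pm pM ε : ℝ}
    (hε : 0 < ε) (hpm : 1 < pm) (hpD : ∀ x ∈ D, pm ≤ p x ∧ p x ≤ pM) {h : 𝔼 → ℝ}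
    (hLip : LocallyLipschitzOn (D : Set 𝔼) h) (hsol : IsWeakSolution p (-ε) D h) {y : 𝔼}
    (hy : y ∈ D) {k : ℕ} (hk : 1 ≤ k) (hkp : 2 ≤ (2 * k + 1) * (pm - 1)) (c : ℝ) :
    ¬ ∀ᶠ x in 𝓝 y, h x ≤ h y + c * (‖x - y‖ ^ 2) ^ (k + 1) := by
  intro hle
  -- Any positive coefficient larger than `c` makes the contact strict.
  set B := max c 0 + 1 with hB
  have hBpos : 0 < B := by positivity
  have hcB : c < B := by
    have := le_max_left c 0
    linarith
  set b := 2 * B * (k + 1) with hb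
  have hbpos : 0 < b := by positivity
  set Q : 𝔼 → ℝ := fun x => h y + B * (‖x - y‖ ^ 2) ^ (k + 1) with hQ
  set A : 𝔼 → 𝔼 := fun x => (b * (‖x - y‖ ^ 2) ^ k) • (x - y) with hA
  have hQA : gradient Q = A := gradient_norm_sq_pow _ _ _ _
  have hAn : ∀ x, ‖A x‖ = b * ‖x - y‖ ^ (2 * k + 1) := by
    intro x
    rw [hA]
    simp only
    rw [norm_smul, Real.norm_of_nonneg (by positivity), ← pow_mul, pow_succ, mul_assoc]
  have hA0 : ∀ x, x ≠ y → A x ≠ 0 := by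
    intro x hx
    rw [← norm_pos_iff, hAn]
    have : 0 < ‖x - y‖ := norm_pos_iff.2 (sub_ne_zero.2 hx)
    positivity
  have hQc : ContDiff ℝ 2 Q :=
    contDiff_const.add (contDiff_const.mul (((contDiff_id.sub contDiff_const).norm_sq ℝ).pow _))
  set V : 𝔼 → 𝔼 := fun x => ‖A x‖ ^ (p x - 2) • A x with hV
  have hVd : ∀ x, x ≠ y → ContDiffAt ℝ 1 V x := by
    intro x hx
    have := contDiffAt_rpow_norm_gradient (p := p) (Q := Q) hp.contDiffAt hQc.contDiffAt
      (by rw [hQA]; exact hA0 x hx)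
    rwa [hQA] at this
  have hAc : Continuous fun x => ‖A x‖ := by
    simp_rw [hAn]
    fun_prop
  have hAy : ‖A y‖ = 0 := by rw [hAn]; simp
  -- The flux has size `‖A x‖ ^ (p x - 1)`, which is of order at most `‖x - y‖ ^ ((2 * k + 1) * (pm
  -- - 1))`. The flatness condition makes this exponent at least `2`, so the flux has zero
  -- derivative at `y`.
  have hkey : ∀ x ∈ D, ‖A x‖ ≤ 1 → ‖x - y‖ ≤ 1 →
      ‖A x‖ ^ (p x - 1) ≤ b ^ (pm - 1) * ‖x - y‖ ^ 2 := by
    intro x hx hx1 hx2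
    rcases (norm_nonneg (A x)).eq_or_lt with h0 | hpos
    · rw [← h0, Real.zero_rpow (by linarith [(hpD x hx).1])]
      positivity
    refine (Real.rpow_le_rpow_of_exponent_ge hpos hx1 (by linarith [(hpD x hx).1] :
      pm - 1 ≤ p x - 1)).trans ?_
    rw [hAn, Real.mul_rpow hbpos.le (by positivity), ← Real.rpow_natCast, ← Real.rpow_mul
      (norm_nonneg _)]
    refine mul_le_mul_of_nonneg_left ?_ (by positivity)
    rw [← Real.rpow_two]
    have hs : 0 < ‖x - y‖ := by
      rw [norm_pos_iff, sub_ne_zero]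
      rintro rfl
      exact hpos.ne' hAy
    refine Real.rpow_le_rpow_of_exponent_ge hs hx2 ?_
    push_cast
    exact hkp
  have hVy : HasFDerivAt V (0 : 𝔼 →L[ℝ] 𝔼) y := by
    rw [hasFDerivAt_iff_isLittleO]
    have hVy0 : V y = 0 := by
      rw [hV]
      simp only
      rw [norm_eq_zero.1 hAy, smul_zero]
    refine Asymptotics.IsBigO.trans_isLittleO (g := fun x => ‖x - y‖ ^ 2) ?_ ?_
    · refine Asymptotics.IsBigO.of_bound (b ^ (pm - 1)) ?_
      have e1 : ∀ᶠ x in 𝓝 y, ‖A x‖ < 1 :=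
        hAc.continuousAt.eventually_lt_const (hAy.trans_lt one_pos)
      filter_upwards [D.isOpen.mem_nhds hy, e1, Metric.ball_mem_nhds y one_pos] with x hxD hx1 hx2
      rw [hVy0, Real.norm_of_nonneg (by positivity)]
      rw [_root_.zero_apply, sub_zero, sub_zero]
      rw [hV]
      simp only
      rw [norm_smul, Real.norm_of_nonneg (by positivity),
        rpow_sub_two_mul_self (norm_nonneg _) (by linarith [(hpD x hxD).1])]
      refine hkey x hxD hx1.le ?_
      rw [← dist_eq_norm]
      exact (Metric.mem_ball.1 hx2).le
    · have h2 : Tendsto (fun x => x - y) (𝓝 y) (𝓝 0) := by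
        have h2 : Continuous fun x : 𝔼 => x - y := by fun_prop
        simpa using h2.tendsto y
      exact (Asymptotics.isLittleO_norm_pow_id (E' := 𝔼) one_lt_two).comp_tendsto h2
  have hVlim : Tendsto (fderiv ℝ V) (𝓝 y) (𝓝 0) := by
    rw [tendsto_zero_iff_norm_tendsto_zero]
    -- Half of the exponent `pm - 1` absorbs the logarithm coming from the derivative of `p`; the
    -- other half still tends to zero.
    set β : 𝔼 → ℝ := fun x => (1 + 2 * k) * (1 + |p x - 2|) * b ^ (pm - 1) * ‖x - y‖ +
      2 / (pm - 1) * ‖A x‖ ^ ((pm - 1) / 2) * ‖fderiv ℝ p x‖ with hβ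
    have hβc : Tendsto β (𝓝 y) (𝓝 0) := by
      have hpc := hp.continuous
      have hpd := hp.continuous_fderiv one_ne_zero
      have h3 : Continuous fun x => ‖A x‖ ^ ((pm - 1) / 2) :=
        hAc.rpow_const fun x => Or.inr (by linarith)
      have : Continuous β := by
        rw [hβ]
        fun_prop
      have h4 := this.tendsto y
      have h5 : β y = 0 := by
        rw [hβ]
        simp only
        rw [hAy, Real.zero_rpow (by linarith)]
        simp
      rwa [h5] at h4
    refine squeeze_zero' (Eventually.of_forall fun x => norm_nonneg _) ?_ hβc
    have e1 : ∀ᶠ x in 𝓝 y, ‖A x‖ < 1 :=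
      hAc.continuousAt.eventually_lt_const (hAy.trans_lt one_pos)
    filter_upwards [D.isOpen.mem_nhds hy, e1, Metric.ball_mem_nhds y one_pos] with x hxD hx1 hx2
    have hx2' : ‖x - y‖ ≤ 1 := by
      rw [← dist_eq_norm]
      exact (Metric.mem_ball.1 hx2).le
    by_cases hxy : x = y
    · rw [hxy, hVy.fderiv, norm_zero]
      positivity
    have hs : 0 < ‖x - y‖ := norm_pos_iff.2 (sub_ne_zero.2 hxy)
    have hN : 0 < ‖A x‖ := norm_pos_iff.2 (hA0 x hxy)
    obtain ⟨A', hA', hA'n⟩ := exists_hasFDerivAt_norm_sq_pow_smul hbpos hk y x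
    refine (norm_fderiv_rpow_norm_smul_le (hp.differentiable one_ne_zero x).hasFDerivAt hA'
      (hA0 x hxy)).trans ?_
    have hq := hpD x hxD
    refine add_le_add ?_ (mul_le_mul_of_nonneg_right ?_ (norm_nonneg _))
    · have h1 : (b * (‖x - y‖ ^ 2) ^ k) * ‖x - y‖ = ‖A x‖ := by
        rw [hAn, ← pow_mul, pow_succ, mul_assoc]
      have h2 : ‖A x‖ ^ (p x - 2) * (b * (‖x - y‖ ^ 2) ^ k) ≤ b ^ (pm - 1) * ‖x - y‖ := by
        have h3 := hkey x hxD hx1.le hx2'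
        rw [← rpow_sub_two_mul_self hN.le (by linarith)] at h3
        nth_rewrite 2 [← h1] at h3
        refine le_of_mul_le_mul_right ?_ hs
        calc _ = ‖A x‖ ^ (p x - 2) * (b * (‖x - y‖ ^ 2) ^ k * ‖x - y‖) := by ring
          _ ≤ _ := h3
          _ = _ := by ring
      calc _ ≤ ‖A x‖ ^ (p x - 2) * ((1 + 2 * k) * (b * (‖x - y‖ ^ 2) ^ k)) * (1 + |p x - 2|) := by
            gcongr
        _ = (1 + 2 * k) * (1 + |p x - 2|) * (‖A x‖ ^ (p x - 2) * (b * (‖x - y‖ ^ 2) ^ k)) := by ring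
        _ ≤ (1 + 2 * k) * (1 + |p x - 2|) * (b ^ (pm - 1) * ‖x - y‖) := by gcongr
        _ = _ := by ring
    · have h1 := Real.abs_log_mul_self_rpow_lt ‖A x‖ ((pm - 1) / 2) hN hx1.le (by linarith)
      rw [abs_mul, abs_of_nonneg (by positivity : 0 ≤ ‖A x‖ ^ ((pm - 1) / 2)), one_div_div] at h1
      have h2 : ‖A x‖ ^ (p x - 1) ≤ ‖A x‖ ^ ((pm - 1) / 2) * ‖A x‖ ^ ((pm - 1) / 2) := by
        rw [← Real.rpow_add hN]
        exact Real.rpow_le_rpow_of_exponent_ge hN hx1.le (by linarith)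
      calc _ ≤ ‖A x‖ ^ ((pm - 1) / 2) * ‖A x‖ ^ ((pm - 1) / 2) * |Real.log ‖A x‖| := by gcongr
        _ = ‖A x‖ ^ ((pm - 1) / 2) * (|Real.log ‖A x‖| * ‖A x‖ ^ ((pm - 1) / 2)) := by ring
        _ ≤ ‖A x‖ ^ ((pm - 1) / 2) * (2 / (pm - 1)) := by gcongr
        _ = _ := by ring
  have hVC : ContDiff ℝ 1 V := by
    rw [contDiff_one_iff_fderiv]
    constructor
    · intro x
      by_cases hx : x = y
      · rw [hx]; exact hVy.differentiableAt
      · exact (hVd x hx).differentiableAt one_ne_zero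
    · rw [continuous_iff_continuousAt]
      intro x
      by_cases hx : x = y
      · rw [hx, ContinuousAt, hVy.fderiv]
        exact hVlim
      · exact (hVd x hx).continuousAt_fderiv one_ne_zero
  have hev : ∀ᶠ x in 𝓝 y, (x ≠ y → h x < Q x) ∧ x ∈ D := by
    filter_upwards [hle, D.isOpen.mem_nhds hy] with x hx hxD
    refine ⟨fun hxy => hx.trans_lt ?_, hxD⟩
    have hs : 0 < ‖x - y‖ := norm_pos_iff.2 (sub_ne_zero.2 hxy)
    have : c * (‖x - y‖ ^ 2) ^ (k + 1) < B * (‖x - y‖ ^ 2) ^ (k + 1) := by gcongr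
    simp only [hQ]
    linarith
  obtain ⟨O, hO, hOo, hyO⟩ := eventually_nhds_iff.1 hev
  have h1 := le_divergence_of_touching_above hp.continuous
    (fun x hx => ⟨hpm.trans_le (hpD x hx).1, (hpD x hx).2⟩) hLip hsol (hOo.mem_nhds hyO) hOo
    (fun x hx => (hO x hx).2) (Q := Q) (V := V) (hQc.of_le (by norm_num)).contDiffOn
    hVC.contDiffOn (fun x _ => by rw [hQA]) (by simp [hQ]) (fun x hx hxy => (hO x hx).1 hxy)
  -- The flux is `C^1` with zero divergence at `y`, so the weak comparison yields `ε ≤ 0`.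
  rw [divergence, hVy.fderiv] at h1
  simp at h1
  linarith

end CriticalTouching

/-! ### From global test functions to second-order subjets. -/

section ViscosityJets

variable {n : ℕ}

local notation "𝔼" => EuclideanSpace ℝ (Fin n)

theorem exists_real_lt_of_isCompact {v : 𝔼 → EReal} {s : Set 𝔼} (hs : IsCompact s)
    (hv : LowerSemicontinuousOn v s) (hbot : ∀ x ∈ s, v x ≠ ⊥) : ∃ c : ℝ, ∀ x ∈ s, (c : EReal) < v x := by
  rcases s.eq_empty_or_nonempty with rfl | hne
  · exact ⟨0, fun x hx => hx.elim⟩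
  obtain ⟨a, ha, hmin⟩ := LowerSemicontinuousOn.exists_isMinOn hne hs hv
  obtain ⟨c, -, hc⟩ := EReal.lt_iff_exists_real_btwn.1 (bot_lt_iff_ne_bot.2 (hbot a ha))
  exact ⟨c, fun x hx => hc.trans_le (hmin hx)⟩

/-- Test functions must lie below `v` on all of `D`, while `v` may tend to `-∞` at the boundary.
With `ρ` positive exactly on `D`, the sets `{T⁻¹ ≤ ρ}` are compact and `v` is bounded below on each.
A partition of unity on the line assembles these bounds into a smooth function of `1 / ρ`; the
admissible values form convex sets. -/
theorem exists_contDiffOn_lt {D : Opens 𝔼} (hD : Bornology.IsBounded (D : Set 𝔼))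
    {v : 𝔼 → EReal} (hv : LowerSemicontinuousOn v (D : Set 𝔼)) (hbot : ∀ x ∈ D, v x ≠ ⊥) :
    ∃ m : 𝔼 → ℝ, ContDiffOn ℝ 2 m (D : Set 𝔼) ∧ ∀ x ∈ D, (m x : EReal) < v x := by
  obtain ⟨ρ, hρs, hρc, hρr⟩ := D.isOpen.exists_contDiff_support_eq (n := (2 : ℕ∞))
  have hρ0 : ∀ x, 0 ≤ ρ x := fun x => (hρr (mem_range_self x)).1
  have hρD : ∀ x ∈ D, 0 < ρ x := by
    intro x hx
    have : x ∈ Function.support ρ := by rw [hρs]; exact hx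
    exact lt_of_le_of_ne (hρ0 x) (Ne.symm this)
  have hloc : ∀ t : ℝ, ∃ c : ℝ, ∀ᶠ s in 𝓝 t, c ∈ {c : ℝ | ∀ x ∈ D, (ρ x)⁻¹ = s → (c : EReal) < v x} := by
    intro t
    set T := |t| + 1 with hT
    have hTpos : 0 < T := by positivity
    set S : Set 𝔼 := {x | T⁻¹ ≤ ρ x} with hS
    have hSD : S ⊆ D := by
      intro x hx
      rw [← hρs]
      exact ((inv_pos.2 hTpos).trans_le hx).ne'
    have hSc : IsCompact S := Metric.isCompact_of_isClosed_isBounded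
      (isClosed_le continuous_const hρc.continuous) (hD.subset hSD)
    obtain ⟨c, hc⟩ := exists_real_lt_of_isCompact hSc (hv.mono hSD) fun x hx => hbot x (hSD hx)
    refine ⟨c, ?_⟩
    have h1 : ∀ᶠ s in 𝓝 t, s < T := by
      have : t < T := by
        have := le_abs_self t
        linarith
      exact eventually_lt_nhds this
    filter_upwards [h1] with s hs x hx hxs
    refine hc x ?_
    change T⁻¹ ≤ ρ x
    rw [inv_le_comm₀ hTpos (hρD x hx), hxs]
    exact hs.le
  obtain ⟨θ, hθ⟩ := exists_contMDiffMap_forall_mem_convex_of_local_const (n := (2 : ℕ∞))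
    (modelWithCornersSelf ℝ ℝ) (t := fun s => {c : ℝ | ∀ x ∈ D, (ρ x)⁻¹ = s → (c : EReal) < v x})
    (fun s => by
      intro a ha b hb α β hα hβ hαβ x hx hxs
      have h1 : α • a + β • b ≤ max a b := by
        have h2 := mul_le_mul_of_nonneg_left (le_max_left a b) hα
        have h3 := mul_le_mul_of_nonneg_left (le_max_right a b) hβ
        have h4 : (α + β) * max a b = max a b := by rw [hαβ, one_mul]
        rw [add_mul] at h4
        simp only [smul_eq_mul]
        linarith
      refine lt_of_le_of_lt (EReal.coe_le_coe_iff.2 h1) ?_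
      rcases max_choice a b with h | h
      · rw [h]; exact ha x hx hxs
      · rw [h]; exact hb x hx hxs) hloc
  refine ⟨fun x => θ (ρ x)⁻¹, ?_, fun x hx => hθ _ x hx rfl⟩
  have hθc : ContDiff ℝ 2 θ := θ.contMDiff.contDiff
  exact hθc.comp_contDiffOn (hρc.contDiffOn.inv fun x hx => (hρD x hx).ne')

/-- A viscosity supersolution satisfies the pointwise inequality for second order subjets. -/
theorem pxOperator_le_of_subjet {p : 𝔼 → ℝ} {D : Opens 𝔼}
    (hD : Bornology.IsBounded (D : Set 𝔼)) {v : 𝔼 → EReal}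
    (hv : IsViscositySupersolution p D v) {z : 𝔼} (hz : z ∈ D) {r : ℝ} (hvz : v z = r)
    {η : 𝔼} (hη : η ≠ 0) {X : 𝔼 →L[ℝ] 𝔼 →L[ℝ] ℝ} (hX : ∀ a b, X a b = X b a)
    (hjet : ∀ τ > 0, ∀ᶠ e in 𝓝 (0 : 𝔼),
      ((r + inner ℝ η e + 2⁻¹ * X e e - τ * ‖e‖ ^ 2 : ℝ) : EReal) ≤ v (z + e)) :
    pxOperator (p z) (gradient p z) η X ≤ 0 := by
  refine le_of_tendsto (tendsto_pxOperator_add_inner (p z) (gradient p z) η X (-4))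
    (eventually_nhdsWithin_of_forall fun τ hτ => ?_)
  have hτ' : (0 : ℝ) < τ := hτ
  set Xτ : 𝔼 →L[ℝ] 𝔼 →L[ℝ] ℝ := X + (-4 * τ) • innerForm with hXτ
  have hsym : ∀ u v, Xτ u v = Xτ v u := by
    intro u v
    simp [hXτ, hX u v, real_inner_comm]
  set Q := quadraticJet z r η Xτ with hQ
  have hQz : Q z = r := by simp [hQ, quadraticJet]
  have hev : ∀ᶠ x in 𝓝 z, x ≠ z → (Q x : EReal) < v x := by
    refine eventually_nhds_of_eventually_add ?_
    filter_upwards [hjet τ hτ'] with e he hne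
    have he0 : 0 < ‖e‖ := norm_pos_iff.2 (by simpa using hne)
    refine lt_of_lt_of_le (EReal.coe_lt_coe_iff.2 ?_) he
    rw [hQ, hXτ, quadraticJet_add_inner]
    have : 0 < τ * ‖e‖ ^ 2 := by positivity
    linarith
  obtain ⟨δ, hδ, hδQ⟩ := Metric.eventually_nhds_iff_ball.1 hev
  obtain ⟨m, hm, hmv⟩ := exists_contDiffOn_lt hD hv.lsc hv.ne_bot
  let χ : ContDiffBump z := ⟨δ / 2, δ, half_pos hδ, half_lt_self hδ⟩
  -- A convex combination of two functions below `v`: it has the jet of `Q` at `z` and is an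
  -- admissible test function on all of `D`.
  set φ : 𝔼 → ℝ := fun x => χ x * Q x + (1 - χ x) * m x with hφ
  have hφQ : φ =ᶠ[𝓝 z] Q := by
    filter_upwards [χ.eventuallyEq_one] with x hx
    simp [hφ, hx]
  have hφc : ContDiffOn ℝ 2 φ (D : Set 𝔼) :=
    (χ.contDiff.mul (contDiff_quadraticJet _ _ _ _)).contDiffOn.add
      ((contDiff_const.sub χ.contDiff).contDiffOn.mul hm)
  have hgr : gradient φ z = η := by
    rw [gradient, hφQ.fderiv_eq]
    exact gradient_quadraticJet z r η hsym
  have hlt : ∀ x ∈ D, x ≠ z → (φ x : EReal) < v x := by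
    intro x hx hxz
    by_cases hxb : x ∈ Metric.ball z δ
    · have h1 : φ x ≤ max (Q x) (m x) := by
        have h2 := χ.nonneg' x
        have h3 : χ x ≤ 1 := χ.le_one
        simp only [hφ]
        nlinarith [le_max_left (Q x) (m x), le_max_right (Q x) (m x)]
      refine lt_of_le_of_lt (EReal.coe_le_coe_iff.2 h1) ?_
      rcases max_choice (Q x) (m x) with h | h
      · rw [h]; exact hδQ x hxb hxz
      · rw [h]; exact hmv x hx
    · have : χ x = 0 := χ.zero_of_le_dist (by simpa using hxb)
      simp only [hφ, this, zero_mul, sub_zero, one_mul, zero_add]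
      exact hmv x hx
  have h1 := hv.touching φ hφc z hz (by rw [hvz, hφQ.eq_of_nhds, hQz]) hlt (by rwa [hgr])
  rw [pxLaplacian_eq_pxOperator, hgr, hφQ.fderiv.fderiv_eq,
    fderiv_fderiv_quadraticJet z _ η hsym] at h1
  linarith

end ViscosityJets

/-! ### Second-order expansion at a point of twice differentiability. -/

section Taylor

variable {E : Type*} [NormedAddCommGroup E] [NormedSpace ℝ E]

/-- Differentiability of `fderiv F` at the single point `x` suffices: by symmetry of the second
derivative, the remainder has derivative at most `τ * ‖u‖` near `0`, and the mean value inequality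
finishes. -/
theorem eventually_abs_taylor_le {F : E → ℝ} (hF : Differentiable ℝ F) {x : E}
    (hx : DifferentiableAt ℝ (fderiv ℝ F) x) {τ : ℝ} (hτ : 0 < τ) :
    ∀ᶠ e in 𝓝 (0 : E), |F (x + e) - F x - fderiv ℝ F x e -
      2⁻¹ * fderiv ℝ (fderiv ℝ F) x e e| ≤ τ * ‖e‖ ^ 2 := by
  set X := fderiv ℝ (fderiv ℝ F) x with hX
  have hsym : ∀ u v, X u v = X v u :=
    second_derivative_symmetric (fun y => (hF y).hasFDerivAt) hx.hasFDerivAt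
  have h1 := hasFDerivAt_iff_isLittleO_nhds_zero.1 hx.hasFDerivAt
  rw [Asymptotics.isLittleO_iff] at h1
  obtain ⟨δ, hδ, hb⟩ := Metric.eventually_nhds_iff_ball.1 (h1 hτ)
  filter_upwards [Metric.ball_mem_nhds 0 hδ] with e he
  set R : E → ℝ := fun e => F (x + e) - F x - fderiv ℝ F x e - 2⁻¹ * X e e with hR
  have hRd : ∀ e, HasFDerivAt R (fderiv ℝ F (x + e) - fderiv ℝ F x - X e) e := by
    intro e
    have h2 : HasFDerivAt (fun e => F (x + e)) (fderiv ℝ F (x + e)) e := by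
      have h3 : HasFDerivAt (fun e => x + e) (.id ℝ E) e := (hasFDerivAt_id e).const_add x
      exact (hF (x + e)).hasFDerivAt.comp e h3
    have h4 : HasFDerivAt (fun e => X e e) _ e :=
      (X.hasFDerivAt (x := e)).clm_apply (hasFDerivAt_id e)
    have h5 : HasFDerivAt R _ e :=
      ((h2.sub_const (F x)).sub (fderiv ℝ F x).hasFDerivAt).sub (h4.const_mul 2⁻¹)
    refine h5.congr_fderiv ?_
    ext u
    have := hsym u e
    simp only [_root_.sub_apply, _root_.smul_apply, _root_.add_apply,
      ContinuousLinearMap.comp_apply, ContinuousLinearMap.flip_apply,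
      ContinuousLinearMap.id_apply, smul_eq_mul, this]
    ring
  have h2 := (convex_closedBall (0 : E) ‖e‖).norm_image_sub_le_of_norm_hasFDerivWithin_le
    (f := R) (C := τ * ‖e‖) (x := 0) (y := e) (fun u _ => (hRd u).hasFDerivWithinAt)
    (fun u hu => by
      have hu' : ‖u‖ ≤ ‖e‖ := by simpa using hu
      refine (hb u ?_).trans (mul_le_mul_of_nonneg_left hu' hτ.le)
      have : ‖e‖ < δ := by simpa using he
      simpa using hu'.trans_lt this) (by simp) (by simp)
  simp only [hR, add_zero, map_zero, sub_self, mul_zero, sub_zero, Real.norm_eq_abs] at h2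
  rw [pow_two, ← mul_assoc]
  exact h2

/-- The second order necessary condition at a maximum, for a difference of two functions. -/
theorem fderiv_fderiv_le_of_forall_le {F G : E → ℝ} (hF : Differentiable ℝ F)
    (hG : Differentiable ℝ G) {x : E} (hFx : DifferentiableAt ℝ (fderiv ℝ F) x)
    (hGx : DifferentiableAt ℝ (fderiv ℝ G) x) {l : E →L[ℝ] ℝ} {m : ℝ}
    (hle : ∀ y, F y ≤ G y + l y + m) (heq : F x = G x + l x + m) :
    fderiv ℝ F x = fderiv ℝ G x + l ∧
      ∀ e, fderiv ℝ (fderiv ℝ F) x e e ≤ fderiv ℝ (fderiv ℝ G) x e e := by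
  have h1 : fderiv ℝ F x = fderiv ℝ G x + l := by
    have h2 : IsLocalMax (fun y => F y - (G y + l y)) x := by
      refine Eventually.of_forall fun y => ?_
      have := hle y
      simp only
      linarith
    have h3 := h2.fderiv_eq_zero
    rw [fderiv_fun_sub (hF x) ((hG x).fun_add l.differentiableAt),
      fderiv_fun_add (hG x) l.differentiableAt, l.fderiv] at h3
    exact sub_eq_zero.1 h3
  refine ⟨h1, fun e => ?_⟩
  set X := fderiv ℝ (fderiv ℝ F) x
  set Y := fderiv ℝ (fderiv ℝ G) x
  have key : ∀ τ > 0, X e e ≤ Y e e + τ * (4 * ‖e‖ ^ 2) := by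
    intro τ hτ
    have h3 := (eventually_abs_taylor_le hF hFx hτ).and (eventually_abs_taylor_le hG hGx hτ)
    have h4 : Tendsto (fun t : ℝ => t • e) (𝓝[>] 0) (𝓝 0) := by
      have : Continuous fun t : ℝ => t • e := by fun_prop
      simpa using (this.tendsto 0).mono_left (nhdsWithin_le_nhds (s := Ioi 0))
    obtain ⟨t, ht, ht0⟩ := ((h4.eventually h3).and self_mem_nhdsWithin).exists
    have ht0' : 0 < t := ht0
    obtain ⟨h5, h6⟩ := ht
    have h7 := (abs_le.1 h5).1
    have h8 := (abs_le.1 h6).2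
    have h9 := hle (x + t • e)
    rw [h1] at h7
    simp only [map_smul, _root_.smul_apply, _root_.add_apply, smul_eq_mul, norm_smul,
      Real.norm_of_nonneg ht0'.le, map_add] at h7 h8 h9
    have h10 : t ^ 2 * X e e ≤ t ^ 2 * (Y e e + τ * (4 * ‖e‖ ^ 2)) := by
      change _ ≤ F (x + t • e) - F x - t * (fderiv ℝ G x e + l e) - 2⁻¹ * (t * (t * X e e)) at h7
      change G (x + t • e) - G x - t * fderiv ℝ G x e - 2⁻¹ * (t * (t * Y e e)) ≤ _ at h8
      nlinarith
    exact le_of_mul_le_mul_left h10 (by positivity)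
  have h2 : Tendsto (fun τ : ℝ => Y e e + τ * (4 * ‖e‖ ^ 2)) (𝓝[>] 0)
      (𝓝 (Y e e + 0 * (4 * ‖e‖ ^ 2))) :=
    ((continuous_const.add (continuous_id.mul continuous_const)).tendsto 0).mono_left
      nhdsWithin_le_nhds
  simpa using ge_of_tendsto h2 (eventually_nhdsWithin_of_forall key)

end Taylor

/-! ### Sup-convolutions and jets at contact points. -/

section Doubling

variable {E : Type*} [NormedAddCommGroup E] [InnerProductSpace ℝ E]

/-- Sup-convolution over a compact set, with a kernel of quadratic growth. -/
theorem exists_supConvolution {K : Set E} (hK : IsCompact K) (hKne : K.Nonempty) {h : E → ℝ}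
    (hh : UpperSemicontinuousOn h K) {k : E → ℝ} (hk : Differentiable ℝ k) (hk0 : ∀ w, 0 ≤ k w)
    {a : ℝ} (hka : ∀ w e, k (w + e) ≤ k w + fderiv ℝ k w e + a * ‖e‖ ^ 2) :
    ∃ f : E → ℝ, (∀ x, ∃ y ∈ K, f x = h y - k (x - y)) ∧ (∀ x, ∀ y ∈ K, h y - k (x - y) ≤ f x) ∧
      ConvexOn ℝ univ (fun x => f x + a * ‖x‖ ^ 2) ∧ ∃ c, ∀ x, f x ≤ c := by
  have hmax : ∀ x, ∃ y ∈ K, IsMaxOn (fun y => h y - k (x - y)) K y := by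
    intro x
    refine UpperSemicontinuousOn.exists_isMaxOn hKne hK ?_
    have hc : ContinuousOn (fun y => -k (x - y)) K :=
      (hk.continuous.comp (continuous_const.sub continuous_id)).neg.continuousOn
    simpa only [sub_eq_add_neg] using hh.add hc.upperSemicontinuousOn
  choose Y hYK hY using hmax
  refine ⟨fun x => h (Y x) - k (x - Y x), fun x => ⟨Y x, hYK x, rfl⟩, fun x y hy => hY x hy, ?_, ?_⟩
  · refine convexOn_of_affine_support fun x => ?_
    refine ⟨(2 * a) • innerSL ℝ x - fderiv ℝ k (x - Y x), fun x' => ?_⟩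
    have h1 : h (Y x) - k (x' - Y x) ≤ h (Y x') - k (x' - Y x') := hY x' (hYK x)
    have h2 := hka (x - Y x) (x' - x)
    rw [show x - Y x + (x' - x) = x' - Y x by abel] at h2
    have h3 : ‖x'‖ ^ 2 = ‖x‖ ^ 2 + 2 * inner ℝ x (x' - x) + ‖x' - x‖ ^ 2 := by
      rw [← norm_add_sq_real]; simp
    simp only [_root_.sub_apply, _root_.smul_apply, innerSL_apply_apply, smul_eq_mul, h3]
    linarith
  · obtain ⟨y₀, -, hy₀⟩ := UpperSemicontinuousOn.exists_isMaxOn hKne hK hh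
    refine ⟨h y₀, fun x => ?_⟩
    have : h (Y x) ≤ h y₀ := hy₀ (hYK x)
    linarith [hk0 (x - Y x)]

variable [FiniteDimensional ℝ E] [MeasurableSpace E] [BorelSpace E]

/-- If the slopes of `F - G` at the points of a set cover a ball, then both `F` and `G` are twice
differentiable at some point of the set. -/
theorem exists_differentiableAt_fderiv_of_slopes {F G : E → ℝ} {KF KG : NNReal}
    (hF : LipschitzWith KF (fderiv ℝ F)) (hG : LipschitzWith KG (fderiv ℝ G)) {N : Set E} {δ : ℝ}
    (hδ : 0 < δ) (hN : ∀ l : E →L[ℝ] ℝ, ‖l‖ < δ → ∃ x ∈ N, fderiv ℝ F x - fderiv ℝ G x = l) :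
    ∃ x ∈ N, DifferentiableAt ℝ (fderiv ℝ F) x ∧ DifferentiableAt ℝ (fderiv ℝ G) x := by
  by_contra! hcon
  -- This measure is a Haar measure, so Rademacher applies, and it scales well under Lipschitz maps.
  -- If the conclusion failed, `N` would be null, hence so would be its image under the Lipschitz
  -- map of slopes, which contains a ball.
  set μ : Measure E := Measure.hausdorffMeasure (Module.finrank ℝ E) with hμ
  have hnull : μ N = 0 := by
    have h1 : ∀ᵐ x ∂μ, x ∉ N := by
      filter_upwards [hF.ae_differentiableAt (μ := μ), hG.ae_differentiableAt (μ := μ)] with x h1 h2 hx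
      exact hcon x hx h1 h2
    exact measure_eq_zero_iff_ae_notMem.2 h1
  set J := (InnerProductSpace.toDual ℝ E).symm
  have hL : LipschitzWith (KF + KG) fun x => J (fderiv ℝ F x - fderiv ℝ G x) := by
    have := J.lipschitz.comp (hF.sub hG)
    rwa [one_mul] at this
  have h1 := hL.hausdorffMeasure_image_le (Nat.cast_nonneg (Module.finrank ℝ E)) N
  rw [← hμ, hnull, mul_zero] at h1
  have h2 : Metric.ball 0 δ ⊆ (fun x => J (fderiv ℝ F x - fderiv ℝ G x)) '' N := by
    intro u hu
    obtain ⟨x, hx, hxl⟩ := hN (J.symm u) (by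
      rw [LinearIsometryEquiv.norm_map]; simpa using hu)
    exact ⟨x, hx, by simp only [hxl, LinearIsometryEquiv.apply_symm_apply]⟩
  exact (Metric.measure_ball_pos μ 0 hδ).not_ge ((measure_mono h2).trans h1)

/-- A perturbed theorem on sums, with no appeal to Alexandrov's theorem. The Hessians belong to the
regularized sup-convolutions at a common point `x`, and are carried to `y` and `z` by translating
the points. The constants `C` and `R` precede `δ`, so the perturbation can later be removed by
compactness. -/
theorem exists_contact_jets {K : Set E} (hK : IsCompact K) (hKne : K.Nonempty) {h v : E → ℝ}
    (hh : UpperSemicontinuousOn h K) (hv : LowerSemicontinuousOn v K) {k : E → ℝ}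
    (hk : ContDiff ℝ 2 k) (hk0 : ∀ w, 0 ≤ k w) (hkg : ∀ w, ‖w‖ ^ 2 - 1 ≤ k w) {a : ℝ}
    (ha : 0 < a) (hka : ∀ w e, k (w + e) ≤ k w + fderiv ℝ k w e + a * ‖e‖ ^ 2) :
    ∃ (C R : ℝ), ∀ δ > 0, δ < 1 → ∃ (l : E →L[ℝ] ℝ) (x y z : E) (X Y : E →L[ℝ] E →L[ℝ] ℝ),
      ‖l‖ < δ ∧ ‖x‖ ≤ R ∧ y ∈ K ∧ z ∈ K ∧ ‖X‖ ≤ C ∧ ‖Y‖ ≤ C ∧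
      (∀ x', ∀ y' ∈ K, ∀ z' ∈ K, h y' - v z' - k (x' - y') - k (x' - z') - l x' ≤
        h y - v z - k (x - y) - k (x - z) - l x) ∧
      (∀ u w, X u w = X w u) ∧ (∀ u w, Y u w = Y w u) ∧ (∀ e, X e e ≤ Y e e) ∧
      -fderiv ℝ k (x - y) = fderiv ℝ k (x - z) + l ∧
      (∀ τ > 0, ∀ᶠ e in 𝓝 (0 : E), y + e ∈ K →
        h (y + e) ≤ h y - fderiv ℝ k (x - y) e + 2⁻¹ * X e e + τ * ‖e‖ ^ 2) ∧
      ∀ S : E →L[ℝ] E, ∀ τ > 0, ∀ᶠ e in 𝓝 (0 : E), z + e ∈ K →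
        v z + fderiv ℝ k (x - z) e + 2⁻¹ * (Y (S e) (S e) -
          fderiv ℝ (fderiv ℝ k) (x - z) (S e - e) (S e - e)) - τ * ‖e‖ ^ 2 ≤ v (z + e) := by
  have hkd : Differentiable ℝ k := hk.differentiable two_ne_zero
  have hkdd : Differentiable ℝ (fderiv ℝ k) :=
    (hk.fderiv_right (m := 1) (by norm_num)).differentiable one_ne_zero
  obtain ⟨f, hf1, hf2, hf3, cf, hf4⟩ := exists_supConvolution hK hKne hh hkd hk0 hka
  have hv' : UpperSemicontinuousOn (fun z => -v z) K := by
    intro z hz c hc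
    have := hv z hz (-c) (by linarith)
    filter_upwards [this] with u hu
    linarith
  obtain ⟨g', hg1, hg2, hg3, cg, hg4⟩ := exists_supConvolution hK hKne hv' hkd hk0 hka
  obtain ⟨F, G, hF, hG, ⟨KF, hKF⟩, ⟨KG, hKG⟩, hfF, hGg, hmain⟩ :=
    exists_regularization (f := f) (g := fun x => -g' x) (c := max cf cg) ha hf3
      (fun x => (hf4 x).trans (le_max_left _ _)) (by
        have : (fun x => a * ‖x‖ ^ 2 - -g' x) = fun x => g' x + a * ‖x‖ ^ 2 := by
          ext x; ring
        rw [this]; exact hg3)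
      (fun x => neg_le_neg ((hg4 x).trans (le_max_right _ _)))
  obtain ⟨y₀, hy₀⟩ := hKne
  obtain ⟨R₀, hR₀⟩ := hK.isBounded.exists_norm_le
  set M₀ : ℝ := f y₀ + g' y₀ with hM₀
  set R : ℝ := 3 * |R₀| + |cg| + |M₀| + |cf| + |k 0| + 3 with hR
  -- The quadratic growth of `k` beats a perturbation of slope less than `1`, so maxima over `x` are
  -- attained in a fixed ball.
  have hfbound : ∀ x, R ≤ ‖x‖ → ∀ l : E →L[ℝ] ℝ, ‖l‖ < 1 → f x + g' x - l x < M₀ - l y₀ := by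
    intro x hx l hl
    obtain ⟨y, hyK, hy⟩ := hf1 x
    have b1 := hf2 y y hyK
    rw [sub_self] at b1
    have b2 := hf4 y
    have b3 := hkg (x - y)
    have b4 := hg4 x
    have b5 := norm_sub_norm_le x y
    have b6 := hR₀ y hyK
    have b7 := hR₀ y₀ hy₀
    have b8 : -‖x‖ ≤ l x := by
      have := (abs_le.1 ((Real.norm_eq_abs _).symm.le.trans (l.le_of_opNorm_le hl.le x))).1
      linarith
    have b9 : l y₀ ≤ ‖y₀‖ := by
      have := (abs_le.1 ((Real.norm_eq_abs _).symm.le.trans (l.le_of_opNorm_le hl.le y₀))).2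
      linarith
    have a1 := le_abs_self R₀
    have a2 := le_abs_self cg
    have a3 := neg_abs_le M₀
    have a4 := le_abs_self cf
    have a5 := le_abs_self (k 0)
    have a6 : 0 ≤ 2 * |R₀| + |cg| + |M₀| + |cf| + |k 0| := by positivity
    have c1 : 2 * |R₀| + |cg| + |M₀| + |cf| + |k 0| + 3 ≤ ‖x - y‖ := by linarith
    have c2 : ‖x‖ ≤ ‖x - y‖ + R₀ := by linarith
    nlinarith
  have hatt : ∀ l : E →L[ℝ] ℝ, ‖l‖ < 1 → ∃ x, ‖x‖ ≤ R ∧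
      ∀ x', f x' + g' x' - l x' ≤ f x + g' x - l x := by
    intro l hl
    have hc : Continuous fun x => f x + g' x - l x := by
      have c1 : Continuous fun x => f x + a * ‖x‖ ^ 2 := by
        simpa [continuousOn_univ] using hf3.continuousOn isOpen_univ
      have c2 : Continuous fun x => g' x + a * ‖x‖ ^ 2 := by
        simpa [continuousOn_univ] using hg3.continuousOn isOpen_univ
      have c3 : Continuous fun x : E => a * ‖x‖ ^ 2 := by fun_prop
      have : (fun x => f x + g' x - l x) = fun x => (f x + a * ‖x‖ ^ 2) - a * ‖x‖ ^ 2 +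
          ((g' x + a * ‖x‖ ^ 2) - a * ‖x‖ ^ 2) - l x := by
        ext x; ring
      rw [this]
      exact ((c1.sub c3).add (c2.sub c3)).sub l.continuous
    have hRpos : 0 ≤ R := by positivity
    obtain ⟨x, hx, hxm⟩ := (isCompact_closedBall (0 : E) R).exists_isMaxOn
      ⟨0, Metric.mem_closedBall_self hRpos⟩ hc.continuousOn
    have hy₀R : y₀ ∈ Metric.closedBall (0 : E) R := by
      rw [mem_closedBall_zero_iff]
      have := hR₀ y₀ hy₀
      have := le_abs_self R₀
      have : 0 ≤ 2 * |R₀| + |cg| + |M₀| + |cf| + |k 0| + 3 := by positivity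
      linarith
    refine ⟨x, by simpa using hx, fun x' => ?_⟩
    by_cases hx' : x' ∈ Metric.closedBall (0 : E) R
    · exact hxm hx'
    · have h1 : f y₀ + g' y₀ - l y₀ ≤ f x + g' x - l x := hxm hy₀R
      have h2 := hfbound x' (by
        rw [mem_closedBall_zero_iff, not_le] at hx'
        exact hx'.le) l hl
      linarith
  -- `F` and `G` do not depend on the perturbation, so neither do the Lipschitz bounds on their
  -- derivatives, which bound the Hessians.
  refine ⟨max KF KG, R, fun δ hδ hδ1 => ?_⟩
  set N : Set E := {x | ‖x‖ ≤ R ∧ ∃ l : E →L[ℝ] ℝ, ‖l‖ < δ ∧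
    ∀ x', f x' + g' x' - l x' ≤ f x + g' x - l x} with hN
  -- The regularization preserves the affine bound with slope `l`, so it must be exact at a point
  -- where that bound is attained.
  have hcontact : ∀ (l : E →L[ℝ] ℝ) (x : E), (∀ x', f x' + g' x' - l x' ≤ f x + g' x - l x) →
      F x = f x ∧ G x = -g' x ∧ (∀ x', F x' ≤ G x' + l x' + (f x + g' x - l x)) := by
    intro l x hx
    have h1 := hmain l (f x + g' x - l x) (fun x' => by linarith [hx x'])
    have h2 := h1 x
    have h3 := hfF x
    have h4 := hGg x
    refine ⟨by linarith, by linarith, h1⟩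
  obtain ⟨x, ⟨hxR, l, hl, hxl⟩, hxF, hxG⟩ := exists_differentiableAt_fderiv_of_slopes hKF hKG
    (N := N) hδ (by
      intro l hl
      obtain ⟨x, hxR, hx⟩ := hatt l (hl.trans hδ1)
      refine ⟨x, ⟨hxR, l, hl, hx⟩, ?_⟩
      obtain ⟨e1, e2, e3⟩ := hcontact l x hx
      have h2 : IsLocalMax (fun y => F y - (G y + l y)) x := by
        refine Eventually.of_forall fun y => ?_
        have := e3 y
        simp only
        linarith
      have h3 := h2.fderiv_eq_zero
      rw [fderiv_fun_sub (hF x) ((hG x).fun_add l.differentiableAt),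
        fderiv_fun_add (hG x) l.differentiableAt, l.fderiv] at h3
      rw [sub_eq_zero.1 h3]; simp)
  obtain ⟨e1, e2, e3⟩ := hcontact l x hxl
  obtain ⟨hDl, hXY⟩ := fderiv_fderiv_le_of_forall_le hF hG hxF hxG e3 (by linarith)
  obtain ⟨y, hyK, hy⟩ := hf1 x
  obtain ⟨z, hzK, hz⟩ := hg1 x
  have hDF : fderiv ℝ F x = -fderiv ℝ k (x - y) := by
    have h1 : IsLocalMin (fun x' => F x' + k (x' - y)) x := by
      refine Eventually.of_forall fun x' => ?_
      have h2 := hf2 x' y hyK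
      have h3 := hfF x'
      simp only
      linarith
    have h4 : HasFDerivAt (fun x' => x' - y) (.id ℝ E) x := (hasFDerivAt_id x).sub_const y
    have h5 : HasFDerivAt (fun x' => k (x' - y)) (fderiv ℝ k (x - y)) x :=
      (hkd (x - y)).hasFDerivAt.comp x h4
    exact eq_neg_of_add_eq_zero_left (h1.hasFDerivAt_eq_zero ((hF x).hasFDerivAt.add h5))
  have hDG : fderiv ℝ G x = fderiv ℝ k (x - z) := by
    have h1 : IsLocalMax (fun x' => G x' - k (x' - z)) x := by
      refine Eventually.of_forall fun x' => ?_
      have h2 := hg2 x' z hzK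
      have h3 := hGg x'
      simp only
      linarith
    have h4 : HasFDerivAt (fun x' => x' - z) (.id ℝ E) x := (hasFDerivAt_id x).sub_const z
    have h5 : HasFDerivAt (fun x' => k (x' - z)) (fderiv ℝ k (x - z)) x :=
      (hkd (x - z)).hasFDerivAt.comp x h4
    exact sub_eq_zero.1 (h1.hasFDerivAt_eq_zero ((hG x).hasFDerivAt.sub h5))
  refine ⟨l, x, y, z, fderiv ℝ (fderiv ℝ F) x, fderiv ℝ (fderiv ℝ G) x, hl, hxR, hyK, hzK,
    (norm_fderiv_le_of_lipschitz ℝ hKF).trans (le_max_left _ _),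
    (norm_fderiv_le_of_lipschitz ℝ hKG).trans (le_max_right _ _), ?_,
    second_derivative_symmetric (fun y => (hF y).hasFDerivAt) hxF.hasFDerivAt,
    second_derivative_symmetric (fun y => (hG y).hasFDerivAt) hxG.hasFDerivAt, hXY,
    by rw [← hDF, ← hDG, hDl], ?_, ?_⟩
  · intro x' y' hy' z' hz'
    have h1 := hf2 x' y' hy'
    have h2 := hg2 x' z' hz'
    have h3 := hxl x'
    linarith
  · intro τ hτ
    filter_upwards [eventually_abs_taylor_le hF hxF hτ] with e he hye
    have h1 := hf2 (x + e) (y + e) hye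
    rw [add_sub_add_right_eq_sub] at h1
    have h2 := hfF (x + e)
    have h3 := (abs_le.1 he).2
    rw [hDF] at h3
    simp only [_root_.neg_apply] at h3
    linarith
  · intro S τ hτ
    -- Moving `z` by `e` and `x` by `S e` changes the argument of `k` by `T e`. The expansions of
    -- `G` along `S e` and of `k` along `T e` together give the subjet; `B` shares `τ` between their
    -- errors.
    set T : E →L[ℝ] E := S - .id ℝ E with hT
    set B : ℝ := ‖S‖ ^ 2 + ‖T‖ ^ 2 + 1 with hB
    have hBpos : 0 < B := by positivity
    have hτB : 0 < τ / B := by positivity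
    have t1 : Tendsto S (𝓝 0) (𝓝 0) := by simpa using S.continuous.tendsto 0
    have t2 : Tendsto T (𝓝 0) (𝓝 0) := by simpa using T.continuous.tendsto 0
    filter_upwards [t1.eventually (eventually_abs_taylor_le hG hxG hτB),
      t2.eventually (eventually_abs_taylor_le hkd (hkdd (x - z)) hτB)] with e he1 he2 hze
    have h1 := hg2 (x + S e) (z + e) hze
    have h2 := hGg (x + S e)
    have h3 := (abs_le.1 he1).1
    have h4 := (abs_le.1 he2).2
    have e4 : x - z + T e = x + S e - (z + e) := by
      simp only [hT, _root_.sub_apply, ContinuousLinearMap.id_apply]; abel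
    rw [e4] at h4
    have e5 : T e = S e - e := by simp [hT]
    have h5 : τ / B * ‖S e‖ ^ 2 + τ / B * ‖T e‖ ^ 2 ≤ τ * ‖e‖ ^ 2 := by
      have h6 : ‖S e‖ ^ 2 ≤ ‖S‖ ^ 2 * ‖e‖ ^ 2 := by
        rw [← mul_pow]; exact pow_le_pow_left₀ (norm_nonneg _) (S.le_opNorm e) 2
      have h7 : ‖T e‖ ^ 2 ≤ ‖T‖ ^ 2 * ‖e‖ ^ 2 := by
        rw [← mul_pow]; exact pow_le_pow_left₀ (norm_nonneg _) (T.le_opNorm e) 2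
      have h8 : ‖S e‖ ^ 2 + ‖T e‖ ^ 2 ≤ B * ‖e‖ ^ 2 := by
        rw [hB]
        nlinarith [sq_nonneg ‖e‖]
      calc _ = τ / B * (‖S e‖ ^ 2 + ‖T e‖ ^ 2) := by ring
        _ ≤ τ / B * (B * ‖e‖ ^ 2) := by gcongr
        _ = _ := by field_simp
    have e6 : fderiv ℝ k (x - z) (T e) = fderiv ℝ k (x - z) (S e) - fderiv ℝ k (x - z) e := by
      rw [e5, map_sub]
    rw [hDG] at h3
    rw [e6] at h4
    rw [← e5]
    linarith

end Doubling

/-! ### Removal of the linear perturbation. -/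

section Limit

variable {n : ℕ}
local notation "𝔼" => EuclideanSpace ℝ (Fin n)

theorem tendsto_clm_apply {ι F G : Type*} [NormedAddCommGroup F] [NormedSpace ℝ F]
    [NormedAddCommGroup G] [NormedSpace ℝ G] {f : Filter ι} {A : ι → F →L[ℝ] G} {e : ι → F}
    {A₀ : F →L[ℝ] G} {e₀ : F} (hA : Tendsto A f (𝓝 A₀)) (he : Tendsto e f (𝓝 e₀)) :
    Tendsto (fun i => A i (e i)) f (𝓝 (A₀ e₀)) :=
  (isBoundedBilinearMap_apply.continuous.tendsto (A₀, e₀)).comp (hA.prodMk_nhds he)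

theorem tendsto_clm_apply₂ {ι F : Type*} [NormedAddCommGroup F] [NormedSpace ℝ F]
    {f : Filter ι} {A : ι → F →L[ℝ] F →L[ℝ] ℝ} {e : ι → F}
    {A₀ : F →L[ℝ] F →L[ℝ] ℝ} {e₀ : F} (hA : Tendsto A f (𝓝 A₀)) (he : Tendsto e f (𝓝 e₀)) :
    Tendsto (fun i => A i (e i) (e i)) f (𝓝 (A₀ e₀ e₀)) :=
  tendsto_clm_apply (tendsto_clm_apply hA he) he

theorem tendsto_pxOperator {ι : Type*} {f : Filter ι} {q : ι → ℝ} {ξ η : ι → 𝔼}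
    {X : ι → 𝔼 →L[ℝ] 𝔼 →L[ℝ] ℝ} {q₀ : ℝ} {ξ₀ η₀ : 𝔼} {X₀ : 𝔼 →L[ℝ] 𝔼 →L[ℝ] ℝ}
    (hq : Tendsto q f (𝓝 q₀)) (hξ : Tendsto ξ f (𝓝 ξ₀)) (hη : Tendsto η f (𝓝 η₀)) (h0 : η₀ ≠ 0)
    (hX : ∀ (e : ι → 𝔼) (e₀ : 𝔼), Tendsto e f (𝓝 e₀) →
      Tendsto (fun i => X i (e i) (e i)) f (𝓝 (X₀ e₀ e₀))) :
    Tendsto (fun i => pxOperator (q i) (ξ i) (η i) (X i)) f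
      (𝓝 (pxOperator q₀ ξ₀ η₀ X₀)) := by
  have hn : ‖η₀‖ ≠ 0 := norm_ne_zero_iff.2 h0
  unfold pxOperator
  refine ((hη.norm.rpow (hq.sub_const 2) (Or.inl hn))).mul (((tendsto_finsetSum _ fun i _ =>
    hX _ _ tendsto_const_nhds).add ((hξ.inner hη).mul (hη.norm.log hn))).add
    ((hq.sub_const 2).mul (hX _ _ ((hη.norm.inv₀ hn).smul hη))))

set_option synthInstance.maxHeartbeats 200000 in
set_option maxHeartbeats 1000000 in
/-- A maximum point of the doubled functional carries limiting jets at which the viscosity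
inequalities of `h` and `v` hold. -/
theorem exists_maximizer_jets {p : 𝔼 → ℝ} (hp : ContDiff ℝ 1 p) {D : Opens 𝔼}
    (hDb : Bornology.IsBounded (D : Set 𝔼)) {pM : ℝ}
    (hpD : ∀ x ∈ D, 1 < p x ∧ p x ≤ pM) {ε : ℝ} {h : 𝔼 → ℝ}
    (hLip : LocallyLipschitzOn (D : Set 𝔼) h) (hsol : IsWeakSolution p (-ε) D h)
    {v : 𝔼 → EReal} (hv : IsViscositySupersolution p D v)
    {K : Set 𝔼} (hK : IsCompact K) (hKne : K.Nonempty) (hKD : K ⊆ D)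
    {u : 𝔼 → ℝ} (hu : LowerSemicontinuousOn u K) (huv : ∀ z ∈ K, (u z : EReal) ≤ v z) {N : ℝ}
    (huN : ∀ z ∈ K, u z < N → v z = u z)
    {k : 𝔼 → ℝ} (hk : ContDiff ℝ 2 k) (hk0 : ∀ w, 0 ≤ k w) (hkg : ∀ w, ‖w‖ ^ 2 - 1 ≤ k w) {a : ℝ}
    (ha : 0 < a) (hka : ∀ w e, k (w + e) ≤ k w + fderiv ℝ k w e + a * ‖e‖ ^ 2)
    (hmax : ∀ x, ∀ y ∈ K, ∀ z ∈ K,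
      (∀ x', ∀ y' ∈ K, ∀ z' ∈ K, h y' - u z' - k (x' - y') - k (x' - z') ≤
        h y - u z - k (x - y) - k (x - z)) →
      y ∈ interior K ∧ z ∈ interior K ∧ u z < N ∧ gradient k (x - z) ≠ 0) :
    ∃ (x y z : 𝔼) (X Y : 𝔼 →L[ℝ] 𝔼 →L[ℝ] ℝ), y ∈ K ∧ z ∈ K ∧
      (∀ x', ∀ y' ∈ K, ∀ z' ∈ K, h y' - u z' - k (x' - y') - k (x' - z') ≤
        h y - u z - k (x - y) - k (x - z)) ∧
      (∀ e, X e e ≤ Y e e) ∧ -gradient k (x - y) = gradient k (x - z) ∧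
      ε ≤ pxOperator (p y) (gradient p y) (gradient k (x - z)) X ∧
      ∀ S : 𝔼 →L[ℝ] 𝔼, pxOperator (p z) (gradient p z) (gradient k (x - z))
        (Y.bilinearComp S S - (fderiv ℝ (fderiv ℝ k) (x - z)).bilinearComp
          (S - .id ℝ 𝔼) (S - .id ℝ 𝔼)) ≤ 0 := by
  have hhc : ContinuousOn h K := (hLip.continuousOn).mono hKD
  have hkc : Continuous k := hk.continuous
  have hkdc : Continuous (fderiv ℝ k) := hk.continuous_fderiv two_ne_zero
  have hkddc : Continuous (fderiv ℝ (fderiv ℝ k)) :=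
    (hk.fderiv_right (m := 1) (by norm_num)).continuous_fderiv one_ne_zero
  have hkdd : Differentiable ℝ (fderiv ℝ k) :=
    (hk.fderiv_right (m := 1) (by norm_num)).differentiable one_ne_zero
  have hgc : Continuous (gradient k) :=
    (InnerProductSpace.toDual ℝ 𝔼).symm.continuous.comp hkdc
  have hpc : Continuous (gradient p) :=
    (InnerProductSpace.toDual ℝ 𝔼).symm.continuous.comp (hp.continuous_fderiv one_ne_zero)
  have hgi : ∀ w e, inner ℝ (gradient k w) e = fderiv ℝ k w e := fun w e => by
    simp [gradient, InnerProductSpace.toDual_symm_apply]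
  obtain ⟨C, R, hCR⟩ := exists_contact_jets hK hKne hhc.upperSemicontinuousOn hu hk hk0 hkg ha hka
  have hδ : ∀ m : ℕ, (0 : ℝ) < 1 / ((m : ℝ) + 2) ∧ 1 / ((m : ℝ) + 2) < 1 := fun m => by
    constructor
    · positivity
    · rw [div_lt_one (by positivity)]; linarith [(Nat.cast_nonneg m : (0 : ℝ) ≤ m)]
  choose l x y z X Y hl hx hy hz hX hY hM hXs hYs hXY hlk hjy hjz using
    fun m : ℕ => hCR _ (hδ m).1 (hδ m).2
  have : ProperSpace (𝔼 →L[ℝ] 𝔼 →L[ℝ] ℝ) := FiniteDimensional.proper ℝ (𝔼 →L[ℝ] 𝔼 →L[ℝ] ℝ)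
  have hcpt : IsCompact (Metric.closedBall (0 : 𝔼) R ×ˢ K ×ˢ K ×ˢ
      Metric.closedBall (0 : 𝔼 →L[ℝ] 𝔼 →L[ℝ] ℝ) C ×ˢ
      Metric.closedBall (0 : 𝔼 →L[ℝ] 𝔼 →L[ℝ] ℝ) C) :=
    (isCompact_closedBall _ _).prod (hK.prod (hK.prod
      ((isCompact_closedBall _ _).prod (isCompact_closedBall _ _))))
  obtain ⟨⟨x₀, y₀, z₀, X₀, Y₀⟩, hmem, φ, hφ, hlim⟩ := hcpt.tendsto_subseq
    (x := fun m => (x m, y m, z m, X m, Y m)) (fun m => by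
      exact ⟨mem_closedBall_zero_iff.2 (hx m), hy m, hz m, 
        (dist_zero_right (X m)).trans_le (hX m), (dist_zero_right (Y m)).trans_le (hY m)⟩)
  simp only [mem_prod] at hmem
  obtain ⟨-, hyK, hzK, -, -⟩ := hmem
  have hlx : Tendsto (fun m => x (φ m)) atTop (𝓝 x₀) := (continuous_fst.tendsto _).comp hlim
  have hl1 := (continuous_snd.tendsto _).comp hlim
  have hly : Tendsto (fun m => y (φ m)) atTop (𝓝 y₀) := (continuous_fst.tendsto _).comp hl1
  have hl2 := (continuous_snd.tendsto _).comp hl1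
  have hlz : Tendsto (fun m => z (φ m)) atTop (𝓝 z₀) := (continuous_fst.tendsto _).comp hl2
  have hl3 := (continuous_snd.tendsto _).comp hl2
  have hlX : Tendsto (fun m => X (φ m)) atTop (𝓝 X₀) := (continuous_fst.tendsto _).comp hl3
  have hlY : Tendsto (fun m => Y (φ m)) atTop (𝓝 Y₀) := (continuous_snd.tendsto _).comp hl3
  have hll : Tendsto (fun m => l (φ m)) atTop (𝓝 0) := by
    have h1 : Tendsto (fun m : ℕ => 1 / ((m : ℝ) + 2)) atTop (𝓝 0) := by
      have := (tendsto_const_nhds (x := (1 : ℝ))).div_atTop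
        (tendsto_atTop_add_const_right atTop (2 : ℝ) tendsto_natCast_atTop_atTop)
      exact this
    exact (squeeze_zero_norm (fun m => (hl m).le) h1).comp hφ.tendsto_atTop
  have hhl : Tendsto (fun m => h (y (φ m))) atTop (𝓝 (h y₀)) :=
    (hhc y₀ hyK).tendsto.comp (tendsto_nhdsWithin_iff.2 ⟨hly, .of_forall fun m => hy _⟩)
  have hzw : Tendsto (fun m => z (φ m)) atTop (𝓝[K] z₀) :=
    tendsto_nhdsWithin_iff.2 ⟨hlz, .of_forall fun m => hz _⟩
  have hky : Tendsto (fun m => k (x (φ m) - y (φ m))) atTop (𝓝 (k (x₀ - y₀))) :=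
    (hkc.tendsto _).comp (hlx.sub hly)
  have hkz : Tendsto (fun m => k (x (φ m) - z (φ m))) atTop (𝓝 (k (x₀ - z₀))) :=
    (hkc.tendsto _).comp (hlx.sub hlz)
  have hlapp : ∀ (e : ℕ → 𝔼) (e₀ : 𝔼), Tendsto e atTop (𝓝 e₀) →
      Tendsto (fun m => l (φ m) (e m)) atTop (𝓝 0) := fun e e₀ he => by
    simpa using tendsto_clm_apply hll he
  -- Lower semicontinuity of `u` has the right sign for a limit of perturbed maximizers to be an
  -- exact maximizer.
  have hM₀ : ∀ x', ∀ y' ∈ K, ∀ z' ∈ K, h y' - u z' - k (x' - y') - k (x' - z') ≤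
      h y₀ - u z₀ - k (x₀ - y₀) - k (x₀ - z₀) := by
    intro x' y' hy' z' hz'
    refine le_of_forall_pos_le_add fun τ hτ => ?_
    have h1 := hzw.eventually (hu z₀ hzK (u z₀ - τ) (by linarith))
    refine ge_of_tendsto (x := atTop)
      (f := fun m => h (y (φ m)) - (u z₀ - τ) - k (x (φ m) - y (φ m)) - k (x (φ m) - z (φ m)) -
        l (φ m) (x (φ m)) + l (φ m) x') ?_ ?_
    · have := (((((hhl.sub_const (u z₀ - τ)).sub hky).sub hkz).sub (hlapp _ _ hlx)).add
        (hlapp _ x' tendsto_const_nhds))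
      convert this using 2
      ring
    · filter_upwards [h1] with m hm
      have := hM (φ m) x' y' hy' z' hz'
      linarith
  obtain ⟨hyi, hzi, huz, hη⟩ := hmax x₀ y₀ hyK z₀ hzK hM₀
  -- Semicontinuity does not bound `u` from above along the sequence; comparing with the limit point
  -- in the perturbed maximality does.
  have huzN : ∀ᶠ m in atTop, u (z (φ m)) < N := by
    have := ((((((hhl.sub_const (h y₀)).sub hky).sub hkz).sub (hlapp _ _ hlx)).add
        (hlapp _ x₀ tendsto_const_nhds)).add_const (u z₀ + k (x₀ - y₀) + k (x₀ - z₀)))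
    filter_upwards [this.eventually (gt_mem_nhds (a := N) (by simpa using huz))] with m hm
    have := hM (φ m) x₀ y₀ hyK z₀ hzK
    linarith
  have hyiE : ∀ᶠ m in atTop, y (φ m) ∈ interior K := hly.eventually (isOpen_interior.mem_nhds hyi)
  have hziE : ∀ᶠ m in atTop, z (φ m) ∈ interior K := hlz.eventually (isOpen_interior.mem_nhds hzi)
  have hgz : Tendsto (fun m => gradient k (x (φ m) - z (φ m))) atTop (𝓝 (gradient k (x₀ - z₀))) :=
    (hgc.tendsto _).comp (hlx.sub hlz)
  have hgy : Tendsto (fun m => -gradient k (x (φ m) - y (φ m))) atTop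
      (𝓝 (-gradient k (x₀ - y₀))) :=
    ((hgc.tendsto _).comp (hlx.sub hly)).neg
  have hgeq : -gradient k (x₀ - y₀) = gradient k (x₀ - z₀) := by
    have h1 : Tendsto (fun m => -fderiv ℝ k (x (φ m) - y (φ m))) atTop
        (𝓝 (-fderiv ℝ k (x₀ - y₀))) := ((hkdc.tendsto _).comp (hlx.sub hly)).neg
    have h2 : Tendsto (fun m => fderiv ℝ k (x (φ m) - z (φ m)) + l (φ m)) atTop
        (𝓝 (fderiv ℝ k (x₀ - z₀) + 0)) := ((hkdc.tendsto _).comp (hlx.sub hlz)).add hll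
    simp only [hlk] at h1
    have h3 := tendsto_nhds_unique h1 h2
    rw [add_zero] at h3
    rw [gradient, gradient, ← h3, map_neg]
  rw [hgeq] at hgy
  have hint : ∀ w : 𝔼, w ∈ interior K → ∀ᶠ e in 𝓝 (0 : 𝔼), w + e ∈ K := fun w hw => by
    have : Tendsto (fun e : 𝔼 => w + e) (𝓝 0) (𝓝 w) := by
      simpa using (continuous_const.add continuous_id).tendsto (0 : 𝔼) (f := fun e : 𝔼 => w + e)
    exact this.eventually (mem_interior_iff_mem_nhds.1 hw)
  refine ⟨x₀, y₀, z₀, X₀, Y₀, hyK, hzK, hM₀, fun e => ?_, hgeq, ?_, fun S => ?_⟩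
  · exact le_of_tendsto_of_tendsto' (tendsto_clm_apply₂ hlX tendsto_const_nhds)
      (tendsto_clm_apply₂ hlY tendsto_const_nhds)
      fun m => hXY _ e
  · refine ge_of_tendsto (tendsto_pxOperator ((hp.continuous.tendsto _).comp hly)
      ((hpc.tendsto _).comp hly) hgy hη fun e e₀ he => tendsto_clm_apply₂ hlX he) ?_
    filter_upwards [hyiE, hgy.eventually_ne hη] with m hm1 hm2
    refine le_pxOperator_of_superjet hp hpD hLip hsol (hKD (hy _)) hm2 (hXs _) fun τ hτ => ?_
    filter_upwards [hjy (φ m) τ hτ, hint _ hm1] with e he hk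
    have := he hk
    rw [inner_neg_left, hgi]
    linarith
  · set T : 𝔼 →L[ℝ] 𝔼 := S - .id ℝ 𝔼 with hT
    have hdiag : ∀ (Y : 𝔼 →L[ℝ] 𝔼 →L[ℝ] ℝ) (w e : 𝔼), (Y.bilinearComp S S -
        (fderiv ℝ (fderiv ℝ k) w).bilinearComp T T) e e =
        Y (S e) (S e) - fderiv ℝ (fderiv ℝ k) w (T e) (T e) := fun _ _ _ => rfl
    have hZ : ∀ (e : ℕ → 𝔼) (e₀ : 𝔼), Tendsto e atTop (𝓝 e₀) → Tendsto (fun m =>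
        ((Y (φ m)).bilinearComp S S -
          (fderiv ℝ (fderiv ℝ k) (x (φ m) - z (φ m))).bilinearComp T T) (e m) (e m)) atTop
        (𝓝 ((Y₀.bilinearComp S S -
          (fderiv ℝ (fderiv ℝ k) (x₀ - z₀)).bilinearComp T T) e₀ e₀)) := by
      intro e e₀ he
      simp only [hdiag]
      have hS : Tendsto (fun m => S (e m)) atTop (𝓝 (S e₀)) := (S.continuous.tendsto _).comp he
      have hTe : Tendsto (fun m => T (e m)) atTop (𝓝 (T e₀)) := (T.continuous.tendsto _).comp he
      have hk2 : Tendsto (fun m => fderiv ℝ (fderiv ℝ k) (x (φ m) - z (φ m))) atTop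
        (𝓝 (fderiv ℝ (fderiv ℝ k) (x₀ - z₀))) := (hkddc.tendsto _).comp (hlx.sub hlz)
      exact (tendsto_clm_apply₂ hlY hS).sub (tendsto_clm_apply₂ hk2 hTe)
    refine le_of_tendsto (tendsto_pxOperator ((hp.continuous.tendsto _).comp hlz)
      ((hpc.tendsto _).comp hlz) hgz hη hZ) ?_
    filter_upwards [hziE, hgz.eventually_ne hη, huzN] with m hm1 hm2 hm3
    refine pxOperator_le_of_subjet hDb hv (hKD (hz _)) (huN _ (hz _) hm3) hm2 ?_ fun τ hτ => ?_
    · intro e e'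
      have hsym := second_derivative_symmetric
        (fun w => ((hk.differentiable two_ne_zero) w).hasFDerivAt)
        (hkdd (x (φ m) - z (φ m))).hasFDerivAt
      change Y (φ m) (S e) (S e') - fderiv ℝ (fderiv ℝ k) (x (φ m) - z (φ m)) (T e) (T e') =
        Y (φ m) (S e') (S e) - fderiv ℝ (fderiv ℝ k) (x (φ m) - z (φ m)) (T e') (T e)
      rw [hYs, hsym]
    · filter_upwards [hjz (φ m) S τ hτ, hint _ hm1] with e he hk
      refine le_trans ?_ (huv _ hk)
      have := he hk
      rw [hgi, EReal.coe_le_coe_iff, hdiag]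
      exact this

end Limit

/-! ### The doubling kernel. -/

section Kernel

variable {n : ℕ}
local notation "𝔼" => EuclideanSpace ℝ (Fin n)

/-- A smooth doubling kernel which is a high power of the norm near the origin and quadratic at
infinity. -/
theorem exists_kernel (q : ℕ) : ∃ κ : 𝔼 → ℝ, ContDiff ℝ 2 κ ∧
    (∀ w, 0 ≤ κ w) ∧ (∀ w, ‖w‖ ^ 2 - 1 ≤ κ w) ∧ (∀ w, ‖w‖ ≤ 1 → κ w = (‖w‖ ^ 2) ^ (q + 1)) ∧
    (∀ w, 1 ≤ ‖w‖ → 1 ≤ κ w) ∧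
    ∃ a > 0, ∀ w e, κ (w + e) ≤ κ w + fderiv ℝ κ w e + a * ‖e‖ ^ 2 := by
  obtain ⟨χ, hχr⟩ : ∃ χ : ContDiffBump (0 : 𝔼), χ.rIn = 1 := ⟨⟨1, 2, one_pos, one_lt_two⟩, rfl⟩
  have hχ0 : ∀ w, 0 ≤ χ w := fun w => χ.nonneg
  have hχ1 : ∀ w, χ w ≤ 1 := fun w => χ.le_one
  have hχ : ∀ w : 𝔼, ‖w‖ ≤ 1 → χ w = 1 := fun w hw =>
    χ.one_of_mem_closedBall (by simpa [hχr] using hw)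
  -- The kernel is `‖w‖ ^ 2 + g w`. Since `g` is `C^2` with compact support, its derivative is
  -- Lipschitz, and this provides the global quadratic upper bound.
  set g : 𝔼 → ℝ := fun w => χ w * ((‖w‖ ^ 2) ^ (q + 1) - ‖w‖ ^ 2) with hg
  have hg2 : ContDiff ℝ 2 g :=
    χ.contDiff.mul (((contDiff_norm_sq ℝ).pow (q + 1)).sub (contDiff_norm_sq ℝ))
  have hgs : HasCompactSupport g := χ.hasCompactSupport.mul_right
  have hgd := hg2.differentiable two_ne_zero
  obtain ⟨L, hL⟩ := ContDiff.lipschitzWith_of_hasCompactSupport (hgs.fderiv ℝ)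
    (hg2.fderiv_right (m := 1) (by norm_num)) one_ne_zero
  have hge : ∀ w e, g (w + e) ≤ g w + fderiv ℝ g w e + L * ‖e‖ ^ 2 := by
    intro w e
    have h1 := Convex.norm_image_sub_le_of_norm_fderiv_le' (𝕜 := ℝ) (f := g) (φ := fderiv ℝ g w)
      (C := L * ‖e‖) (s := Metric.closedBall w ‖e‖) (fun x _ => hgd x) (fun x hx => by
        refine (hL.norm_sub_le x w).trans ?_
        gcongr
        simpa [dist_eq_norm] using hx) (convex_closedBall w ‖e‖)
      (Metric.mem_closedBall_self (norm_nonneg e)) (y := w + e) (by simp)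
    rw [add_sub_cancel_left] at h1
    have h2 := (abs_le.1 ((Real.norm_eq_abs _).symm.le.trans h1)).2
    nlinarith
  have hκ : ∀ w, ‖w‖ ^ 2 + g w = (1 - χ w) * ‖w‖ ^ 2 + χ w * (‖w‖ ^ 2) ^ (q + 1) := fun w => by
    simp only [hg]; ring
  have hbig : ∀ w : 𝔼, 1 ≤ ‖w‖ → ‖w‖ ^ 2 ≤ ‖w‖ ^ 2 + g w := fun w hw => by
    have : ‖w‖ ^ 2 ≤ (‖w‖ ^ 2) ^ (q + 1) := le_self_pow₀ (one_le_pow₀ hw) (Nat.succ_ne_zero q)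
    have := mul_nonneg (hχ0 w) (sub_nonneg.2 this)
    simp only [hg]
    linarith
  have hpos : ∀ w, 0 ≤ ‖w‖ ^ 2 + g w := fun w => by
    rw [hκ]
    have := hχ0 w
    have := sub_nonneg.2 (hχ1 w)
    positivity
  refine ⟨fun w => ‖w‖ ^ 2 + g w, (contDiff_norm_sq ℝ).add hg2, hpos, fun w => ?_, fun w hw => ?_,
    fun w hw => (one_le_pow₀ hw).trans (hbig w hw), 1 + L, by positivity, fun w e => ?_⟩
  · rcases le_total ‖w‖ 1 with hw | hw
    · have : ‖w‖ ^ 2 ≤ 1 := pow_le_one₀ (norm_nonneg w) hw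
      linarith [hpos w]
    · linarith [hbig w hw]
  · simp [hg, hχ w hw]
  · have h1 : HasFDerivAt (fun w : 𝔼 => ‖w‖ ^ 2) (2 • innerSL ℝ w) w :=
      (hasStrictFDerivAt_norm_sq w).hasFDerivAt
    have h2 : fderiv ℝ (fun w => ‖w‖ ^ 2 + g w) w = 2 • innerSL ℝ w + fderiv ℝ g w :=
      (h1.add (hgd w).hasFDerivAt).fderiv
    simp only [h2, _root_.add_apply, _root_.smul_apply, innerSL_apply_apply,
      nsmul_eq_mul, norm_add_sq_real, Nat.cast_ofNat]
    linarith [hge w e]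

theorem norm_lt_of_kernel_lt {κ : 𝔼 → ℝ} {q : ℕ} (h1 : ∀ w, ‖w‖ ≤ 1 → κ w = (‖w‖ ^ 2) ^ (q + 1))
    (h2 : ∀ w, 1 ≤ ‖w‖ → 1 ≤ κ w) {ρ : ℝ} (hρ : 0 < ρ) (hρ1 : ρ ≤ 1) {w : 𝔼}
    (hw : κ w < (ρ ^ 2) ^ (q + 1)) : ‖w‖ < ρ := by
  by_contra! hcon
  rcases le_total ‖w‖ 1 with hle | hle
  · rw [h1 w hle] at hw
    exact hw.not_ge (by gcongr)
  · have : (ρ ^ 2) ^ (q + 1) ≤ 1 := pow_le_one₀ (by positivity) (pow_le_one₀ hρ.le hρ1)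
    linarith [h2 w hle]

/-- The gradient and the Hessian of a multiple of the power kernel near the origin. -/
theorem gradient_fderiv_kernel {κ : 𝔼 → ℝ} {q : ℕ} (hq : 1 ≤ q)
    (h1 : ∀ w, ‖w‖ ≤ 1 → κ w = (‖w‖ ^ 2) ^ (q + 1)) {j : ℝ} (hj : 0 < j) {w : 𝔼} (hw : ‖w‖ < 1) :
    gradient (fun w => j * κ w) w = (2 * j * (q + 1) * (‖w‖ ^ 2) ^ q) • w ∧
    ∀ e, fderiv ℝ (fderiv ℝ fun w => j * κ w) w e e ≤
      (1 + 2 * q) * (2 * j * (q + 1) * (‖w‖ ^ 2) ^ q) * ‖e‖ ^ 2 := by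
  have hloc : ∀ w : 𝔼, ‖w‖ < 1 →
      gradient (fun w => j * κ w) w = (2 * j * (q + 1) * (‖w‖ ^ 2) ^ q) • w := by
    intro w hw
    have hev : (fun w => j * κ w) =ᶠ[𝓝 w] fun w => 0 + j * (‖w - 0‖ ^ 2) ^ (q + 1) := by
      filter_upwards [isOpen_lt continuous_norm continuous_const |>.mem_nhds hw] with u hu
      rw [h1 u (le_of_lt hu)]; simp
    have := congrFun (gradient_norm_sq_pow 0 j q (0 : 𝔼)) w
    rw [gradient, hev.fderiv_eq, ← gradient, this]
    simp
  refine ⟨hloc w hw, fun e => ?_⟩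
  obtain ⟨A, hA, hAn⟩ := exists_hasFDerivAt_norm_sq_pow_smul (b := 2 * j * (q + 1))
    (by positivity) hq (0 : 𝔼) w
  have hev : gradient (fun w => j * κ w) =ᶠ[𝓝 w]
      fun x => (2 * j * (q + 1) * (‖x - 0‖ ^ 2) ^ q) • (x - 0) := by
    filter_upwards [isOpen_lt continuous_norm continuous_const |>.mem_nhds hw] with u hu
    rw [hloc u hu]; simp
  have hA' : HasFDerivAt (gradient fun w => j * κ w) A w := hA.congr_of_eventuallyEq hev
  have hD : fderiv ℝ (fderiv ℝ fun w => j * κ w) w e e = inner ℝ (A e) e := by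
    have h3 : HasFDerivAt (fderiv ℝ fun w => j * κ w)
        ((innerForm (n := n)).comp A) w := by
      have := (innerForm (n := n)).hasFDerivAt.comp w hA'
      have heq : (innerForm (n := n)) ∘ (gradient fun w => j * κ w) =
          fderiv ℝ fun w => j * κ w := by
        ext u e
        simp [gradient, InnerProductSpace.toDual_symm_apply]
      rwa [heq] at this
    rw [h3.fderiv]
    simp
  rw [hD]
  have h4 : inner ℝ (A e) e ≤ ‖A‖ * ‖e‖ * ‖e‖ :=
    (real_inner_le_norm _ _).trans (by gcongr; exact A.le_opNorm e)
  rw [sub_zero] at hAn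
  nlinarith [sq_nonneg ‖e‖, mul_le_mul_of_nonneg_right hAn (sq_nonneg ‖e‖)]

/-- A one-sided Lipschitz bound controls the derivative. -/
theorem norm_le_of_neg_mul_norm_le {E : Type*} [NormedAddCommGroup E] [NormedSpace ℝ E]
    {g : E → ℝ} {g' : E →L[ℝ] ℝ} {y : E} {L : ℝ} (hL : 0 ≤ L)
    (hg : HasFDerivAt g g' y) (h : ∀ᶠ x in 𝓝 y, g y - L * ‖x - y‖ ≤ g x) : ‖g'‖ ≤ L := by
  have key : ∀ e, -(L * ‖e‖) ≤ g' e := by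
    intro e
    have h1 : HasDerivAt (fun t : ℝ => g (y + t • e)) (g' e) 0 := by
      have h2 : HasDerivAt (fun t : ℝ => y + t • e) e 0 := by
        simpa using ((hasDerivAt_id (0 : ℝ)).smul_const e).const_add y
      have h3 : HasFDerivAt g g' (y + (0 : ℝ) • e) := by simpa using hg
      exact h3.comp_hasDerivAt 0 h2
    have h4 := (hasDerivAt_iff_tendsto_slope.1 h1).mono_left
      -- Only slopes with `t > 0` are bounded below by the hypothesis; the opposite bound on the
      -- derivative follows by replacing `e` with `-e`.
      (nhdsWithin_mono 0 (fun t (ht : 0 < t) => ht.ne') : 𝓝[>] (0 : ℝ) ≤ 𝓝[≠] 0)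
    refine ge_of_tendsto h4 ?_
    have h5 : Tendsto (fun t : ℝ => y + t • e) (𝓝[>] 0) (𝓝 y) := by
      have : Continuous fun t : ℝ => y + t • e := by fun_prop
      simpa using (this.tendsto 0).mono_left nhdsWithin_le_nhds
    filter_upwards [h5.eventually h, self_mem_nhdsWithin] with t ht (ht0 : 0 < t)
    rw [slope_def_field, sub_zero, le_div_iff₀ ht0]
    simp only [add_sub_cancel_left, norm_smul, Real.norm_eq_abs, abs_of_pos ht0, zero_smul,
      add_zero] at ht ⊢
    linarith
  refine g'.opNorm_le_bound hL fun e => ?_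
  rw [Real.norm_eq_abs, abs_le]
  refine ⟨key e, ?_⟩
  have := key (-e)
  rw [norm_neg, map_neg] at this
  linarith

end Kernel

/-! ### Comparison of the operators with two different exponents. -/

section Algebra

variable {n : ℕ}
local notation "𝔼" => EuclideanSpace ℝ (Fin n)

/-- The trace of `Z` conjugated by `s • id + t • ν ⊗ ν`. It is used for a stretch along `ν`, for the
rank-one part alone, and for the projection orthogonal to `ν`. -/
theorem sum_apply_add_smul (Z : 𝔼 →L[ℝ] 𝔼 →L[ℝ] ℝ) {ν : 𝔼} (hν : ‖ν‖ = 1) (s t : ℝ) :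
    ∑ i, Z (s • EuclideanSpace.single i 1 + t • inner ℝ ν (EuclideanSpace.single i (1 : ℝ)) • ν)
      (s • EuclideanSpace.single i 1 + t • inner ℝ ν (EuclideanSpace.single i (1 : ℝ)) • ν) =
    s ^ 2 * ∑ i, Z (EuclideanSpace.single i 1) (EuclideanSpace.single i 1) +
      (2 * s * t + t ^ 2) * Z ν ν := by
  have hi : ∀ i, inner ℝ ν (EuclideanSpace.single i (1 : ℝ)) = ν i := fun i => by
    simp [EuclideanSpace.inner_single_right]
  have h1 : ∑ i, Z (EuclideanSpace.single i 1) ν * ν i = Z ν ν :=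
    sum_clm_single (Z.flip ν) ν
  have h2 : ∑ i, Z ν (EuclideanSpace.single i 1) * ν i = Z ν ν := sum_clm_single (Z ν) ν
  have h3 : ∑ i, ν i * ν i = 1 := by
    have := EuclideanSpace.norm_sq_eq ν
    rw [hν] at this
    simpa [sq] using this.symm
  calc _ = ∑ i, (s ^ 2 * Z (EuclideanSpace.single i 1) (EuclideanSpace.single i 1) +
        s * t * (Z (EuclideanSpace.single i 1) ν * ν i) +
        s * t * (Z ν (EuclideanSpace.single i 1) * ν i) + t ^ 2 * Z ν ν * (ν i * ν i)) := by
        refine Finset.sum_congr rfl fun i _ => ?_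
        rw [hi]
        simp only [map_add, map_smul, _root_.add_apply, _root_.smul_apply, smul_eq_mul]
        ring
    _ = _ := by
        simp only [Finset.sum_add_distrib, ← Finset.mul_sum, h1, h2, h3]
        ring

/-- Doubling comparison for two different exponents. -/
theorem pxOperator_le_of_forall_pxOperator_le {P Q : ℝ} (hP : 1 < P) (hQ : 1 < Q) {ξ ζ η : 𝔼}
    (hη : η ≠ 0) {X Y H : 𝔼 →L[ℝ] 𝔼 →L[ℝ] ℝ} (hXY : ∀ e, X e e ≤ Y e e)
    (hY : ∀ S : 𝔼 →L[ℝ] 𝔼, pxOperator Q ζ η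
      (Y.bilinearComp S S - H.bilinearComp (S - .id ℝ 𝔼) (S - .id ℝ 𝔼)) ≤ 0) :
    pxOperator P ξ η X ≤ ‖η‖ ^ (P - 2) * ((Q - 1) * (√((P - 1) / (Q - 1)) - 1) ^ 2 *
      H (‖η‖⁻¹ • η) (‖η‖⁻¹ • η) + inner ℝ (ξ - ζ) η * Real.log ‖η‖) := by
  have hn : 0 < ‖η‖ := norm_pos_iff.2 hη
  set ν : 𝔼 := ‖η‖⁻¹ • η with hνd
  have hν : ‖ν‖ = 1 := by
    rw [hνd, norm_smul, norm_inv, norm_norm, inv_mul_cancel₀ hn.ne']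
  -- The operator weighs the direction `ν` by exponent minus one and the orthogonal directions by
  -- one. With this `s` the stretched `Y` carries the weight `(Q - 1) * s ^ 2 = P - 1` along `ν`,
  -- exactly that of `X`.
  set s := √((P - 1) / (Q - 1)) with hs
  have hs2 : (Q - 1) * s ^ 2 = P - 1 := by
    rw [hs, Real.sq_sqrt (div_nonneg (by linarith) (by linarith)),
      mul_div_cancel₀ _ (by linarith)]
  set S : 𝔼 →L[ℝ] 𝔼 := .id ℝ 𝔼 + (s - 1) • (innerSL ℝ ν).smulRight ν with hS
  have hSe : ∀ e, S e = e + (s - 1) • inner ℝ ν e • ν := fun e => by simp [hS]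
  have hTe : ∀ e, (S - ContinuousLinearMap.id ℝ 𝔼) e = (s - 1) • inner ℝ ν e • ν := fun e => by simp [hS]
  have hνν : inner ℝ ν ν = 1 := by rw [real_inner_self_eq_norm_sq, hν, one_pow]
  have hSν : S ν = s • ν := by rw [hSe, hνν]; module
  have hTν : (S - ContinuousLinearMap.id ℝ 𝔼) ν = (s - 1) • ν := by rw [hTe, hνν, one_smul]
  have e1 := sum_apply_add_smul Y hν 1 (s - 1)
  have e2 := sum_apply_add_smul H hν 0 (s - 1)
  have e3 := sum_apply_add_smul (Y - X) hν 1 (-1)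
  simp only [one_smul, zero_smul, zero_add] at e1 e2 e3
  -- The trace of `Y - X` on the orthogonal complement of `ν`; the direction `ν` is compared
  -- separately in `h2`.
  have hpos : 0 ≤ ∑ i, (Y - X) (EuclideanSpace.single i 1 +
      (-1 : ℝ) • inner ℝ ν (EuclideanSpace.single i (1 : ℝ)) • ν)
      (EuclideanSpace.single i 1 + (-1 : ℝ) • inner ℝ ν (EuclideanSpace.single i (1 : ℝ)) • ν) :=
    Finset.sum_nonneg fun i _ => by
      simpa only [_root_.sub_apply, sub_nonneg] using hXY _
  rw [e3] at hpos
  simp only [_root_.sub_apply, Finset.sum_sub_distrib] at hpos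
  have hYS := hY S
  unfold pxOperator at hYS
  rw [← hνd] at hYS
  have hZ : ∀ e : 𝔼, (Y.bilinearComp S S - H.bilinearComp (S - ContinuousLinearMap.id ℝ 𝔼) (S - ContinuousLinearMap.id ℝ 𝔼)) e e =
      Y (S e) (S e) - H ((S - ContinuousLinearMap.id ℝ 𝔼) e) ((S - ContinuousLinearMap.id ℝ 𝔼) e) := fun _ => rfl
  rw [hZ ν, hSν, hTν, Finset.sum_congr rfl fun i _ => hZ (EuclideanSpace.single i 1)] at hYS
  simp only [hSe, hTe, Finset.sum_sub_distrib, e1, e2] at hYS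
  simp only [map_smul, _root_.smul_apply, smul_eq_mul] at hYS
  have hYS' := nonpos_of_mul_nonpos_right hYS (Real.rpow_pos_of_pos hn _)
  rw [pxOperator, ← hνd]
  refine mul_le_mul_of_nonneg_left ?_ (Real.rpow_nonneg hn.le _)
  rw [inner_sub_left]
  have h2 : (P - 1) * X ν ν ≤ (P - 1) * Y ν ν :=
    mul_le_mul_of_nonneg_left (hXY ν) (by linarith)
  have h3 : (Q - 1) * s ^ 2 * Y ν ν = (P - 1) * Y ν ν := by rw [hs2]
  linarith

/-- Factor `s ^ 2 - 1 = (P - Q) / (Q - 1)` as `(s - 1) * (s + 1)` and use `s + 1 ≥ 1`. -/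
theorem abs_sqrt_div_sub_one_le {P Q : ℝ} (hP : 1 < P) (hQ : 1 < Q) :
    |√((P - 1) / (Q - 1)) - 1| ≤ |P - Q| / (Q - 1) := by
  have hQ' : 0 < Q - 1 := by linarith
  set s := √((P - 1) / (Q - 1)) with hs
  have hs2 : s ^ 2 = (P - 1) / (Q - 1) := Real.sq_sqrt (div_nonneg (by linarith) (by linarith))
  have hs0 : 0 ≤ s := Real.sqrt_nonneg _
  have h1 : (P - Q) / (Q - 1) = (s - 1) * (s + 1) := by
    rw [show (s - 1) * (s + 1) = s ^ 2 - 1 by ring, hs2]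
    field_simp
    ring
  rw [← congrArg (|P - Q| / ·) (abs_of_pos hQ'), ← abs_div, h1, abs_mul, abs_of_pos (by linarith : 0 < s + 1)]
  nlinarith [abs_nonneg (s - 1)]

/-- For `t ≤ 1` the power `pm - 1 > 0` beats the logarithm; for `t ≥ 1` everything is bounded in
terms of `L` and `pM`. -/
theorem exists_rpow_mul_abs_log_le {pm pM : ℝ} (hpm : 1 < pm) (L : ℝ) :
    ∃ C, 0 ≤ C ∧ ∀ P, pm ≤ P → P ≤ pM → ∀ t, 0 < t → t ≤ L →
      t ^ (P - 1) ≤ C ∧ t ^ (P - 1) * |Real.log t| ≤ C := by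
  set L' := 1 + |L|
  have hL' : 1 ≤ L' := by simp [L']
  have hinv : 0 < 1 / (pm - 1) := by
    have : 0 < pm - 1 := by linarith
    positivity
  refine ⟨1 + 1 / (pm - 1) + L' ^ pM * L', by positivity, fun P hP1 hP2 t ht htL => ?_⟩
  have hc : 0 ≤ L' ^ pM := by positivity
  rcases le_total t 1 with h1 | h1
  · have h2 : t ^ (P - 1) ≤ t ^ (pm - 1) :=
      Real.rpow_le_rpow_of_exponent_ge ht h1 (by linarith)
    have h3 : t ^ (P - 1) ≤ 1 := Real.rpow_le_one ht.le h1 (by linarith)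
    have h4 := Real.abs_log_mul_self_rpow_lt t (pm - 1) ht h1 (by linarith)
    rw [abs_mul, abs_of_nonneg (Real.rpow_nonneg ht.le _)] at h4
    have h5 := mul_le_mul_of_nonneg_right h2 (abs_nonneg (Real.log t))
    have : 0 ≤ L' ^ pM * L' := by positivity
    constructor <;> linarith
  · have htL' : t ≤ L' := by
      have := le_abs_self L
      simp only [L']; linarith
    have h2 : t ^ (P - 1) ≤ L' ^ pM :=
      (Real.rpow_le_rpow ht.le htL' (by linarith)).trans
        (Real.rpow_le_rpow_of_exponent_le hL' (by linarith))
    have h3 : |Real.log t| ≤ L' := by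
      rw [abs_of_nonneg (Real.log_nonneg h1)]
      have := Real.log_le_sub_one_of_pos ht
      linarith
    have h4 : t ^ (P - 1) * |Real.log t| ≤ L' ^ pM * L' := by gcongr
    constructor
    · nlinarith
    · linarith

end Algebra

/-! ### The comparison argument. -/

section Comparison

variable {n : ℕ}
local notation "𝔼" => EuclideanSpace ℝ (Fin n)

/-- The minimum of `v` and `N` makes the doubling real valued; it agrees with `v` where it stays
below `N`, and all maximum points will lie there. -/
theorem exists_real_truncation {v : 𝔼 → EReal} {s : Set 𝔼} (hbot : ∀ x ∈ s, v x ≠ ⊥)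
    (hv : LowerSemicontinuousOn v s) (N : ℝ) :
    ∃ u : 𝔼 → ℝ, LowerSemicontinuousOn u s ∧ (∀ z ∈ s, (u z : EReal) ≤ v z) ∧
      ∀ z ∈ s, u z < N → v z = u z := by
  have hu : ∀ z ∈ s, ((min (v z) (N : EReal)).toReal : EReal) = min (v z) N := fun z hz => by
    refine EReal.coe_toReal ?_ ?_
    · exact ((min_le_right _ _).trans_lt (EReal.coe_lt_top N)).ne
    · exact (lt_min (bot_lt_iff_ne_bot.2 (hbot z hz)) (EReal.bot_lt_coe N)).ne'
  refine ⟨fun z => (min (v z) (N : EReal)).toReal, fun z hz c hc => ?_, fun z hz => ?_,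
    fun z hz hlt => ?_⟩
  · have h1 : (c : EReal) < min (v z) N := by
      rw [← hu z hz]; exact_mod_cast hc
    obtain ⟨h2, h3⟩ := lt_min_iff.1 h1
    filter_upwards [hv z hz c h2, self_mem_nhdsWithin] with x hx hxs
    have : (c : EReal) < ((min (v x) (N : EReal)).toReal : EReal) := by
      rw [hu x hxs]; exact lt_min hx h3
    exact_mod_cast this
  · change ((min (v z) (N : EReal)).toReal : EReal) ≤ v z
    rw [hu z hz]; exact min_le_left _ _
  · have h1 : min (v z) (N : EReal) < N := by
      rw [← hu z hz]; exact_mod_cast hlt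
    change v z = ((min (v z) (N : EReal)).toReal : EReal)
    rw [hu z hz]
    rcases min_lt_iff.1 h1 with h | h
    · exact (min_eq_left h.le).symm
    · exact absurd h (lt_irrefl _)

theorem isCompact_closure_setOf_le {D : Opens 𝔼} (hD : Bornology.IsBounded (D : Set 𝔼))
    {v : 𝔼 → EReal} {h : 𝔼 → ℝ} (hbd : ∀ z ∈ frontier (D : Set 𝔼),
      0 ≤ liminf (fun x => v x - (h x : EReal)) (𝓝[(D : Set 𝔼)] z)) {m : ℝ} (hm : 0 < m) :
    IsCompact (closure {x | x ∈ D ∧ v x ≤ ((h x - m : ℝ) : EReal)}) ∧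
      closure {x | x ∈ D ∧ v x ≤ ((h x - m : ℝ) : EReal)} ⊆ D := by
  set A := {x | x ∈ D ∧ v x ≤ ((h x - m : ℝ) : EReal)} with hA
  have hAD : A ⊆ D := fun x hx => hx.1
  refine ⟨(hD.subset hAD).isCompact_closure, fun z hz => ?_⟩
  by_contra hzD
  have hzf : z ∈ frontier (D : Set 𝔼) :=
    ⟨closure_mono hAD hz, by rwa [D.isOpen.interior_eq]⟩
  have h1 : ((-m : ℝ) : EReal) < liminf (fun x => v x - (h x : EReal)) (𝓝[(D : Set 𝔼)] z) :=
    lt_of_lt_of_le (by exact_mod_cast neg_lt_zero.2 hm) (hbd z hzf)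
  have h2 := eventually_nhdsWithin_iff.1 (eventually_lt_of_lt_liminf h1)
  obtain ⟨x, hx1, hxD, hx2⟩ := mem_closure_iff_nhds.1 hz _ h2
  have h3 := hx1 hxD
  revert hx2 h3
  generalize v x = t
  induction t with
  | bot => simp
  | top => exact fun h4 _ => absurd (top_le_iff.1 h4) (EReal.coe_ne_top _)
  | coe r =>
    intro h4 h5
    norm_cast at h4 h5
    linarith

/-- The squared stretch error is of order `r ^ 2`, while the kernel Hessian is of order `b = ‖η‖ /
r`. The product is of order `r * ‖η‖`, so `‖η‖ ^ (P - 2)` times it is controlled by `r * ‖η‖ ^ (P -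
1)`, however large the kernel multiple is. -/
theorem le_of_le_doubled_pxOperator {P Q pm Lp C σ ε b r : ℝ} {q : ℕ} (hpm : 1 < pm) (hP : pm ≤ P)
    (hQ : pm ≤ Q) {ξ ζ η : 𝔼} {H : 𝔼 →L[ℝ] 𝔼 →L[ℝ] ℝ} (hη : η ≠ 0) (hr : 0 < r)
    (hC1 : ‖η‖ ^ (P - 1) ≤ C) (hC2 : ‖η‖ ^ (P - 1) * |Real.log ‖η‖| ≤ C)
    (hb : b * r = ‖η‖) (hH : H (‖η‖⁻¹ • η) (‖η‖⁻¹ • η) ≤ (1 + 2 * q) * b)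
    (hPQ : |P - Q| ≤ Lp * (2 * r)) (hσ : ‖ξ - ζ‖ ≤ σ)
    (hε : ε ≤ ‖η‖ ^ (P - 2) * ((Q - 1) * (√((P - 1) / (Q - 1)) - 1) ^ 2 *
      H (‖η‖⁻¹ • η) (‖η‖⁻¹ • η) + inner ℝ (ξ - ζ) η * Real.log ‖η‖)) :
    ε ≤ C * (4 * Lp ^ 2 * (1 + 2 * q) / (pm - 1)) * r + C * σ := by
  have hn : 0 < ‖η‖ := norm_pos_iff.2 hη
  have hpm' : 0 < pm - 1 := by linarith
  have hQ' : 0 < Q - 1 := by linarith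
  have hb0 : 0 < b := pos_of_mul_pos_left (hb ▸ hn) hr.le
  have hpow : ‖η‖ ^ (P - 2) * ‖η‖ = ‖η‖ ^ (P - 1) :=
    rpow_sub_two_mul_self hn.le (by linarith)
  have hpow0 : 0 < ‖η‖ ^ (P - 2) := Real.rpow_pos_of_pos hn _
  set s := √((P - 1) / (Q - 1))
  have h1 : (Q - 1) * (s - 1) ^ 2 ≤ 4 * Lp ^ 2 / (pm - 1) * r ^ 2 := by
    have h2 : |s - 1| ≤ |P - Q| / (Q - 1) :=
      abs_sqrt_div_sub_one_le (by linarith) (by linarith)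
    have h3 : |s - 1| ≤ Lp * (2 * r) / (Q - 1) := h2.trans (by gcongr)
    have h4 : (s - 1) ^ 2 ≤ (Lp * (2 * r) / (Q - 1)) ^ 2 := by
      rw [← sq_abs (s - 1)]
      exact pow_le_pow_left₀ (abs_nonneg _) h3 2
    calc (Q - 1) * (s - 1) ^ 2 ≤ (Q - 1) * (Lp * (2 * r) / (Q - 1)) ^ 2 := by gcongr
      _ = 4 * Lp ^ 2 / (Q - 1) * r ^ 2 := by field_simp; ring
      _ ≤ _ := by gcongr
  have h5 : (Q - 1) * (s - 1) ^ 2 * H (‖η‖⁻¹ • η) (‖η‖⁻¹ • η) ≤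
      4 * Lp ^ 2 * (1 + 2 * q) / (pm - 1) * r * ‖η‖ := by
    calc _ ≤ (Q - 1) * (s - 1) ^ 2 * ((1 + 2 * q) * b) := by gcongr
      _ ≤ 4 * Lp ^ 2 / (pm - 1) * r ^ 2 * ((1 + 2 * q) * b) := by gcongr
      _ = _ := by rw [← hb]; ring
  have h6 : inner ℝ (ξ - ζ) η * Real.log ‖η‖ ≤ σ * ‖η‖ * |Real.log ‖η‖| := by
    refine (le_abs_self _).trans ?_
    rw [abs_mul]
    gcongr
    exact (abs_real_inner_le_norm _ _).trans (by gcongr)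
  have hσ0 : 0 ≤ σ := (norm_nonneg _).trans hσ
  calc ε ≤ _ := hε
    _ ≤ ‖η‖ ^ (P - 2) * (4 * Lp ^ 2 * (1 + 2 * q) / (pm - 1) * r * ‖η‖ +
        σ * ‖η‖ * |Real.log ‖η‖|) := by gcongr
    _ = ‖η‖ ^ (P - 1) * (4 * Lp ^ 2 * (1 + 2 * q) / (pm - 1) * r) +
        ‖η‖ ^ (P - 1) * |Real.log ‖η‖| * σ := by rw [← hpow]; ring
    _ ≤ C * (4 * Lp ^ 2 * (1 + 2 * q) / (pm - 1) * r) + C * σ := by gcongr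
    _ = _ := by ring

/-- The comparison principle for viscosity supersolutions. -/
theorem le_of_isViscositySupersolution {p : 𝔼 → ℝ} (hp : ContDiff ℝ 1 p) {D : Opens 𝔼}
    (hD : Bornology.IsBounded (D : Set 𝔼)) {pm pM : ℝ} (hpm : 1 < pm)
    (hpD : ∀ x ∈ D, pm ≤ p x ∧ p x ≤ pM) {ε : ℝ} (hε : 0 < ε) {v : 𝔼 → EReal} {h : 𝔼 → ℝ}
    (hv : IsViscositySupersolution p D v) (hLip : LocallyLipschitzOn (D : Set 𝔼) h)
    (hsol : IsWeakSolution p (-ε) D h)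
    (hbd : ∀ z ∈ frontier (D : Set 𝔼),
      0 ≤ liminf (fun x => v x - (h x : EReal)) (𝓝[(D : Set 𝔼)] z)) :
    ∀ x ∈ D, (h x : EReal) ≤ v x := by
  intro x₀ hx₀
  by_contra! hlt
  obtain ⟨r₀, hr₀⟩ : ∃ r₀ : ℝ, v x₀ = r₀ :=
    ⟨(v x₀).toReal, (EReal.coe_toReal (hlt.trans (EReal.coe_lt_top _)).ne (hv.ne_bot x₀ hx₀)).symm⟩
  obtain ⟨m, hm0, hm⟩ : ∃ m : ℝ, 0 < m ∧ h x₀ - r₀ = m := by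
    refine ⟨h x₀ - r₀, ?_, rfl⟩
    rw [hr₀] at hlt
    have : r₀ < h x₀ := by exact_mod_cast hlt
    linarith
  obtain ⟨hAc, hAD⟩ := isCompact_closure_setOf_le hD hbd (half_pos hm0)
  set A := {x | x ∈ D ∧ v x ≤ ((h x - m / 2 : ℝ) : EReal)} with hA
  have hx₀A : x₀ ∈ A := ⟨hx₀, by
    rw [hr₀, EReal.coe_le_coe_iff]; linarith⟩
  obtain ⟨K, hK, hAK, hKD⟩ := exists_compact_between hAc D.isOpen hAD
  have hx₀K : x₀ ∈ K := interior_subset (hAK (subset_closure hx₀A))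
  have hhc : ContinuousOn h K := hLip.continuousOn.mono hKD
  obtain ⟨L, hL⟩ := (hLip.mono hKD).exists_lipschitzOnWith_of_compact hK
  obtain ⟨Lp, hLp⟩ := ((hp.locallyLipschitz).locallyLipschitzOn
    (s := K)).exists_lipschitzOnWith_of_compact hK
  obtain ⟨N, hN⟩ := (hK.bddAbove_image hhc)
  have hN' : ∀ y ∈ K, h y ≤ N := fun y hy => hN (mem_image_of_mem h hy)
  obtain ⟨u, hu, huv, huN⟩ := exists_real_truncation (s := K) (fun x hx => hv.ne_bot x (hKD hx))
    (hv.lsc.mono hKD) N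
  have hux₀ : u x₀ ≤ r₀ := by
    have := huv x₀ hx₀K
    rw [hr₀] at this
    exact_mod_cast this
  obtain ⟨z₁, hz₁K, hz₁⟩ := hu.exists_isMinOn ⟨x₀, hx₀K⟩ hK
  -- The kernel is flat enough for the exclusion of critical contact, which is delicate when `pm` is
  -- close to `1`.
  obtain ⟨q₀, hq₀⟩ := exists_nat_ge (2 / (pm - 1))
  obtain ⟨q, hq1, hq⟩ : ∃ q : ℕ, 1 ≤ q ∧ 2 ≤ (2 * (q : ℝ) + 1) * (pm - 1) := by
    refine ⟨q₀ + 1, by omega, ?_⟩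
    have hpm' : 0 < pm - 1 := by linarith
    rw [div_le_iff₀ hpm'] at hq₀
    push_cast
    have : 0 ≤ (q₀ : ℝ) * (pm - 1) := by positivity
    nlinarith
  obtain ⟨κ, hκ2, hκ0, hκg, hκ1, hκ1', a, ha, hκa⟩ := exists_kernel (n := n) q
  obtain ⟨C, hC0, hC⟩ := exists_rpow_mul_abs_log_le (pM := pM) hpm L
  set M : ℝ := 4 * (Lp : ℝ) ^ 2 * (1 + 2 * q) / (pm - 1) with hM
  have hM0 : 0 ≤ M := div_nonneg (by positivity) (by linarith)
  set σ : ℝ := ε / (4 * (C + 1)) with hσ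
  have hσ0 : 0 < σ := by positivity
  have hCσ : C * σ ≤ ε / 4 := by
    rw [hσ, ← mul_div_assoc, div_le_div_iff₀ (by positivity) (by positivity)]
    nlinarith
  have hpg : Continuous (gradient p) :=
    (InnerProductSpace.toDual ℝ 𝔼).symm.continuous.comp (hp.continuous_fderiv one_ne_zero)
  obtain ⟨δ₁, hδ₁, hδ₁p⟩ := Metric.uniformContinuousOn_iff.1
    (hK.uniformContinuousOn_of_continuous hpg.continuousOn) σ hσ0
  obtain ⟨δ₂, hδ₂, hδ₂A⟩ := hAc.exists_thickening_subset_open isOpen_interior hAK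
  -- The admissible distance: `δ₁` controls the oscillation of `Dp`, `δ₂` keeps `y` in the interior
  -- of `K`, and the last two bounds control the oscillation of `h` and the Hessian error.
  obtain ⟨ρ, hρ0, hρ1, hρδ₁, hρδ₂, hρL, hρM⟩ : ∃ ρ : ℝ, 0 < ρ ∧ ρ ≤ 1 ∧ 2 * ρ ≤ δ₁ ∧ 2 * ρ ≤ δ₂ ∧
      L * (2 * ρ) ≤ m / 2 ∧ C * M * ρ ≤ ε / 4 := by
    have hCM : 0 ≤ C * M := mul_nonneg hC0 hM0
    refine ⟨min (min 1 (min (δ₁ / 2) (δ₂ / 2))) (min (m / (4 * (L + 1))) (ε / (4 * (C * M + 1)))),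
      by positivity, (min_le_left _ _).trans (min_le_left _ _), ?_, ?_, ?_, ?_⟩
    · have := (min_le_left (min 1 (min (δ₁ / 2) (δ₂ / 2)))
        (min (m / (4 * ((L : ℝ) + 1))) (ε / (4 * (C * M + 1))))).trans
        ((min_le_right _ _).trans (min_le_left _ _))
      linarith
    · have := (min_le_left (min 1 (min (δ₁ / 2) (δ₂ / 2)))
        (min (m / (4 * ((L : ℝ) + 1))) (ε / (4 * (C * M + 1))))).trans
        ((min_le_right _ _).trans (min_le_right _ _))
      linarith
    · have := (min_le_right (min 1 (min (δ₁ / 2) (δ₂ / 2)))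
        (min (m / (4 * ((L : ℝ) + 1))) (ε / (4 * (C * M + 1))))).trans (min_le_left _ _)
      calc _ ≤ (L : ℝ) * (2 * (m / (4 * (L + 1)))) := by gcongr
        _ ≤ (L + 1 : ℝ) * (2 * (m / (4 * (L + 1)))) := by gcongr; linarith
        _ = _ := by field_simp; norm_num
    · have := (min_le_right (min 1 (min (δ₁ / 2) (δ₂ / 2)))
        (min (m / (4 * ((L : ℝ) + 1))) (ε / (4 * (C * M + 1))))).trans (min_le_right _ _)
      calc _ ≤ C * M * (ε / (4 * (C * M + 1))) := by gcongr
        _ ≤ (C * M + 1) * (ε / (4 * (C * M + 1))) := by gcongr; linarith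
        _ = _ := by field_simp
  set t : ℝ := (ρ ^ 2) ^ (q + 1) with ht
  have ht0 : 0 < t := by positivity
  have ht1 : t ≤ 1 := pow_le_one₀ (by positivity) (pow_le_one₀ hρ0.le hρ1)
  -- Any maximum point pays less than `N - u z₁` in each kernel term, and `t` is the kernel at
  -- distance `ρ`; this multiple therefore forces distances below `ρ`.
  set j : ℝ := (|N - u z₁| + 1) / t with hj
  have hj1 : 1 ≤ j := by
    rw [hj, le_div_iff₀ ht0]
    linarith [abs_nonneg (N - u z₁)]
  have hj0 : 0 < j := by linarith
  have hjt : N - u z₁ < j * t := by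
    rw [hj, div_mul_cancel₀ _ ht0.ne']
    linarith [le_abs_self (N - u z₁)]
  set k : 𝔼 → ℝ := fun w => j * κ w with hk
  have hk2 : ContDiff ℝ 2 k := contDiff_const.mul hκ2
  have hk0 : k 0 = 0 := by simp [hk, hκ1 0 (by simp)]
  have hkd : ∀ w, fderiv ℝ k w = j • fderiv ℝ κ w := fun w =>
    fderiv_const_mul (hκ2.differentiable two_ne_zero w) j
  have hkpos : ∀ w, 0 ≤ k w := fun w => mul_nonneg hj0.le (hκ0 w)
  have hkg : ∀ w, ‖w‖ ^ 2 - 1 ≤ k w := fun w =>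
    (hκg w).trans (le_mul_of_one_le_left (hκ0 w) hj1)
  have hka : ∀ w e, k (w + e) ≤ k w + fderiv ℝ k w e + j * a * ‖e‖ ^ 2 := fun w e => by
    have := mul_le_mul_of_nonneg_left (hκa w e) hj0.le
    rw [hkd, _root_.smul_apply, smul_eq_mul]
    change j * κ (w + e) ≤ j * κ w + _ + _
    linarith
  have hnear : ∀ w, k w < j * t → ‖w‖ < ρ := fun w hw =>
    norm_lt_of_kernel_lt hκ1 hκ1' hρ0 hρ1 (lt_of_mul_lt_mul_left hw hj0.le)
  have hmaxfacts : ∀ x, ∀ y ∈ K, ∀ z ∈ K,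
      (∀ x', ∀ y' ∈ K, ∀ z' ∈ K, h y' - u z' - k (x' - y') - k (x' - z') ≤
        h y - u z - k (x - y) - k (x - z)) →
      ‖x - y‖ < ρ ∧ ‖x - z‖ < ρ ∧ ‖y - z‖ < 2 * ρ ∧ y ∈ interior K ∧ z ∈ interior K ∧ u z < N := by
    intro x y hy z hz hmx
    have h1 := hmx x₀ x₀ hx₀K x₀ hx₀K
    rw [sub_self, hk0] at h1
    have h2 : u z₁ ≤ u z := hz₁ hz
    have h3 := hN' y hy
    have h4 := hkpos (x - y)
    have h5 := hkpos (x - z)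
    have h6 : ‖x - y‖ < ρ := hnear _ (by linarith)
    have h7 : ‖x - z‖ < ρ := hnear _ (by linarith)
    have h8 : ‖y - z‖ < 2 * ρ := by
      have : y - z = (x - z) - (x - y) := by abel
      rw [this]
      linarith [norm_sub_le (x - z) (x - y)]
    have h9 : u z < N := by linarith
    have h10 : h y - h z ≤ m / 2 := by
      have := hL.norm_sub_le hy hz
      have h11 := le_abs_self (h y - h z)
      rw [← Real.norm_eq_abs] at h11
      have h12 : (L : ℝ) * ‖y - z‖ ≤ L * (2 * ρ) := by gcongr
      linarith
    -- The maximum is at least `m`, and replacing `h y` by `h z` costs at most `m / 2`.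
    have hzA : z ∈ A := ⟨hKD hz, by
      rw [huN z hz h9, EReal.coe_le_coe_iff]; linarith⟩
    refine ⟨h6, h7, h8, hδ₂A ?_, hAK (subset_closure hzA), h9⟩
    exact Metric.mem_thickening_iff.2 ⟨z, subset_closure hzA, by
      rw [dist_eq_norm]; linarith⟩
  have hηfact : ∀ x, ∀ y ∈ K, ∀ z ∈ K,
      (∀ x', ∀ y' ∈ K, ∀ z' ∈ K, h y' - u z' - k (x' - y') - k (x' - z') ≤
        h y - u z - k (x - y) - k (x - z)) → gradient k (x - z) ≠ 0 := by
    intro x y hy z hz hmx h0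
    obtain ⟨h1, h2, -, hyi, -, -⟩ := hmaxfacts x y hy z hz hmx
    have hkD := hk2.differentiable two_ne_zero
    -- Stationarity in `x`: if the gradient vanishes at `x - z`, it also vanishes at `x - y`, so `x
    -- = y`. Maximality in `y` then places a flat power above `h` at that point.
    have hcrit : fderiv ℝ k (x - y) + fderiv ℝ k (x - z) = 0 := by
      have d : ∀ c : 𝔼, HasFDerivAt (fun x' => k (x' - c)) (fderiv ℝ k (x - c)) x := fun c => by
        have d₀ : HasFDerivAt (fun x' => x' - c) (.id ℝ 𝔼) x := (hasFDerivAt_id x).sub_const c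
        exact (hkD (x - c)).hasFDerivAt.comp x d₀
      have hmin : IsLocalMin (fun x' => k (x' - y) + k (x' - z)) x :=
        Eventually.of_forall fun x' => by
          have := hmx x' y hy z hz
          simp only
          linarith
      exact hmin.hasFDerivAt_eq_zero ((d y).add (d z))
    have h3 : fderiv ℝ k (x - z) = 0 := by simpa [gradient] using h0
    have h4 : gradient k (x - y) = 0 := by
      rw [h3, add_zero] at hcrit
      simp [gradient, hcrit]
    rw [(gradient_fderiv_kernel hq1 hκ1 hj0 (h1.trans_le hρ1)).1] at h4
    have hxy : x = y := by
      rcases smul_eq_zero.1 h4 with h5 | h5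
      · have h6 : ‖x - y‖ = 0 := by
          by_contra hne
          have : 0 < 2 * j * (q + 1) * (‖x - y‖ ^ 2) ^ q := by positivity
          linarith
        exact sub_eq_zero.1 (norm_eq_zero.1 h6)
      · exact sub_eq_zero.1 h5
    subst hxy
    refine not_eventually_le_norm_pow hp hε hpm hpD hLip hsol (hKD hy) hq1 hq j ?_
    filter_upwards [mem_interior_iff_mem_nhds.1 hyi, Metric.ball_mem_nhds x one_pos] with y' hy' hb
    have h5 := hmx x y' hy' z hz
    rw [sub_self, hk0] at h5
    have h6 : k (x - y') = j * (‖y' - x‖ ^ 2) ^ (q + 1) := by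
      rw [← dist_eq_norm y' x, dist_comm, dist_eq_norm]
      rw [Metric.mem_ball, dist_comm, dist_eq_norm] at hb
      simp only [hk, hκ1 _ hb.le]
    linarith
  obtain ⟨x, y, z, X, Y, hy, hz, hmx, hXY, hgrad, hX, hY⟩ := exists_maximizer_jets hp hD
    (fun x hx => ⟨hpm.trans_le (hpD x hx).1, (hpD x hx).2⟩) hLip hsol hv hK ⟨x₀, hx₀K⟩ hKD hu huv
    huN hk2 hkpos hkg (mul_pos hj0 ha) hka (fun x y hy z hz hmx => by
      obtain ⟨-, -, -, h1, h2, h3⟩ := hmaxfacts x y hy z hz hmx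
      exact ⟨h1, h2, h3, hηfact x y hy z hz hmx⟩)
  obtain ⟨hxy, hxz, hyz, hyi, hzi, -⟩ := hmaxfacts x y hy z hz hmx
  have hη := hηfact x y hy z hz hmx
  set η := gradient k (x - z) with hηd
  obtain ⟨gy, -⟩ := gradient_fderiv_kernel hq1 hκ1 hj0 (hxy.trans_le hρ1)
  obtain ⟨gz, Hz⟩ := gradient_fderiv_kernel hq1 hκ1 hj0 (hxz.trans_le hρ1)
  have hηn : ‖η‖ = 2 * j * (q + 1) * (‖x - z‖ ^ 2) ^ q * ‖x - z‖ := by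
    rw [hηd, gz, norm_smul, Real.norm_of_nonneg (by positivity)]
  have hηn' : ‖η‖ = 2 * j * (q + 1) * (‖x - y‖ ^ 2) ^ q * ‖x - y‖ := by
    rw [← hgrad, norm_neg, gy, norm_smul, Real.norm_of_nonneg (by positivity)]
  -- The two kernel gradients are opposite, and their norm is strictly increasing in the distance.
  have hnn : ‖x - y‖ = ‖x - z‖ := by
    have h1 : ‖x - y‖ ^ (2 * q + 1) = ‖x - z‖ ^ (2 * q + 1) := by
      have h2 : (2 * j * (q + 1)) * ‖x - y‖ ^ (2 * q + 1) =
          (2 * j * (q + 1)) * ‖x - z‖ ^ (2 * q + 1) := by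
        rw [pow_succ, pow_succ, pow_mul, pow_mul]
        linarith
      exact mul_left_cancel₀ (by positivity) h2
    exact (pow_left_inj₀ (norm_nonneg _) (norm_nonneg _) (by omega)).1 h1
  have hr : 0 < ‖x - z‖ := by
    by_contra! h0
    have h1 : ‖x - z‖ = 0 := le_antisymm h0 (norm_nonneg _)
    rw [h1, mul_zero] at hηn
    exact hη (norm_eq_zero.1 hηn)
  have hyz2 : ‖y - z‖ ≤ 2 * ‖x - z‖ := by
    have : y - z = (x - z) - (x - y) := by abel
    rw [this]
    linarith [norm_sub_le (x - z) (x - y)]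
  -- As `y` maximizes `h - k (x - ·)` locally, the slope of the kernel cannot exceed the Lipschitz
  -- constant of `h`; this bound does not depend on `j`.
  have hηL : ‖η‖ ≤ L := by
    have h1 : HasFDerivAt (fun y' => k (x - y')) (-fderiv ℝ k (x - y)) y := by
      have h2 : HasFDerivAt (fun y' => x - y') (-(ContinuousLinearMap.id ℝ 𝔼)) y := by
        simpa using (hasFDerivAt_id y).const_sub x
      have := ((hk2.differentiable two_ne_zero) (x - y)).hasFDerivAt.comp y h2
      rwa [ContinuousLinearMap.comp_neg, ContinuousLinearMap.comp_id] at this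
    have h3 := norm_le_of_neg_mul_norm_le L.coe_nonneg h1 (by
      filter_upwards [mem_interior_iff_mem_nhds.1 hyi] with y' hy'
      have h4 := hmx x y' hy' z hz
      have h5 := hL.norm_sub_le hy' hy
      rw [Real.norm_eq_abs] at h5
      have h6 := neg_abs_le (h y' - h y)
      linarith)
    rwa [← hgrad, norm_neg, norm_gradient_eq, ← norm_neg]
  have hpy := hpD y (hKD hy)
  have hpz := hpD z (hKD hz)
  obtain ⟨hC1, hC2⟩ := hC (p y) hpy.1 hpy.2 ‖η‖ (norm_pos_iff.2 hη) hηL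
  have hfin := le_of_le_doubled_pxOperator (Lp := Lp) (q := q) (σ := σ) hpm hpy.1 hpz.1 hη hr hC1
    hC2 hηn.symm (H := fderiv ℝ (fderiv ℝ k) (x - z)) (by
      refine (Hz _).trans ?_
      rw [norm_smul, norm_inv, norm_norm, inv_mul_cancel₀ (norm_ne_zero_iff.2 hη), one_pow, mul_one])
    (by
      have h1 := hLp.norm_sub_le hy hz
      rw [Real.norm_eq_abs] at h1
      exact h1.trans (by gcongr))
    (by
      have := hδ₁p y hy z hz (by rw [dist_eq_norm]; linarith)
      rw [dist_eq_norm] at this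
      exact this.le)
    (hX.trans (pxOperator_le_of_forall_pxOperator_le (hpm.trans_le hpy.1) (hpm.trans_le hpz.1)
      hη hXY hY))
  have h1 : C * M * ‖x - z‖ ≤ C * M * ρ :=
    mul_le_mul_of_nonneg_left hxz.le (mul_nonneg hC0 hM0)
  -- The two error terms are at most `ε / 4` each, so `ε ≤ ε / 2`.
  linarith

end Comparison

/-! ### Change of sign, reducing subsolutions to supersolutions. -/

section Reflection

variable {n : ℕ}
local notation "𝔼" => EuclideanSpace ℝ (Fin n)

theorem gradient_neg (φ : 𝔼 → ℝ) : gradient (fun x => -φ x) = fun x => -gradient φ x := by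
  ext1 x
  rw [gradient, fderiv_fun_neg, map_neg, gradient]

theorem pxLaplacian_neg (p φ : 𝔼 → ℝ) (x : 𝔼) :
    pxLaplacian p (fun x => -φ x) x = -pxLaplacian p φ x := by
  have h1 : fderiv ℝ (fun x => -φ x) = fun x => -fderiv ℝ φ x := by
    ext1 y; exact fderiv_fun_neg
  have h2 : fderiv ℝ (fderiv ℝ fun x => -φ x) x = -fderiv ℝ (fderiv ℝ φ) x := by
    rw [h1]; exact fderiv_fun_neg
  have h3 : Δ (fun x => -φ x) x = -Δ φ x := congrFun (InnerProductSpace.laplacian_neg (f := φ)) x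
  rw [pxLaplacian, pxLaplacian, normalizedInfLaplacian, normalizedInfLaplacian, h2, h3,
    congrFun (gradient_neg φ) x]
  simp only [norm_neg, smul_neg, map_neg, inner_neg_right, _root_.neg_apply]
  ring

theorem IsViscositySubsolution.neg {p : 𝔼 → ℝ} {D : Opens 𝔼} {u : 𝔼 → EReal}
    (hu : IsViscositySubsolution p D u) : IsViscositySupersolution p D fun x => -u x where
  ne_bot x hx := by
    rw [Ne, EReal.neg_eq_bot_iff]; exact hu.ne_top x hx
  lsc x hx c hc := by
    filter_upwards [hu.usc x hx (-c) (EReal.lt_neg_comm.1 hc)] with y hy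
    exact EReal.lt_neg_comm.1 hy
  finite_ae := by
    filter_upwards [hu.finite_ae] with x hx
    rw [Ne, EReal.neg_eq_top_iff]; exact hx
  touching φ hφ x₀ hx₀ h0 hlt hne := by
    have h1 := hu.touching (fun x => -φ x) hφ.neg x₀ hx₀
      (by rw [EReal.coe_neg, ← h0, neg_neg]) (fun x hx hxx => by
        rw [EReal.coe_neg]; exact EReal.lt_neg_comm.1 (hlt x hx hxx))
      (by rw [congrFun (gradient_neg φ) x₀]; exact neg_ne_zero.2 hne)
    rw [pxLaplacian_neg, neg_neg] at h1
    linarith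

theorem MemVarLp.neg {F : Type*} [NormedAddCommGroup F] {p : 𝔼 → ℝ} {D : Opens 𝔼} {f : 𝔼 → F}
    (hf : MemVarLp p D f) : MemVarLp p D fun x => -f x :=
  ⟨hf.1.neg, by simpa only [norm_neg] using hf.2⟩

theorem IsWeakSolution.neg {p : 𝔼 → ℝ} {c : ℝ} {D : Opens 𝔼} {h : 𝔼 → ℝ}
    (hh : IsWeakSolution p c D h) : IsWeakSolution p (-c) D fun x => -h x := by
  obtain ⟨G, ⟨⟨h1, h2, h3⟩, h4⟩, h5⟩ := hh
  refine ⟨fun x => -G x, ⟨⟨fun x hx => ?_, fun x hx => ?_, fun φ => ?_⟩, fun Ω hΩ hΩD =>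
    ⟨(h4 Ω hΩ hΩD).1.neg, (h4 Ω hΩ hΩD).2.neg⟩⟩, fun φ => ?_⟩
  · exact (h1 x hx).neg
  · exact (h2 x hx).neg
  · simp only [neg_smul, smul_neg, integral_neg, h3 φ]
  · simp only [norm_neg, smul_neg, inner_neg_left, neg_mul, integral_neg, h5 φ]

end Reflection

end PxLaplace
end
theorem proposition4p3 {n : ℕ} (p : EuclideanSpace ℝ (Fin n) → ℝ) (hp : ContDiff ℝ 1 p)
    (D : Opens (EuclideanSpace ℝ (Fin n)))
    (hD : Bornology.IsBounded (D : Set (EuclideanSpace ℝ (Fin n))))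
    (hpD : ∃ pm pM : ℝ, 1 < pm ∧ ∀ x ∈ D, pm ≤ p x ∧ p x ≤ pM)
    (ε : ℝ) (hε : 0 < ε) :
    (∀ (v : EuclideanSpace ℝ (Fin n) → EReal) (h : EuclideanSpace ℝ (Fin n) → ℝ),
      PxLaplace.IsViscositySupersolution p D v →
      LocallyLipschitzOn (D : Set (EuclideanSpace ℝ (Fin n))) h →
      PxLaplace.IsWeakSolution p (-ε) D h →
      (∀ z ∈ frontier (D : Set (EuclideanSpace ℝ (Fin n))),
        0 ≤ liminf (fun x => v x - (h x : EReal))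
          (𝓝[(D : Set (EuclideanSpace ℝ (Fin n)))] z)) →
      ∀ x ∈ D, (h x : EReal) ≤ v x) ∧
    (∀ (u : EuclideanSpace ℝ (Fin n) → EReal) (h : EuclideanSpace ℝ (Fin n) → ℝ),
      PxLaplace.IsViscositySubsolution p D u →
      LocallyLipschitzOn (D : Set (EuclideanSpace ℝ (Fin n))) h →
      PxLaplace.IsWeakSolution p ε D h →
      (∀ z ∈ frontier (D : Set (EuclideanSpace ℝ (Fin n))),
        limsup (fun x => u x - (h x : EReal))
          (𝓝[(D : Set (EuclideanSpace ℝ (Fin n)))] z) ≤ 0) →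
      ∀ x ∈ D, u x ≤ (h x : EReal)) := by 
  obtain ⟨pm, pM, hpm, hpM⟩ := hpD
  refine ⟨fun v h hv hLip hsol hbd =>
    PxLaplace.le_of_isViscositySupersolution hp hD hpm hpM hε hv hLip hsol hbd,
    fun u h hu hLip hsol hbd x hx => ?_⟩
  have hLip' : LocallyLipschitzOn (D : Set (EuclideanSpace ℝ (Fin n))) fun x => -h x := hLip.neg
  have hcmp := PxLaplace.le_of_isViscositySupersolution hp hD hpm hpM hε hu.neg hLip' hsol.neg
    (fun z hz => ?_) x hx
  · rw [EReal.coe_neg] at hcmp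
    exact EReal.neg_le_neg_iff.1 hcmp
  -- Negation distributes over this extended-real difference because `h x` is finite, and it
  -- exchanges `limsup` and `liminf`.
  · have hfun : (fun x => -u x - ((-h x : ℝ) : EReal)) = -fun x => u x - (h x : EReal) := by
      ext1 x
      rw [Pi.neg_apply, EReal.coe_neg, EReal.neg_sub (Or.inr (EReal.coe_ne_bot _))
        (Or.inr (EReal.coe_ne_top _)), sub_eq_add_neg, neg_neg]
    rw [hfun, EReal.liminf_neg]
    exact EReal.le_neg_of_le_neg (by simpa using hbd z hz)
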